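/- Let $X$ be a scheme (for instance, of finite type over $\mathbb C$), let $$0\to K\to V\xrightarrow{\ \rho\ } W\to 0$$ be an exact sequence of vector bundles on $X$ of ranks $N-r$, $N$, $r$, and let $0\le s\le r$. For a vector bundle $V$ on $X$, the Grassmann bundle $\mathbb G_s(V)\to X$ is the $X$-scheme, equipped with a tautological rank $s$ subbundle of the pull-back of $V$, that is universal with this property: $X$-morphisms from $f\colon T\to X$ to $\mathbb G_s(V)$ correspond, by pulling back the tautological subbundle, to rank $s$ subbundles of $f^*V$. An affine linear bundle of rank $n$ on a scheme $Y$ is a morphism $E\to Y$ together with a Zariski open cover $\{U_i\}$ of $Y$ and isomorphisms $E|_{U_i}\cong \mathbb A^n\times U_i$ over $U_i$ whose transition functions on $U_i\cap U_j$ have the form $v\mapsto g_{ij}v+t_{ij}$ with $g_{ij}\in GL_n(\mathcal O(U_i\cap U_j))$ and $t_{ij}\in\mathcal O(U_i\cap U_j)^n$; its associated vector bundle is the vector bundle with transition functions $g_{ij}$. Then the Grassmann bundles $\mathbb G_s(V)$ and $\nu\colon \mathbb G_s(W)\to X$ exist. Let $S\subset \nu^*W$ be the tautological subbundle. The set $\mathbb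 G_s(V)_K$ of points of $\mathbb G_s(V)$ whose corresponding $s$-plane in the fibre of $V$ meets the fibre of $K$ only in $0$ is open. Regarding it as an open subscheme, there is a unique morphism $\pi\colon\mathbb G_s(V)_K\to\mathbb G_s(W)$ over $X$ sending an $s$-plane $p$ to $\rho(p)$ (that is, such that $\rho$ maps the tautological bundle on $\mathbb G_s(V)_K$ into $\pi^*S$), and $\pi$ has the structure of an affine linear bundle on $\mathbb G_s(W)$ of rank $s(N-r)$, with associated vector bundle isomorphic to $\operatorname{Hom}(S,\nu^*K)$. -/

import Mathlib

open CategoryTheory AlgebraicGeometry TopologicalSpace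

universe u

noncomputable section

namespace GrassBundle

/-- Restriction of functions `𝒪_X(U) → 𝒪_X(O)` for open sets `O ≤ U`. -/
def res {X : Scheme.{u}} {U O : X.Opens} (h : O ≤ U) : Γ(X, U) →+* Γ(X, O) :=
  (X.presheaf.map (homOfLE h).op).hom

/-- Pull-back of functions `𝒪_Y(U) → 𝒪_X(O)` along `f : X ⟶ Y`, for `O ≤ f ⁻¹ U`. -/
def pull {X Y : Scheme.{u}} (f : X ⟶ Y) {U : Y.Opens} {O : X.Opens} (h : O ≤ f ⁻¹ᵁ U) :
    Γ(Y, U) →+* Γ(X, O) :=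
  (f.appLE U O h).hom

/-- Value of functions at a point: `𝒪_X(U) → κ(x)` for `x ∈ U`. -/
def eval {X : Scheme.{u}} {U : X.Opens} (x : X) (hx : x ∈ U) : Γ(X, U) →+* X.residueField x :=
  (X.evaluation U x hx).hom

/-- Germs of functions: `𝒪_X(U) → 𝒪_{X,x}` for `x ∈ U`. -/
def germ {X : Scheme.{u}} {U : X.Opens} (x : X) (hx : x ∈ U) : Γ(X, U) →+* X.presheaf.stalk x :=
  (X.presheaf.germ U x hx).hom

lemma res_res {X : Scheme.{u}} {U V O : X.Opens} (h : V ≤ U) (h' : O ≤ V) (a : Γ(X, U)) :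
    res h' (res h a) = res (h'.trans h) a := by
  have := X.presheaf.map_comp (homOfLE h).op (homOfLE h').op
  exact (congrArg (fun φ => φ.hom a) this).symm

lemma pull_res {X Y : Scheme.{u}} (f : X ⟶ Y) {U V : Y.Opens} {O : X.Opens} (h : V ≤ U)
    (h' : O ≤ f ⁻¹ᵁ V) (a : Γ(Y, U)) :
    pull f h' (res h a) = pull f (h'.trans ((Opens.map f.base).map (homOfLE h)).le) a :=
  congrArg (fun φ => φ.hom a) (f.map_appLE h' (homOfLE h).op)

lemma res_pull {X Y : Scheme.{u}} (f : X ⟶ Y) {U : Y.Opens} {O O' : X.Opens}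
    (h : O ≤ f ⁻¹ᵁ U) (h' : O' ≤ O) (a : Γ(Y, U)) :
    res h' (pull f h a) = pull f (h'.trans h) a :=
  congrArg (fun φ => φ.hom a) (f.appLE_map h (homOfLE h').op)

lemma pull_pull {X Y Z : Scheme.{u}} (f : X ⟶ Y) (g : Y ⟶ Z) {U : Z.Opens} {V : Y.Opens}
    {O : X.Opens} (h : V ≤ g ⁻¹ᵁ U) (h' : O ≤ f ⁻¹ᵁ V) (a : Γ(Z, U)) :
    pull f h' (pull g h a) =
      pull (f ≫ g) (h'.trans ((Opens.map f.base).map (homOfLE h)).le) a :=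
  congrArg (fun φ => φ.hom a) (Scheme.Hom.appLE_comp_appLE f g U V O h h')

lemma pull_id {X : Scheme.{u}} {U O : X.Opens} (h : O ≤ U) (a : Γ(X, U)) :
    pull (𝟙 X) h a = res h a := by
  have : (𝟙 X : X ⟶ X).appLE U O h = X.presheaf.map (homOfLE h).op := by
    exact Category.id_comp _
  exact congrArg (fun ψ => ψ.hom a) this

/-- A vector bundle on `X` of rank the cardinality of the finite type `n`, given by its transition
functions `g i j : U i ∩ U j → GL_n`: in the trivialization over `U i` a vector is described by a
column `v_i`, and `v_i = g i j * v_j` over `U i ∩ U j`. (Invertibility of `g i j` follows from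
`g_self` and `g_mul`.) -/
structure VectorBundle (X : Scheme.{u}) (n : Type) [Fintype n] [DecidableEq n] where
  /-- the index set of the trivializing cover -/
  ι : Type u
  /-- the trivializing cover -/
  U : ι → X.Opens
  iSup_U : ⨆ i, U i = ⊤
  /-- the transition functions -/
  g : ∀ i j, Matrix n n Γ(X, U i ⊓ U j)
  g_self : ∀ i, g i i = 1
  g_mul : ∀ (i j k : ι) (O : X.Opens) (h₁ : O ≤ U i ⊓ U j) (h₂ : O ≤ U j ⊓ U k)
    (h₃ : O ≤ U i ⊓ U k), (g i j).map (res h₁) * (g j k).map (res h₂) = (g i k).map (res h₃)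

section Bundles

variable {n m l : Type} [Fintype n] [DecidableEq n] [Fintype m] [DecidableEq m]
  [Fintype l] [DecidableEq l]

/-- The pull-back `f^* V` of a vector bundle. -/
def VectorBundle.pullback {X Y : Scheme.{u}} (f : Y ⟶ X) (V : VectorBundle X n) :
    VectorBundle Y n where
  ι := V.ι
  U i := f ⁻¹ᵁ V.U i
  iSup_U := by
    rw [← Scheme.Hom.preimage_iSup, V.iSup_U]; rfl
  g i j := (V.g i j).map (pull f (le_refl (f ⁻¹ᵁ (V.U i ⊓ V.U j))))
  g_self i := by
    rw [V.g_self]; exact Matrix.map_one _ (map_zero _) (map_one _)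
  g_mul i j k O h₁ h₂ h₃ := by
    have hO : O ≤ f ⁻¹ᵁ (V.U i ⊓ V.U j ⊓ V.U k) := le_inf h₁ (h₂.trans inf_le_right)
    have key := congrArg
      (fun M : Matrix n n Γ(X, V.U i ⊓ V.U j ⊓ V.U k) => M.map (pull f hO))
      (V.g_mul i j k (V.U i ⊓ V.U j ⊓ V.U k) inf_le_left
        (fun x hx => ⟨hx.1.2, hx.2⟩) (fun x hx => ⟨hx.1.1, hx.2⟩))
    simp only [Matrix.map_mul, Matrix.map_map] at key ⊢
    convert key using 2 <;>
    · ext p q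
      exact (res_pull _ _ _ _).trans (pull_res _ _ _ _).symm

/-- The vector bundle `Hom(V, W) = V^* ⊗ W`. Over `W.U i ∩ V.U a` a homomorphism is a matrix
`F_{ia}`, and the transition functions are `F_{ia} = g^W_{ij} * F_{jb} * g^V_{ba}`,
where `g^V_{ba}` is the inverse of `g^V_{ab}`. -/
def VectorBundle.hom {X : Scheme.{u}} (V : VectorBundle X n) (W : VectorBundle X m) :
    VectorBundle X (m × n) where
  ι := W.ι × V.ι
  U c := W.U c.1 ⊓ V.U c.2
  iSup_U := by
    rw [iSup_prod]
    simp only [← inf_iSup_eq, V.iSup_U, inf_top_eq, W.iSup_U]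
  g c d := Matrix.of fun p q =>
    res (inf_le_inf inf_le_left inf_le_left) (W.g c.1 d.1 p.1 q.1) *
      res (le_inf (inf_le_right.trans inf_le_right) (inf_le_left.trans inf_le_right)) (V.g d.2 c.2 q.2 p.2)
  g_self c := by
    ext p q
    rw [Matrix.of_apply, W.g_self, V.g_self, Matrix.one_apply, Matrix.one_apply, Matrix.one_apply]
    rcases p with ⟨p₁, p₂⟩
    rcases q with ⟨q₁, q₂⟩
    by_cases h₁ : p₁ = q₁ <;> by_cases h₂ : p₂ = q₂ <;> simp [h₁, h₂, Ne.symm]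
  g_mul c d e O h₁ h₂ h₃ := by
    ext p q
    have kW := congrFun (congrFun (W.g_mul c.1 d.1 e.1 O (fun x hx => ⟨(h₁ hx).1.1, (h₁ hx).2.1⟩)
      (fun x hx => ⟨(h₂ hx).1.1, (h₂ hx).2.1⟩) (fun x hx => ⟨(h₃ hx).1.1, (h₃ hx).2.1⟩)) p.1) q.1
    have kV := congrFun (congrFun (V.g_mul e.2 d.2 c.2 O (fun x hx => ⟨(h₂ hx).2.2, (h₂ hx).1.2⟩)
      (fun x hx => ⟨(h₁ hx).2.2, (h₁ hx).1.2⟩) (fun x hx => ⟨(h₃ hx).2.2, (h₃ hx).1.2⟩)) q.2) p.2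
    simp only [Matrix.mul_apply, Matrix.map_apply, Matrix.of_apply, map_mul, res_res] at kW kV ⊢
    rw [← kW, ← kV, Fintype.sum_prod_type, Finset.sum_mul_sum]
    refine Finset.sum_congr rfl fun a _ => Finset.sum_congr rfl fun b _ => ?_
    ring

/-- A map of vector bundles `S → V` covering a morphism `f : T ⟶ X` of the bases, equivalently a
homomorphism `S → f^* V` of vector bundles on `T`, given by its matrices in the trivializations. -/
structure BundleMap {T X : Scheme.{u}} (f : T ⟶ X) (S : VectorBundle T n)
    (V : VectorBundle X m) where
  /-- the matrix over `f ⁻¹ (V.U i) ∩ S.U a`, so that `w_i = mat i a * v_a` -/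
  mat : ∀ i a, Matrix m n Γ(T, f ⁻¹ᵁ V.U i ⊓ S.U a)
  compat : ∀ (i j : V.ι) (a b : S.ι) (O : T.Opens) (h₁ : O ≤ f ⁻¹ᵁ (V.U i ⊓ V.U j))
    (h₂ : O ≤ S.U a ⊓ S.U b) (h₃ : O ≤ f ⁻¹ᵁ V.U i ⊓ S.U a) (h₄ : O ≤ f ⁻¹ᵁ V.U j ⊓ S.U b),
    (V.g i j).map (pull f h₁) * (mat j b).map (res h₄) =
      (mat i a).map (res h₃) * (S.g a b).map (res h₂)

/-- Homomorphisms of vector bundles on `X`. -/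
abbrev BundleHom {X : Scheme.{u}} (V : VectorBundle X n) (W : VectorBundle X m) :=
  BundleMap (𝟙 X) V W

/-- `χ : S' → V` is the composite of `φ : S' → S`, covering `h`, and `ψ : S → V`, covering `f`. -/
def IsComp {T' T X : Scheme.{u}} {h : T' ⟶ T} {f : T ⟶ X} {f' : T' ⟶ X}
    {S' : VectorBundle T' n} {S : VectorBundle T m} {V : VectorBundle X l}
    (φ : BundleMap h S' S) (ψ : BundleMap f S V) (χ : BundleMap f' S' V) : Prop :=
  h ≫ f = f' ∧ ∀ (i : V.ι) (b : S.ι) (a : S'.ι) (O : T'.Opens)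
    (h₁ : O ≤ h ⁻¹ᵁ (f ⁻¹ᵁ V.U i ⊓ S.U b)) (h₂ : O ≤ h ⁻¹ᵁ S.U b ⊓ S'.U a)
    (h₃ : O ≤ f' ⁻¹ᵁ V.U i ⊓ S'.U a),
    (χ.mat i a).map (res h₃) = (ψ.mat i b).map (pull h h₁) * (φ.mat b a).map (res h₂)

/-- The identity of a vector bundle. -/
def BundleHom.id {X : Scheme.{u}} (V : VectorBundle X n) : BundleHom V V where
  mat i a := V.g i a
  compat i j a b O h₁ h₂ h₃ h₄ := by
    have e : (V.g i j).map (pull (𝟙 X) h₁) = (V.g i j).map (res (O := O) h₁) := by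
      ext p q
      exact pull_id h₁ _
    rw [e]
    exact (V.g_mul i j b O h₁ h₄ (le_inf (h₃.trans inf_le_left) (h₂.trans inf_le_right))).trans
      (V.g_mul i a b O h₃ h₂ _).symm

/-- An isomorphism of vector bundles on `X`. -/
structure BundleIso {X : Scheme.{u}} (V : VectorBundle X n) (W : VectorBundle X m) where
  hom : BundleHom V W
  inv : BundleHom W V
  hom_inv : IsComp hom inv (BundleHom.id V)
  inv_hom : IsComp inv hom (BundleHom.id W)

/-- The base change of a bundle map `φ : S → V` covering `f` along `h : T' ⟶ T`, that is, the
composite `h^* S → S → V`. -/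
def BundleMap.baseChange {T' T X : Scheme.{u}} {f : T ⟶ X} {S : VectorBundle T n}
    {V : VectorBundle X m} (φ : BundleMap f S V) (h : T' ⟶ T) :
    BundleMap (h ≫ f) (S.pullback h) V where
  mat i a := (φ.mat i a).map (pull h (le_refl (h ⁻¹ᵁ (f ⁻¹ᵁ V.U i ⊓ S.U a))))
  compat i j a b O h₁ h₂ h₃ h₄ := by
    have hO : O ≤ h ⁻¹ᵁ (f ⁻¹ᵁ (V.U i ⊓ V.U j) ⊓ (S.U a ⊓ S.U b)) := le_inf h₁ h₂
    have key := congrArg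
      (fun M : Matrix m n Γ(T, f ⁻¹ᵁ (V.U i ⊓ V.U j) ⊓ (S.U a ⊓ S.U b)) => M.map (pull h hO))
      (φ.compat i j a b (f ⁻¹ᵁ (V.U i ⊓ V.U j) ⊓ (S.U a ⊓ S.U b)) inf_le_left inf_le_right
        (fun x hx => ⟨hx.1.1, hx.2.1⟩) (fun x hx => ⟨hx.1.2, hx.2.2⟩))
    simp only [Matrix.map_mul, Matrix.map_map] at key
    convert key using 2
    · ext p q
      simp only [Matrix.map_apply, Function.comp_apply, pull_pull]
    · ext p q
      exact (res_pull _ _ _ _).trans (pull_res _ _ _ _).symm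
    · ext p q
      exact (res_pull _ _ _ _).trans (pull_res _ _ _ _).symm
    · ext p q
      exact (res_pull _ _ _ _).trans (pull_res _ _ _ _).symm

/-- The linear map induced by a bundle map on the fibres at a point `x`, in the trivializations
indexed by `a` and `i`. -/
def BundleMap.fiber {T X : Scheme.{u}} {f : T ⟶ X} {S : VectorBundle T n} {V : VectorBundle X m}
    (φ : BundleMap f S V) (i : V.ι) (a : S.ι) (x : T) (hx : x ∈ f ⁻¹ᵁ V.U i ⊓ S.U a) :
    (n → T.residueField x) →ₗ[T.residueField x] (m → T.residueField x) :=
  ((φ.mat i a).map (eval x hx)).mulVecLin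

/-- A bundle map `S → V` covering `f` makes `S` a subbundle of `f^* V` when it is injective on all
fibres. -/
def BundleMap.IsSubbundle {T X : Scheme.{u}} {f : T ⟶ X} {S : VectorBundle T n}
    {V : VectorBundle X m} (φ : BundleMap f S V) : Prop :=
  ∀ (i : V.ι) (a : S.ι) (x : T) (hx : x ∈ f ⁻¹ᵁ V.U i ⊓ S.U a),
    Function.Injective (φ.fiber i a x hx)

/-- The linear map induced by a bundle map on germs of sections at a point `x`, in the
trivializations indexed by `a` and `i`. -/
def BundleMap.stalk {T X : Scheme.{u}} {f : T ⟶ X} {S : VectorBundle T n} {V : VectorBundle X m}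
    (φ : BundleMap f S V) (i : V.ι) (a : S.ι) (x : T) (hx : x ∈ f ⁻¹ᵁ V.U i ⊓ S.U a) :
    (n → T.presheaf.stalk x) →ₗ[T.presheaf.stalk x] (m → T.presheaf.stalk x) :=
  ((φ.mat i a).map (germ x hx)).mulVecLin

/-- The sequence `0 → K → V → W → 0` of vector bundles is exact: the sequences of `𝒪_{X,x}`-modules
of germs of sections are exact for all points `x`. -/
def ShortExact {X : Scheme.{u}} {K : VectorBundle X n} {V : VectorBundle X m} {W : VectorBundle X l}
    (φ : BundleHom K V) (ρ : BundleHom V W) : Prop :=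
  ∀ (a : K.ι) (b : V.ι) (c : W.ι) (x : X) (ha : x ∈ K.U a) (hb : x ∈ V.U b) (hc : x ∈ W.U c),
    Function.Injective (φ.stalk b a x ⟨hb, ha⟩) ∧
    Function.Exact (φ.stalk b a x ⟨hb, ha⟩) (ρ.stalk c b x ⟨hc, hb⟩) ∧
    Function.Surjective (ρ.stalk c b x ⟨hc, hb⟩)

/-- The Grassmann bundle `ν : 𝔾_s(V) → X` of `s`-planes in `V`, with its tautological subbundle
`S ⊆ ν^* V` of rank `s`: morphisms `T ⟶ 𝔾_s(V)` correspond to a morphism `f : T ⟶ X` together with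
a rank `s` subbundle of `f^* V`, the correspondence being `h ↦ (h ≫ ν, h^* S)`. -/
structure Grassmannian {X : Scheme.{u}} (V : VectorBundle X n) (s : ℕ) where
  /-- the total space -/
  G : Scheme.{u}
  /-- the projection -/
  ν : G ⟶ X
  /-- the tautological bundle -/
  S : VectorBundle G (Fin s)
  /-- the tautological inclusion -/
  incl : BundleMap ν S V
  incl_isSubbundle : incl.IsSubbundle
  existsUnique : ∀ {T : Scheme.{u}} (f : T ⟶ X) (S' : VectorBundle T (Fin s))
    (j : BundleMap f S' V), j.IsSubbundle →
    ∃! h : T ⟶ G, h ≫ ν = f ∧ ∃ k : BundleMap h S' S, IsComp k incl j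

/-- The set of points of `𝔾_s(V)` over which the `s`-plane meets (the image of) `K` trivially. -/
def Grassmannian.transverse {X : Scheme.{u}} {V : VectorBundle X n} {s : ℕ}
    (GV : Grassmannian V s) {K : VectorBundle X m} (φ : BundleHom K V) : Set GV.G :=
  {p | ∀ (i : V.ι) (a : GV.S.ι) (c : K.ι) (hi : p ∈ GV.ν ⁻¹ᵁ V.U i) (ha : p ∈ GV.S.U a)
    (hc : p ∈ GV.ν ⁻¹ᵁ K.U c),
    LinearMap.range (GV.incl.fiber i a p ⟨hi, ha⟩) ⊓
      LinearMap.range ((φ.baseChange GV.ν).fiber i c p ⟨hi, hc⟩) = ⊥}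

/-- `π : U ⟶ 𝔾_s(W)`, on an open `U ⊆ 𝔾_s(V)`, is the projection `p ↦ ρ(p)`: it is a morphism over
`X`, and the composite of the tautological inclusion over `U` with `ρ` maps the tautological bundle
of `𝔾_s(V)` into that of `𝔾_s(W)`. -/
def IsProjection {X : Scheme.{u}} {V : VectorBundle X n} {W : VectorBundle X m} {s : ℕ}
    (ρ : BundleHom V W) (GV : Grassmannian V s) (GW : Grassmannian W s) (U : GV.G.Opens)
    (π : U.toScheme ⟶ GW.G) : Prop :=
  π ≫ GW.ν = U.ι ≫ GV.ν ∧
  ∃ (d : BundleMap (U.ι ≫ GV.ν) (GV.S.pullback U.ι) W) (k : BundleMap π (GV.S.pullback U.ι) GW.S),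
    IsComp (GV.incl.baseChange U.ι) ρ d ∧ IsComp k GW.incl d

/-- The morphism `p⁻¹(U) ⟶ 𝔸^n × U` over `U` with coordinate functions `x`. -/
def chart {E Y : Scheme.{u}} (p : E ⟶ Y) (U : Y.Opens) (x : n → Γ(E, p ⁻¹ᵁ U)) :
    (p ⁻¹ᵁ U).toScheme ⟶ AffineSpace (ULift.{u} n) U.toScheme :=
  AffineSpace.homOfVector (p ∣_ U) fun k => (p ⁻¹ᵁ U).topIso.inv.hom (x k.down)

/-- The structure of an affine linear bundle on `p : E ⟶ Y`, of rank the cardinality of `n`: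
isomorphisms of `p⁻¹(U i)` with `𝔸^n × U i` over an open cover `U i` of `Y`, given by coordinate
functions `x i`, such that the transition functions take values in the group of affine linear maps,
that is, `x i = g i j * x j + t i j` over `U i ∩ U j`. The cover and the linear parts `g i j` form
the transition functions of the associated vector bundle `assoc`. -/
structure AffineLinearBundle {E Y : Scheme.{u}} (p : E ⟶ Y) (n : Type) [Fintype n]
    [DecidableEq n] where
  /-- the associated vector bundle -/
  assoc : VectorBundle Y n
  /-- the coordinate functions of the trivializations -/
  x : ∀ i, n → Γ(E, p ⁻¹ᵁ assoc.U i)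
  isIso_chart : ∀ i, IsIso (chart p (assoc.U i) (x i))
  /-- the translation parts of the transition functions -/
  t : ∀ i j, n → Γ(Y, assoc.U i ⊓ assoc.U j)
  transition : ∀ (i j : assoc.ι) (O : E.Opens) (h : O ≤ p ⁻¹ᵁ (assoc.U i ⊓ assoc.U j)),
    (fun k => res (h.trans ((Opens.map p.base).map (homOfLE inf_le_left)).le) (x i k)) =
      ((assoc.g i j).map (pull p h)).mulVec (fun k => res (h.trans ((Opens.map p.base).map (homOfLE inf_le_right)).le) (x j k)) +
        fun k => pull p h (t i j k)

end Bundles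

end GrassBundle

end

/-! Near each point of the base the sequence splits: there are matrices `F`, `P` of the two given
maps and `σ`, `θ` with `F * θ + σ * P = 1`. An `s`-plane `p` of `V` that meets `K` trivially is
carried isomorphically by `ρ` onto a plane `q` of `W`, and in terms of the splitting it is the graph
of a unique linear map from `q` to `K`. So over the part of the Grassmannian of `W` where a
splitting and a frame `A` of the tautological bundle are fixed, the fibre of `π` is a space of
matrices: lift `A` to the frame `B` of `p` with `P * B = A` and take the coordinates `x = θ * B`;
conversely `B = F * x + σ * A`. Another choice of splitting, trivializations and frame multiplies
`x` on the left by a transition function of `K`, on the right by one of `S`, and adds a term that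
depends only on `q`. The linear part is the transition function of `Hom(S, ν^* K)`. This is carried
by `Projection.exists_hom`, `Projection.hom_ext` and `Projection.exists_translation`.

The argument is by points with values in arbitrary schemes, described by local frames. Injectivity
on fibres is the same as local left invertibility of a matrix of functions
(`locSplit_iff_injective`), and a left invertible matrix can be cancelled; hence matrices found
locally are unique and glue. In this way a subbundle is determined by its local frames
(`exists_isComp_iff`), can be built from compatible ones (`exists_subbundle`), and two morphisms to
a Grassmannian over the base agree once their tautological bundles have common frames
(`Grassmannian.hom_ext`).

Grassmann bundles are glued from affine cells of matrices with an identity minor, two points being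
identified when their matrices have the same column span (`GluingRel.exists_glued`,
`nonempty_grassmannian`). Meeting `K` trivially means that `ρ` is injective on the tautological
bundle, an open condition on minors (`coe_injLocus_eq_transverse`); on that open set the image of
the tautological bundle is a subbundle of `W`, and its classifying morphism is `π`
(`exists_isProjection`). -/

set_option linter.unusedSectionVars false

noncomputable section

namespace GrassBundle

/-! ### Matrices of functions: gluing, local left inverses, invertible minors. -/

section Sections

variable {X Y Z T : Scheme.{u}}

lemma res_self {U : X.Opens} (h : U ≤ U) (a : Γ(X, U)) : res h a = a := by
  have := X.presheaf.map_id (Opposite.op U)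
  exact congrArg (fun φ => φ.hom a) this

/-- Two sections which agree near every point are equal. -/
lemma section_ext {O : X.Opens} {a b : Γ(X, O)}
    (H : ∀ x ∈ O, ∃ (O' : X.Opens) (h : O' ≤ O), x ∈ O' ∧ res h a = res h b) : a = b := by
  choose! U hU hx he using H
  refine TopCat.Sheaf.eq_of_locally_eq' X.sheaf (fun x : O => U x.1) O
    (fun x => homOfLE (hU x.1 x.2)) ?_ a b fun x => he x.1 x.2
  intro x hxO
  exact Opens.mem_iSup.mpr ⟨⟨x, hxO⟩, hx x hxO⟩

/-- Gluing of sections. -/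
lemma exists_section_glue {ι : Type*} (U : ι → X.Opens) (V : X.Opens) (hU : ∀ i, U i ≤ V)
    (hV : V ≤ iSup U) (a : ∀ i, Γ(X, U i))
    (H : ∀ i j, res (inf_le_left : U i ⊓ U j ≤ U i) (a i) = res inf_le_right (a j)) :
    ∃ s : Γ(X, V), ∀ i, res (hU i) s = a i := by
  obtain ⟨s, hs, -⟩ := TopCat.Sheaf.existsUnique_gluing' X.sheaf U V (fun i => homOfLE (hU i)) hV a
    (fun i j => H i j)
  exact ⟨s, hs⟩

lemma pull_isUnit_det {n : Type} [Fintype n] [DecidableEq n] (f : X ⟶ Y) {U : Y.Opens}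
    {O : X.Opens} (h : O ≤ f ⁻¹ᵁ U) {A : Matrix n n Γ(Y, U)} (hA : IsUnit A) :
    IsUnit (A.map (pull f h)) :=
  hA.map (pull f h).mapMatrix

section Matrices

variable {m n l : Type}

lemma map_res_self {U : X.Opens} (h : U ≤ U) (A : Matrix m n Γ(X, U)) : A.map (res h) = A := by
  ext i j; exact res_self _ _

lemma map_res_res {U V O : X.Opens} (h : V ≤ U) (h' : O ≤ V) (A : Matrix m n Γ(X, U)) :
    (A.map (res h)).map (res h') = A.map (res (h'.trans h)) := by
  ext i j; exact res_res _ _ _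

lemma map_pull_res (f : X ⟶ Y) {U V : Y.Opens} {O : X.Opens} (h : V ≤ U)
    (h' : O ≤ f ⁻¹ᵁ V) (A : Matrix m n Γ(Y, U)) :
    (A.map (res h)).map (pull f h') =
      A.map (pull f (h'.trans ((Opens.map f.base).map (homOfLE h)).le)) := by
  ext i j; exact pull_res _ _ _ _

lemma map_res_pull (f : X ⟶ Y) {U : Y.Opens} {O O' : X.Opens}
    (h : O ≤ f ⁻¹ᵁ U) (h' : O' ≤ O) (A : Matrix m n Γ(Y, U)) :
    (A.map (pull f h)).map (res h') = A.map (pull f (h'.trans h)) := by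
  ext i j; exact res_pull _ _ _ _

lemma map_pull_pull (f : X ⟶ Y) (g : Y ⟶ Z) {U : Z.Opens} {V : Y.Opens}
    {O : X.Opens} (h : V ≤ g ⁻¹ᵁ U) (h' : O ≤ f ⁻¹ᵁ V) (A : Matrix m n Γ(Z, U)) :
    (A.map (pull g h)).map (pull f h') =
      A.map (pull (f ≫ g) (h'.trans ((Opens.map f.base).map (homOfLE h)).le)) := by
  ext i j; exact pull_pull _ _ _ _ _

lemma map_pull_id {U O : X.Opens} (h : O ≤ (𝟙 X : X ⟶ X) ⁻¹ᵁ U) (A : Matrix m n Γ(X, U)) :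
    A.map (pull (𝟙 X) h) = A.map (res (O := O) h) := by
  ext i j; exact pull_id _ _

lemma map_pull_congr {f g : X ⟶ Y} (e : f = g) {U : Y.Opens} {O : X.Opens} (h : O ≤ f ⁻¹ᵁ U)
    (h' : O ≤ g ⁻¹ᵁ U) (A : Matrix m n Γ(Y, U)) : A.map (pull f h) = A.map (pull g h') := by
  subst e; rfl

lemma map_res_one [DecidableEq n] {U O : X.Opens} (h : O ≤ U) :
    (1 : Matrix n n Γ(X, U)).map (res h) = 1 :=
  Matrix.map_one _ (map_zero _) (map_one _)

lemma map_pull_one [DecidableEq n] (f : X ⟶ Y) {U : Y.Opens} {O : X.Opens} (h : O ≤ f ⁻¹ᵁ U) :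
    (1 : Matrix n n Γ(Y, U)).map (pull f h) = 1 :=
  Matrix.map_one _ (map_zero _) (map_one _)

lemma map_res_mul [Fintype n] {U O : X.Opens} (h : O ≤ U) (A : Matrix m n Γ(X, U))
    (B : Matrix n l Γ(X, U)) : (A * B).map (res h) = A.map (res h) * B.map (res h) :=
  Matrix.map_mul

lemma map_pull_mul [Fintype n] (f : X ⟶ Y) {U : Y.Opens} {O : X.Opens} (h : O ≤ f ⁻¹ᵁ U)
    (A : Matrix m n Γ(Y, U)) (B : Matrix n l Γ(Y, U)) :
    (A * B).map (pull f h) = A.map (pull f h) * B.map (pull f h) :=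
  Matrix.map_mul

lemma map_res_add {U O : X.Opens} (h : O ≤ U) (A B : Matrix m n Γ(X, U)) :
    (A + B).map (res h) = A.map (res h) + B.map (res h) :=
  Matrix.map_add _ (map_add _) _ _

lemma map_pull_add (f : X ⟶ Y) {U : Y.Opens} {O : X.Opens} (h : O ≤ f ⁻¹ᵁ U)
    (A B : Matrix m n Γ(Y, U)) :
    (A + B).map (pull f h) = A.map (pull f h) + B.map (pull f h) :=
  Matrix.map_add _ (map_add _) _ _

lemma mat_ext {O : X.Opens} {A B : Matrix m n Γ(X, O)}
    (H : ∀ x ∈ O, ∃ (O' : X.Opens) (h : O' ≤ O), x ∈ O' ∧ A.map (res h) = B.map (res h)) :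
    A = B := by
  ext i j
  refine section_ext fun x hx => ?_
  obtain ⟨O', h, hx', e⟩ := H x hx
  exact ⟨O', h, hx', congrFun (congrFun e i) j⟩

lemma exists_mat_glue {ι : Type*} (U : ι → X.Opens) (V : X.Opens) (hU : ∀ i, U i ≤ V)
    (hV : V ≤ iSup U) (A : ∀ i, Matrix m n Γ(X, U i))
    (H : ∀ i j, (A i).map (res (inf_le_left : U i ⊓ U j ≤ U i)) = (A j).map (res inf_le_right)) :
    ∃ B : Matrix m n Γ(X, V), ∀ i, B.map (res (hU i)) = A i := by
  have := fun p q => exists_section_glue U V hU hV (fun i => A i p q)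
    (fun i j => congrFun (congrFun (H i j) p) q)
  choose B hB using this
  exact ⟨Matrix.of B, fun i => by ext p q; exact hB p q i⟩

/-- Gluing of matrices which are uniquely characterized by a property. -/
lemma exists_mat_of_local {O : X.Opens} (P : ∀ O' : X.Opens, Matrix m n Γ(X, O') → Prop)
    (hres : ∀ (O' O'' : X.Opens) (h : O'' ≤ O') (K : Matrix m n Γ(X, O')), P O' K →
      P O'' (K.map (res h)))
    (huniq : ∀ (O' : X.Opens) (K K' : Matrix m n Γ(X, O')), P O' K → P O' K' → K = K')
    (hex : ∀ x ∈ O, ∃ O' ≤ O, x ∈ O' ∧ ∃ K, P O' K) :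
    ∃ K : Matrix m n Γ(X, O), ∀ x ∈ O, ∃ (O' : X.Opens) (h : O' ≤ O), x ∈ O' ∧
      P O' (K.map (res h)) := by
  choose! U hU hx K hK using hex
  obtain ⟨B, hB⟩ := exists_mat_glue (fun x : O => U x.1) O (fun x => hU x.1 x.2)
    (fun x hxO => Opens.mem_iSup.mpr ⟨⟨x, hxO⟩, hx x hxO⟩) (fun x => K x.1)
    (fun x y => huniq _ _ _ (hres _ _ _ _ (hK x.1 x.2)) (hres _ _ _ _ (hK y.1 y.2)))
  exact ⟨B, fun x hxO => ⟨U x, hU x hxO, hx x hxO, by rw [hB ⟨x, hxO⟩]; exact hK x hxO⟩⟩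

variable [Fintype m] [DecidableEq m] [Fintype n] [DecidableEq n] [Fintype l] [DecidableEq l]

/-- A matrix of functions is locally split if it has locally a left inverse. -/
def LocSplit {O : X.Opens} (A : Matrix m n Γ(X, O)) : Prop :=
  ∀ x ∈ O, ∃ (O' : X.Opens) (h : O' ≤ O), x ∈ O' ∧
    ∃ L : Matrix n m Γ(X, O'), L * A.map (res h) = 1

lemma LocSplit.res {O O' : X.Opens} {A : Matrix m n Γ(X, O)} (hA : LocSplit A) (h : O' ≤ O) :
    LocSplit (A.map (res h)) := by
  intro x hx
  obtain ⟨U, hU, hxU, L, hL⟩ := hA x (h hx)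
  refine ⟨U ⊓ O', inf_le_right, ⟨hxU, hx⟩, L.map (GrassBundle.res inf_le_left), ?_⟩
  have := congrArg (fun M => M.map (GrassBundle.res (inf_le_left : U ⊓ O' ≤ U))) hL
  simpa only [map_res_mul, map_res_res, map_res_one] using this

lemma LocSplit.pull (f : X ⟶ Y) {U : Y.Opens} {O : X.Opens} (h : O ≤ f ⁻¹ᵁ U)
    {A : Matrix m n Γ(Y, U)} (hA : LocSplit A) : LocSplit (A.map (pull f h)) := by
  intro x hx
  obtain ⟨V, hV, hxV, L, hL⟩ := hA (f x) (h hx)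
  refine ⟨f ⁻¹ᵁ V ⊓ O, inf_le_right, ⟨hxV, hx⟩, L.map (GrassBundle.pull f inf_le_left), ?_⟩
  have := congrArg (fun M => M.map (GrassBundle.pull f (inf_le_left : f ⁻¹ᵁ V ⊓ O ≤ f ⁻¹ᵁ V))) hL
  simpa only [map_pull_mul, map_pull_res, map_res_pull, map_pull_one] using this

lemma LocSplit.of_local {O : X.Opens} {A : Matrix m n Γ(X, O)}
    (H : ∀ x ∈ O, ∃ (O' : X.Opens) (h : O' ≤ O), x ∈ O' ∧ LocSplit (A.map (GrassBundle.res h))) :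
    LocSplit A := by
  intro x hx
  obtain ⟨O', h, hx', H'⟩ := H x hx
  obtain ⟨U, hU, hxU, L, hL⟩ := H' x hx'
  exact ⟨U, hU.trans h, hxU, L, by rw [map_res_res] at hL; exact hL⟩

lemma LocSplit.of_mul {O : X.Opens} {A : Matrix m n Γ(X, O)} {B : Matrix n l Γ(X, O)}
    (h : LocSplit (A * B)) : LocSplit B := by
  intro x hx
  obtain ⟨U, hU, hxU, L, hL⟩ := h x hx
  exact ⟨U, hU, hxU, L * A.map (GrassBundle.res hU), by
    rw [Matrix.mul_assoc, ← map_res_mul, hL]⟩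

lemma LocSplit.mul {O : X.Opens} {A : Matrix m n Γ(X, O)} {B : Matrix n l Γ(X, O)}
    (hA : LocSplit A) (hB : LocSplit B) : LocSplit (A * B) := by
  intro x hx
  obtain ⟨U, hU, hxU, L, hL⟩ := hA x hx
  obtain ⟨V, hV, hxV, M, hM⟩ := hB x hx
  refine ⟨U ⊓ V, inf_le_left.trans hU, ⟨hxU, hxV⟩,
    M.map (GrassBundle.res (inf_le_right : U ⊓ V ≤ V)) *
      L.map (GrassBundle.res (inf_le_left : U ⊓ V ≤ U)), ?_⟩
  have eL := congrArg (fun N => N.map (GrassBundle.res (inf_le_left : U ⊓ V ≤ U))) hL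
  have eM := congrArg (fun N => N.map (GrassBundle.res (inf_le_right : U ⊓ V ≤ V))) hM
  simp only [map_res_mul, map_res_res, map_res_one] at eL eM
  rw [map_res_mul, Matrix.mul_assoc, ← Matrix.mul_assoc (L.map _), eL, Matrix.one_mul, eM]

/-- Multiply by a local left inverse. This cancellation is behind nearly every uniqueness and gluing
argument below. -/
lemma LocSplit.cancel {O : X.Opens} {A : Matrix m n Γ(X, O)} (hA : LocSplit A)
    {B C : Matrix n l Γ(X, O)} (h : A * B = A * C) : B = C := by
  refine mat_ext fun x hx => ?_
  obtain ⟨U, hU, hxU, L, hL⟩ := hA x hx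
  refine ⟨U, hU, hxU, ?_⟩
  have := congrArg (fun N => L * N.map (GrassBundle.res hU)) h
  simpa only [map_res_mul, ← Matrix.mul_assoc, hL, Matrix.one_mul] using this

lemma eval_res {O O' : X.Opens} (h : O' ≤ O) (x : X) (hx : x ∈ O') (a : Γ(X, O)) :
    eval x hx (res h a) = eval x (h hx) a :=
  congrArg (X.residue x) (X.presheaf.germ_res_apply (homOfLE h) x hx a)

lemma isUnit_iff_eval {O : X.Opens} (a : Γ(X, O)) :
    IsUnit a ↔ ∀ x (hx : x ∈ O), eval x hx a ≠ 0 := by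
  refine ⟨fun h x hx => (h.map (eval x hx)).ne_zero, fun h => ?_⟩
  refine RingedSpace.isUnit_of_isUnit_germ X.toRingedSpace O a fun x hx => ?_
  exact (X.mem_basicOpen a x hx).mp
    ((X.evaluation_ne_zero_iff_mem_basicOpen x hx a).mp (h x hx))

lemma isUnit_of_left_inv {O : X.Opens} {L A : Matrix n n Γ(X, O)} (h : L * A = 1) : IsUnit A :=
  (Matrix.isUnit_iff_isUnit_det _).mpr (Matrix.isUnit_det_of_left_inverse h)

lemma isUnit_of_local {O : X.Opens} {A : Matrix n n Γ(X, O)}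
    (H : ∀ x ∈ O, ∃ (O' : X.Opens) (h : O' ≤ O), x ∈ O' ∧ IsUnit (A.map (res h))) :
    IsUnit A := by
  rw [Matrix.isUnit_iff_isUnit_det, isUnit_iff_eval]
  intro x hx e
  obtain ⟨O', h, hx', hu⟩ := H x hx
  have := (((Matrix.isUnit_iff_isUnit_det _).mp hu).map (eval x hx')).ne_zero
  apply this
  have e1 : (A.map (res h)).det = res h A.det := ((res h).map_det A).symm
  rw [e1, eval_res, e]

/-- A matrix over a field with linearly independent columns has an invertible maximal minor. -/
lemma exists_isUnit_submatrix {k : Type*} [Field k] {A : Matrix m n k}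
    (hA : Function.Injective A.mulVec) : ∃ I : n ↪ m, IsUnit (A.submatrix I id) := by
  obtain ⟨f, hf, -, hli⟩ := Submodule.exists_fun_fin_finrank_span_eq k (Set.range A.row)
  -- Row rank equals column rank, which is the number of columns by injectivity; so a basis of the
  -- row space chosen among the rows gives a square minor.
  have hr : Module.finrank k (Submodule.span k (Set.range A.row)) = Fintype.card n := by
    rw [← Matrix.rank_eq_finrank_span_row, Matrix.rank,
      LinearMap.finrank_range_of_inj (f := A.mulVecLin) hA, Module.finrank_fintype_fun_eq_card]
  choose g hg using hf
  let e : n ≃ Fin (Module.finrank k (Submodule.span k (Set.range A.row))) :=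
    (Fintype.equivFin n).trans (finCongr hr.symm)
  have hrow : A.row ∘ (g ∘ e) = f ∘ e := by
    funext i
    exact hg (e i)
  have hind : LinearIndependent k (f ∘ e) := hli.comp _ e.injective
  have hinj : Function.Injective (g ∘ e) :=
    Function.Injective.of_comp (f := A.row) (hrow ▸ hind.injective)
  refine ⟨⟨g ∘ e, hinj⟩, Matrix.linearIndependent_rows_iff_isUnit.mp ?_⟩
  have : (A.submatrix (g ∘ e) id).row = f ∘ e := hrow
  exact this ▸ hind

lemma isUnit_eval_iff {O : X.Opens} {A : Matrix n n Γ(X, O)} {x : X} (hx : x ∈ O) :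
    IsUnit (A.map (eval x hx)) ↔ x ∈ X.basicOpen A.det := by
  rw [Matrix.isUnit_iff_isUnit_det, ← X.evaluation_ne_zero_iff_mem_basicOpen x hx, isUnit_iff_ne_zero]
  have e1 : (A.map (eval x hx)).det = eval x hx A.det := ((eval x hx).map_det A).symm
  rw [e1]
  rfl

/-- A matrix of functions which is invertible at a point is invertible near that point. -/
lemma isUnit_map_res_basicOpen {O : X.Opens} (A : Matrix n n Γ(X, O)) :
    IsUnit (A.map (res (X.basicOpen_le A.det))) := by
  rw [Matrix.isUnit_iff_isUnit_det]
  have e1 : (A.map (res (X.basicOpen_le A.det))).det = res (X.basicOpen_le A.det) A.det :=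
    ((res (X.basicOpen_le A.det)).map_det A).symm
  rw [e1]
  exact RingedSpace.isUnit_res_basicOpen X.toRingedSpace A.det

/-- A maximal minor that is nonzero in the residue field stays invertible on the basic open set of
its determinant. -/
lemma exists_isUnit_minor {O : X.Opens} {A : Matrix m n Γ(X, O)} {x : X} (hx : x ∈ O)
    (hA : Function.Injective (A.map (eval x hx)).mulVec) :
    ∃ (I : n ↪ m) (O' : X.Opens) (h : O' ≤ O), x ∈ O' ∧
      IsUnit ((A.submatrix I id).map (res h)) := by
  obtain ⟨I, hI⟩ := exists_isUnit_submatrix hA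
  rw [Matrix.submatrix_map, isUnit_eval_iff] at hI
  exact ⟨I, _, X.basicOpen_le _, hI, isUnit_map_res_basicOpen _⟩

lemma LocSplit.of_minor {O : X.Opens} {A : Matrix m n Γ(X, O)} (I : n → m)
    (h : IsUnit (A.submatrix I id)) : LocSplit A := by
  intro x hx
  -- The left inverse selects the rows `I` and then inverts the minor.
  refine ⟨O, le_rfl, hx, (A.submatrix I id)⁻¹ * (1 : Matrix m m Γ(X, O)).submatrix I id, ?_⟩
  rw [map_res_self, Matrix.mul_assoc]
  have : (1 : Matrix m m Γ(X, O)).submatrix I id * A = A.submatrix I id := by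
    have := Matrix.submatrix_mul_equiv (1 : Matrix m m Γ(X, O)) A I (Equiv.refl m) id
    simpa using this
  rw [this]
  exact Matrix.nonsing_inv_mul _ ((Matrix.isUnit_iff_isUnit_det _).mp h)

lemma LocSplit.injective {O : X.Opens} {A : Matrix m n Γ(X, O)} (hA : LocSplit A) {x : X}
    (hx : x ∈ O) : Function.Injective (A.map (eval x hx)).mulVec := by
  obtain ⟨U, hU, hxU, L, hL⟩ := hA x hx
  have e : L.map (eval x hxU) * A.map (eval x hx) = 1 := by
    have := congrArg (fun M => M.map (eval x hxU)) hL
    simp only [Matrix.map_mul, Matrix.map_one _ (map_zero _) (map_one _), Matrix.map_map] at this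
    rw [← this]
    congr 1
    ext i j
    exact (eval_res hU x hxU (A i j)).symm
  intro u v huv
  have := congrArg (fun w => (L.map (eval x hxU)).mulVec w) huv
  simpa only [Matrix.mulVec_mulVec, e, Matrix.one_mulVec] using this

/-- A left inverse can be evaluated at points; conversely injectivity at a point gives an invertible
minor nearby. This replaces the fibrewise definition of a subbundle by one that works with functions
and is stable under base change. -/
lemma locSplit_iff_injective {O : X.Opens} {A : Matrix m n Γ(X, O)} :
    LocSplit A ↔ ∀ x (hx : x ∈ O), Function.Injective (A.map (eval x hx)).mulVec := by
  refine ⟨fun h x hx => h.injective hx, fun H => LocSplit.of_local fun x hx => ?_⟩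
  obtain ⟨I, O', h, hx', hu⟩ := exists_isUnit_minor hx (H x hx)
  exact ⟨O', h, hx', LocSplit.of_minor I hu⟩

lemma LocSplit.exists_minor {O : X.Opens} {A : Matrix m n Γ(X, O)} (hA : LocSplit A) {x : X}
    (hx : x ∈ O) : ∃ (I : n ↪ m) (O' : X.Opens) (h : O' ≤ O), x ∈ O' ∧
      IsUnit ((A.submatrix I id).map (GrassBundle.res h)) :=
  exists_isUnit_minor hx (hA.injective hx)

lemma LocSplit.isUnit {O : X.Opens} {A : Matrix n n Γ(X, O)} (hA : LocSplit A) : IsUnit A := by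
  refine isUnit_of_local fun x hx => ?_
  obtain ⟨U, hU, hxU, L, hL⟩ := hA x hx
  exact ⟨U, hU, hxU, isUnit_of_left_inv hL⟩

lemma LocSplit.of_isUnit {O : X.Opens} {A : Matrix n n Γ(X, O)} (hA : IsUnit A) : LocSplit A :=
  LocSplit.of_minor id hA

lemma isSubbundle_iff {f : T ⟶ X} {S : VectorBundle T n} {V : VectorBundle X m}
    (φ : BundleMap f S V) : φ.IsSubbundle ↔ ∀ i a, LocSplit (φ.mat i a) := by
  simp only [locSplit_iff_injective]
  exact Iff.rfl

end Matrices

end Sections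

/-! ### Change of trivialization, composition and base change of bundle maps. -/

section BundleMaps

variable {m n l : Type} [Fintype m] [DecidableEq m] [Fintype n] [DecidableEq n] [Fintype l]
  [DecidableEq l] {T T' T'' X Y : Scheme.{u}}

lemma opens_le_iff {U V : X.Opens} : U ≤ V ↔ ∀ x, x ∈ U → x ∈ V := Iff.rfl

lemma mem_preimage_iff (f : T ⟶ X) {U : X.Opens} {x : T} : x ∈ f ⁻¹ᵁ U ↔ f x ∈ U := Iff.rfl

lemma mem_inf_iff {U V : X.Opens} {x : X} : x ∈ U ⊓ V ↔ x ∈ U ∧ x ∈ V := Iff.rfl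

lemma mem_top_iff {x : X} : x ∈ (⊤ : X.Opens) ↔ True := Iff.rfl

lemma comp_apply_eq (f : T ⟶ X) (g : X ⟶ Y) (x : T) : (f ≫ g) x = g (f x) := rfl

lemma id_apply_eq (x : X) : (𝟙 X : X ⟶ X) x = x := rfl

/-- An inclusion of open sets, to be checked on points. -/
lemma sub {U V : X.Opens} (h : ∀ x, x ∈ U → x ∈ V := by
    simp only [GrassBundle.opens_le_iff, GrassBundle.mem_preimage_iff, GrassBundle.mem_inf_iff,
      GrassBundle.mem_top_iff, GrassBundle.comp_apply_eq, GrassBundle.id_apply_eq] at *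
    first
    | grind
    | grind [GrassBundle.opens_le_iff, GrassBundle.mem_preimage_iff, GrassBundle.mem_inf_iff]) :
    U ≤ V := h

lemma preimage_eq_of_comp_eq {h : T' ⟶ T} {f : T ⟶ X} {f' : T' ⟶ X} (e : h ≫ f = f')
    (U : X.Opens) : f' ⁻¹ᵁ U = h ⁻¹ᵁ f ⁻¹ᵁ U := by
  subst e; rfl

lemma VectorBundle.exists_mem (V : VectorBundle X n) (x : X) : ∃ i, x ∈ V.U i := by
  have : x ∈ ⨆ i, V.U i := by rw [V.iSup_U]; trivial
  exact Opens.mem_iSup.mp this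

lemma VectorBundle.res_g_self (V : VectorBundle X n) (i : V.ι) {O : X.Opens}
    (h : O ≤ V.U i ⊓ V.U i) : (V.g i i).map (res h) = 1 := by
  rw [V.g_self, map_res_one]

lemma VectorBundle.pull_g_self (V : VectorBundle X n) (f : T ⟶ X) (i : V.ι) {O : T.Opens}
    (h : O ≤ f ⁻¹ᵁ (V.U i ⊓ V.U i)) : (V.g i i).map (pull f h) = 1 := by
  rw [V.g_self, map_pull_one]

lemma VectorBundle.pull_g_mul (V : VectorBundle X n) (f : T ⟶ X) (i j k : V.ι) {O : T.Opens}
    (h₁ : O ≤ f ⁻¹ᵁ (V.U i ⊓ V.U j)) (h₂ : O ≤ f ⁻¹ᵁ (V.U j ⊓ V.U k))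
    (h₃ : O ≤ f ⁻¹ᵁ (V.U i ⊓ V.U k)) :
    (V.g i j).map (pull f h₁) * (V.g j k).map (pull f h₂) = (V.g i k).map (pull f h₃) := by
  have hO : O ≤ f ⁻¹ᵁ (V.U i ⊓ V.U j ⊓ V.U k) := sub
  have := congrArg (fun M => M.map (pull f hO)) (V.g_mul i j k _ sub sub sub)
  simpa only [map_pull_mul, map_pull_res] using this

lemma VectorBundle.isUnit_pull_g (V : VectorBundle X n) (f : T ⟶ X) (i j : V.ι) {O : T.Opens}
    (h : O ≤ f ⁻¹ᵁ (V.U i ⊓ V.U j)) : IsUnit ((V.g i j).map (pull f h)) :=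
  isUnit_of_left_inv ((V.pull_g_mul f j i j sub h sub).trans (V.pull_g_self f j _))

lemma VectorBundle.isUnit_res_g (V : VectorBundle X n) (i j : V.ι) {O : X.Opens}
    (h : O ≤ V.U i ⊓ V.U j) : IsUnit ((V.g i j).map (res h)) :=
  isUnit_of_left_inv ((V.g_mul j i j O sub h sub).trans (V.res_g_self j _))

lemma BundleMap.ext {f : T ⟶ X} {S : VectorBundle T n} {V : VectorBundle X m}
    {φ ψ : BundleMap f S V} (h : ∀ i a, φ.mat i a = ψ.mat i a) : φ = ψ := by
  cases φ; cases ψ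
  congr
  funext i a
  exact h i a

section

variable {f : T ⟶ X} {S : VectorBundle T n} {V : VectorBundle X m} (ψ : BundleMap f S V)

lemma BundleMap.res_mat_target (i j : V.ι) (a : S.ι) {O : T.Opens} (h₁ : O ≤ f ⁻¹ᵁ V.U i ⊓ S.U a)
    (h₂ : O ≤ f ⁻¹ᵁ (V.U i ⊓ V.U j)) (h₃ : O ≤ f ⁻¹ᵁ V.U j ⊓ S.U a) :
    (ψ.mat i a).map (res h₁) = (V.g i j).map (pull f h₂) * (ψ.mat j a).map (res h₃) := by
  rw [ψ.compat i j a a O h₂ sub h₁ h₃, S.res_g_self,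
    Matrix.mul_one]

lemma BundleMap.res_mat_source (i : V.ι) (a b : S.ι) {O : T.Opens} (h₁ : O ≤ f ⁻¹ᵁ V.U i ⊓ S.U b)
    (h₂ : O ≤ f ⁻¹ᵁ V.U i ⊓ S.U a) (h₃ : O ≤ S.U a ⊓ S.U b) :
    (ψ.mat i b).map (res h₁) = (ψ.mat i a).map (res h₂) * (S.g a b).map (res h₃) := by
  rw [← ψ.compat i i a b O sub h₃ h₂ h₁, V.pull_g_self,
    Matrix.one_mul]

lemma BundleMap.pull_mat_target (h : T' ⟶ T) (i j : V.ι) (a : S.ι) {O : T'.Opens}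
    (h₁ : O ≤ h ⁻¹ᵁ (f ⁻¹ᵁ V.U i ⊓ S.U a))
    (h₂ : O ≤ (h ≫ f) ⁻¹ᵁ (V.U i ⊓ V.U j)) (h₃ : O ≤ h ⁻¹ᵁ (f ⁻¹ᵁ V.U j ⊓ S.U a)) :
    (ψ.mat i a).map (pull h h₁) =
      (V.g i j).map (pull (h ≫ f) h₂) * (ψ.mat j a).map (pull h h₃) := by
  have hO : O ≤ h ⁻¹ᵁ (f ⁻¹ᵁ (V.U i ⊓ V.U j) ⊓ S.U a) := sub
  have := congrArg (fun M => M.map (pull h hO)) (ψ.res_mat_target i j a sub sub sub)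
  simpa only [map_pull_mul, map_pull_res, map_pull_pull] using this

lemma BundleMap.pull_mat_source (h : T' ⟶ T) (i : V.ι) (a b : S.ι) {O : T'.Opens}
    (h₁ : O ≤ h ⁻¹ᵁ (f ⁻¹ᵁ V.U i ⊓ S.U b))
    (h₂ : O ≤ h ⁻¹ᵁ (f ⁻¹ᵁ V.U i ⊓ S.U a)) (h₃ : O ≤ h ⁻¹ᵁ (S.U a ⊓ S.U b)) :
    (ψ.mat i b).map (pull h h₁) = (ψ.mat i a).map (pull h h₂) * (S.g a b).map (pull h h₃) := by
  have hO : O ≤ h ⁻¹ᵁ (f ⁻¹ᵁ V.U i ⊓ (S.U a ⊓ S.U b)) := sub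
  have := congrArg (fun M => M.map (pull h hO)) (ψ.res_mat_source i a b sub sub sub)
  simpa only [map_pull_mul, map_pull_res, map_pull_pull] using this

lemma BundleMap.res_baseChange_mat (h : T' ⟶ T) (i : V.ι) (a : S.ι) {O : T'.Opens}
    (h₁ : O ≤ (h ≫ f) ⁻¹ᵁ V.U i ⊓ (S.pullback h).U a)
    (h₂ : O ≤ h ⁻¹ᵁ (f ⁻¹ᵁ V.U i ⊓ S.U a)) :
    ((ψ.baseChange h).mat i a).map (res h₁) = (ψ.mat i a).map (pull h h₂) :=
  map_res_pull h _ _ _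

lemma BundleMap.pull_baseChange_mat (h : T' ⟶ T) (t : T'' ⟶ T') (i : V.ι) (a : S.ι)
    {O : T''.Opens} (h₁ : O ≤ t ⁻¹ᵁ ((h ≫ f) ⁻¹ᵁ V.U i ⊓ (S.pullback h).U a))
    (h₂ : O ≤ (t ≫ h) ⁻¹ᵁ (f ⁻¹ᵁ V.U i ⊓ S.U a)) :
    ((ψ.baseChange h).mat i a).map (pull t h₁) = (ψ.mat i a).map (pull (t ≫ h) h₂) :=
  map_pull_pull t h _ _ _

end

lemma IsComp.unique {h : T' ⟶ T} {f : T ⟶ X} {f' : T' ⟶ X}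
    {S' : VectorBundle T' n} {S : VectorBundle T m} {V : VectorBundle X l}
    {φ : BundleMap h S' S} {ψ : BundleMap f S V} {χ χ' : BundleMap f' S' V}
    (H : IsComp φ ψ χ) (H' : IsComp φ ψ χ') : χ = χ' := by
  obtain ⟨rfl, H⟩ := H
  refine BundleMap.ext fun i a => mat_ext fun x hx => ?_
  obtain ⟨b, hb⟩ := S.exists_mem (h x)
  refine ⟨((h ≫ f) ⁻¹ᵁ V.U i ⊓ S'.U a) ⊓ h ⁻¹ᵁ S.U b, inf_le_left, ⟨hx, hb⟩, ?_⟩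
  rw [H i b a _ sub sub inf_le_left, H'.2 i b a _ sub sub inf_le_left]

/-- Over a trivializing open set of the middle bundle the composite is a matrix product; the product
does not depend on that trivialization because the transition functions of `S` can be moved from one
factor to the other. The products therefore glue. -/
lemma exists_isComp {h : T' ⟶ T} {f : T ⟶ X}
    {S' : VectorBundle T' n} {S : VectorBundle T m} {V : VectorBundle X l}
    (φ : BundleMap h S' S) (ψ : BundleMap f S V) :
    ∃ χ : BundleMap (h ≫ f) S' V, IsComp φ ψ χ := by
  have key (i : V.ι) (b b' : S.ι) (a : S'.ι) (O : T'.Opens)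
      (h₁ : O ≤ h ⁻¹ᵁ (f ⁻¹ᵁ V.U i ⊓ S.U b)) (h₂ : O ≤ h ⁻¹ᵁ S.U b ⊓ S'.U a)
      (h₁' : O ≤ h ⁻¹ᵁ (f ⁻¹ᵁ V.U i ⊓ S.U b')) (h₂' : O ≤ h ⁻¹ᵁ S.U b' ⊓ S'.U a) :
      (ψ.mat i b).map (pull h h₁) * (φ.mat b a).map (res h₂) =
        (ψ.mat i b').map (pull h h₁') * (φ.mat b' a).map (res h₂') := by
    rw [ψ.pull_mat_source h i b b' h₁' h₁ sub, Matrix.mul_assoc,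
      ← φ.res_mat_target b b' a h₂ _ h₂']
  have le₁ (i : V.ι) (b : S.ι) (a : S'.ι) : ((h ≫ f) ⁻¹ᵁ V.U i ⊓ S'.U a) ⊓ h ⁻¹ᵁ S.U b ≤
    h ⁻¹ᵁ (f ⁻¹ᵁ V.U i ⊓ S.U b) := sub
  have le₂ (i : V.ι) (b : S.ι) (a : S'.ι) : ((h ≫ f) ⁻¹ᵁ V.U i ⊓ S'.U a) ⊓ h ⁻¹ᵁ S.U b ≤
    h ⁻¹ᵁ S.U b ⊓ S'.U a := sub
  have glue (i : V.ι) (a : S'.ι) : ∃ M : Matrix l n Γ(T', (h ≫ f) ⁻¹ᵁ V.U i ⊓ S'.U a),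
      ∀ b : S.ι, M.map (res (inf_le_left : ((h ≫ f) ⁻¹ᵁ V.U i ⊓ S'.U a) ⊓ h ⁻¹ᵁ S.U b ≤ _)) =
        (ψ.mat i b).map (pull h (le₁ i b a)) * (φ.mat b a).map (res (le₂ i b a)) := by
    refine exists_mat_glue _ _ _ ?_ _ ?_
    · intro x hx
      obtain ⟨b, hb⟩ := S.exists_mem (h x)
      exact Opens.mem_iSup.mpr ⟨b, hx, hb⟩
    · intro b b'
      simp only [map_res_mul, map_res_pull, map_res_res]
      exact key _ _ _ _ _ _ _ _ _
  choose M hM using glue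
  have hM' (i : V.ι) (b : S.ι) (a : S'.ι) (O : T'.Opens)
      (h₁ : O ≤ h ⁻¹ᵁ (f ⁻¹ᵁ V.U i ⊓ S.U b)) (h₂ : O ≤ h ⁻¹ᵁ S.U b ⊓ S'.U a)
      (h₃ : O ≤ (h ≫ f) ⁻¹ᵁ V.U i ⊓ S'.U a) :
      (M i a).map (res h₃) = (ψ.mat i b).map (pull h h₁) * (φ.mat b a).map (res h₂) := by
    have hO : O ≤ ((h ≫ f) ⁻¹ᵁ V.U i ⊓ S'.U a) ⊓ h ⁻¹ᵁ S.U b := le_inf h₃ (h₂.trans inf_le_left)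
    have := congrArg (fun N => N.map (res hO)) (hM i a b)
    simpa only [map_res_mul, map_res_pull, map_res_res] using this
  -- Compatibility is checked locally, after choosing a trivialization of the middle bundle.
  refine ⟨⟨M, fun i j a b O h₁ h₂ h₃ h₄ => mat_ext fun x hx => ?_⟩, rfl, hM'⟩
  obtain ⟨c, hc⟩ := S.exists_mem (h x)
  refine ⟨O ⊓ h ⁻¹ᵁ S.U c, inf_le_left, ⟨hx, hc⟩, ?_⟩
  simp only [map_res_mul, map_res_pull, map_res_res]
  rw [hM' j c b _ sub sub, hM' i c a _ sub sub,
    ← Matrix.mul_assoc, ← ψ.pull_mat_target h i j c sub _ _,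
    Matrix.mul_assoc, ← φ.res_mat_source c a b sub _ _]

lemma IsComp.baseChange {h : T' ⟶ T} {f : T ⟶ X} {f' : T' ⟶ X}
    {S' : VectorBundle T' n} {S : VectorBundle T m} {V : VectorBundle X l}
    {φ : BundleMap h S' S} {ψ : BundleMap f S V} {χ : BundleMap f' S' V}
    (H : IsComp φ ψ χ) (t : T'' ⟶ T') : IsComp (φ.baseChange t) ψ (χ.baseChange t) := by
  obtain ⟨rfl, H⟩ := H
  refine ⟨Category.assoc _ _ _, fun i b a O h₁ h₂ h₃ => ?_⟩
  have hO : O ≤ t ⁻¹ᵁ ((h ⁻¹ᵁ (f ⁻¹ᵁ V.U i ⊓ S.U b)) ⊓ (h ⁻¹ᵁ S.U b ⊓ S'.U a)) := le_inf h₁ h₂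
  have := congrArg (fun N => N.map (pull t hO)) (H i b a _ inf_le_left inf_le_right sub)
  rw [χ.res_baseChange_mat t i a h₃ h₃, φ.res_baseChange_mat t b a h₂ h₂]
  simpa only [map_pull_mul, map_pull_res, map_pull_pull] using this

lemma BundleMap.IsSubbundle.baseChange {f : T ⟶ X} {S : VectorBundle T n} {V : VectorBundle X m}
    {φ : BundleMap f S V} (hφ : φ.IsSubbundle) (t : T' ⟶ T) : (φ.baseChange t).IsSubbundle := by
  rw [isSubbundle_iff] at hφ ⊢
  exact fun i a => (hφ i a).pull t _

/-- In a factorization `χ = ψ ∘ φ` of a subbundle, `φ` is a subbundle. -/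
lemma IsComp.locSplit {h : T' ⟶ T} {f : T ⟶ X} {f' : T' ⟶ X}
    {S' : VectorBundle T' n} {S : VectorBundle T m} {V : VectorBundle X l}
    {φ : BundleMap h S' S} {ψ : BundleMap f S V} {χ : BundleMap f' S' V}
    (H : IsComp φ ψ χ) (hχ : χ.IsSubbundle) : φ.IsSubbundle := by
  obtain ⟨rfl, H⟩ := H
  rw [isSubbundle_iff] at hχ ⊢
  refine fun b a => LocSplit.of_local fun x hx => ?_
  obtain ⟨i, hi⟩ := V.exists_mem (f (h x))
  refine ⟨(h ⁻¹ᵁ S.U b ⊓ S'.U a) ⊓ h ⁻¹ᵁ f ⁻¹ᵁ V.U i, inf_le_left, ⟨hx, hi⟩, ?_⟩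
  have := (hχ i a).res (O' := (h ⁻¹ᵁ S.U b ⊓ S'.U a) ⊓ h ⁻¹ᵁ f ⁻¹ᵁ V.U i)
    sub
  rw [H i b a _ sub inf_le_left] at this
  exact this.of_mul

/-- The bundle with the transition functions of `V` with respect to a finer cover, up to a
renumbering of the coordinates. -/
def VectorBundle.refine (V : VectorBundle X n) (e : m ≃ n) (ι : Type u) (U : ι → X.Opens)
    (iSup_U : ⨆ c, U c = ⊤) (r : ι → V.ι) (hr : ∀ c, U c ≤ V.U (r c)) : VectorBundle X m where
  ι := ι
  U := U
  iSup_U := iSup_U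
  g c d := ((V.g (r c) (r d)).map (res (inf_le_inf (hr c) (hr d)))).submatrix e e
  g_self c := by rw [V.res_g_self, Matrix.submatrix_one_equiv]
  g_mul c d c' O h₁ h₂ h₃ := by
    simp only [← Matrix.submatrix_map, map_res_res]
    rw [Matrix.submatrix_mul_equiv, V.g_mul _ _ _ O]

end BundleMaps

/-! ### Gluing schemes along an equivalence relation on their points with values in schemes. -/

section Gluing

open Limits

/-- A gluing relation on a family of schemes `Z i`: an equivalence relation on the pairs of a point
and a chart, functorial in the points, which is represented by isomorphisms of open subschemes. -/
structure GluingRel {J : Type u} (Z : J → Scheme.{u}) where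
  Rel : ∀ {T : Scheme.{u}} {i j : J}, (T ⟶ Z i) → (T ⟶ Z j) → Prop
  refl : ∀ {T : Scheme.{u}} {i : J} (a : T ⟶ Z i), Rel a a
  symm : ∀ {T : Scheme.{u}} {i j : J} {a : T ⟶ Z i} {b : T ⟶ Z j}, Rel a b → Rel b a
  trans : ∀ {T : Scheme.{u}} {i j k : J} {a : T ⟶ Z i} {b : T ⟶ Z j} {c : T ⟶ Z k},
    Rel a b → Rel b c → Rel a c
  comp : ∀ {T T' : Scheme.{u}} {i j : J} {a : T ⟶ Z i} {b : T ⟶ Z j} (h : T' ⟶ T),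
    Rel a b → Rel (h ≫ a) (h ≫ b)
  dom : ∀ i _ : J, (Z i).Opens
  map : ∀ i j, (dom i j).toScheme ⟶ Z j
  rel_map : ∀ i j, Rel (dom i j).ι (map i j)
  exists_lift : ∀ {T : Scheme.{u}} {i j : J} {a : T ⟶ Z i} {b : T ⟶ Z j}, Rel a b →
    ∃ c : T ⟶ (dom i j).toScheme, c ≫ (dom i j).ι = a ∧ c ≫ map i j = b

namespace GluingRel

variable {J : Type u} {Z : J → Scheme.{u}} (R : GluingRel Z)

/-- The point of an overlap defined by a pair of related points. -/
def lift {T : Scheme.{u}} {i j : J} {a : T ⟶ Z i} {b : T ⟶ Z j} (h : R.Rel a b) :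
    T ⟶ (R.dom i j).toScheme := (R.exists_lift h).choose

lemma lift_ι {T : Scheme.{u}} {i j : J} {a : T ⟶ Z i} {b : T ⟶ Z j} (h : R.Rel a b) :
    R.lift h ≫ (R.dom i j).ι = a := (R.exists_lift h).choose_spec.1

lemma lift_map {T : Scheme.{u}} {i j : J} {a : T ⟶ Z i} {b : T ⟶ Z j} (h : R.Rel a b) :
    R.lift h ≫ R.map i j = b := (R.exists_lift h).choose_spec.2

lemma lift_map_assoc {T Y : Scheme.{u}} {i j : J} {a : T ⟶ Z i} {b : T ⟶ Z j} (h : R.Rel a b)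
    (g : Z j ⟶ Y) : R.lift h ≫ R.map i j ≫ g = b ≫ g := by
  rw [← Category.assoc, R.lift_map]

/-- The isomorphism between the two overlaps of a pair of charts. -/
def swap (i j : J) : (R.dom i j).toScheme ⟶ (R.dom j i).toScheme := R.lift (R.symm (R.rel_map i j))

lemma swap_ι (i j : J) : R.swap i j ≫ (R.dom j i).ι = R.map i j := R.lift_ι _

lemma swap_ι_assoc (i j : J) {Y : Scheme.{u}} (g : Z j ⟶ Y) :
    R.swap i j ≫ (R.dom j i).ι ≫ g = R.map i j ≫ g := by
  rw [← Category.assoc, R.swap_ι]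

lemma swap_map (i j : J) : R.swap i j ≫ R.map j i = (R.dom i j).ι := R.lift_map _

/-- Over a triple overlap the images in the second and third chart are both related to the same
point of the first, so transitivity applies. -/
lemma rel_triple (i j k : J) :
    R.Rel (pullback.fst (R.dom i j).ι (R.dom i k).ι ≫ R.map i j)
      (pullback.snd (R.dom i j).ι (R.dom i k).ι ≫ R.map i k) := by
  have h₁ := R.comp (pullback.fst (R.dom i j).ι (R.dom i k).ι) (R.rel_map i j)
  have h₂ := R.comp (pullback.snd (R.dom i j).ι (R.dom i k).ι) (R.rel_map i k)
  rw [← pullback.condition] at h₂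
  exact R.trans (R.symm h₁) h₂

/-- The isomorphism between the triple overlaps. -/
def triple (i j k : J) : pullback (R.dom i j).ι (R.dom i k).ι ⟶
    pullback (R.dom j k).ι (R.dom j i).ι :=
  pullback.lift (R.lift (R.rel_triple i j k)) (pullback.fst _ _ ≫ R.swap i j) (by
    rw [R.lift_ι, Category.assoc, R.swap_ι])

lemma triple_fst_ι (i j k : J) : R.triple i j k ≫ pullback.fst _ _ ≫ (R.dom j k).ι =
    pullback.fst _ _ ≫ R.map i j := by
  rw [triple, pullback.lift_fst_assoc, R.lift_ι]

lemma triple_fst_map (i j k : J) : R.triple i j k ≫ pullback.fst _ _ ≫ R.map j k =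
    pullback.snd _ _ ≫ R.map i k := by
  rw [triple, pullback.lift_fst_assoc, R.lift_map]

lemma triple_snd (i j k : J) : R.triple i j k ≫ pullback.snd _ _ =
    pullback.fst _ _ ≫ R.swap i j := by
  rw [triple, pullback.lift_snd]

lemma triple_snd_assoc (i j k : J) {Y : Scheme.{u}} (g : (R.dom j i).toScheme ⟶ Y) :
    R.triple i j k ≫ pullback.snd _ _ ≫ g = pullback.fst _ _ ≫ R.swap i j ≫ g := by
  rw [← Category.assoc, R.triple_snd, Category.assoc]

lemma triple_cocycle_aux (i j k : J) :
    (R.triple i j k ≫ R.triple j k i ≫ R.triple k i j) ≫ pullback.fst _ _ ≫ (R.dom i j).ι =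
      pullback.fst _ _ ≫ (R.dom i j).ι := by
  simp only [Category.assoc]
  rw [R.triple_fst_ι, R.triple_fst_map, R.triple_snd_assoc, R.swap_map]

/-- The overlaps are embedded by monomorphisms, so both projections of the triple overlap are tested
in the chart `Z i`, where they become the same morphism. Going once around returns this morphism
because `swap` followed by `map` back is the inclusion. -/
lemma triple_cocycle (i j k : J) :
    R.triple i j k ≫ R.triple j k i ≫ R.triple k i j = 𝟙 _ := by
  apply pullback.hom_ext
  · rw [← cancel_mono (R.dom i j).ι, Category.assoc, R.triple_cocycle_aux, Category.id_comp]
  · rw [← cancel_mono (R.dom i k).ι, Category.assoc, ← pullback.condition,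
      R.triple_cocycle_aux, Category.id_comp, pullback.condition]

/-- Reflexivity at the identity of `Z i` makes the identity factor through the overlap of the chart
with itself. -/
lemma isIso_ι_self (i : J) : IsIso (R.dom i i).ι := by
  have h := R.refl (𝟙 (Z i))
  exact ⟨R.lift h, by rw [← cancel_mono (R.dom i i).ι, Category.assoc, R.lift_ι,
    Category.comp_id, Category.id_comp], R.lift_ι h⟩

lemma map_self (i : J) : R.map i i = (R.dom i i).ι := by
  have h := R.refl (𝟙 (Z i))
  have := R.isIso_ι_self i
  rw [← cancel_epi (inv (R.dom i i).ι), IsIso.inv_hom_id]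
  have e : R.lift h = inv (R.dom i i).ι := by
    rw [← cancel_mono (R.dom i i).ι, R.lift_ι, IsIso.inv_hom_id]
  rw [← e, R.lift_map]

/-- The glueing data defined by a gluing relation. -/
def glueData : Scheme.GlueData.{u} where
  J := J
  U := Z
  V p := (R.dom p.1 p.2).toScheme
  f i j := (R.dom i j).ι
  f_mono _ _ := inferInstance
  f_hasPullback _ _ _ := inferInstance
  f_id i := R.isIso_ι_self i
  t i j := R.swap i j
  t_id i := by
    rw [← cancel_mono (R.dom i i).ι, R.swap_ι, R.map_self, Category.id_comp]
  t' i j k := R.triple i j k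
  t_fac i j k := R.triple_snd i j k
  cocycle i j k := R.triple_cocycle i j k
  f_open _ _ := inferInstance

/-- The overlaps are the fibre products of the charts over the glued scheme, and they represent the
relation; so two points become equal in the glued scheme exactly when they are related. -/
theorem exists_glued : ∃ (G : Scheme.{u}) (e : ∀ j, Z j ⟶ G), (∀ j, IsOpenImmersion (e j)) ∧
    (∀ x : G, ∃ (j : J) (y : Z j), e j y = x) ∧
    ∀ {T : Scheme.{u}} {i j : J} (a : T ⟶ Z i) (b : T ⟶ Z j), a ≫ e i = b ≫ e j ↔ R.Rel a b := by
  let G : Scheme.{u} := R.glueData.glued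
  let e : ∀ j, Z j ⟶ G := R.glueData.ι
  have he (i j : J) : (R.dom i j).ι ≫ e i = R.map i j ≫ e j := by
    have h : R.swap i j ≫ (R.dom j i).ι ≫ e j = (R.dom i j).ι ≫ e i :=
      R.glueData.glue_condition i j
    rw [← h, R.swap_ι_assoc]
  have hl {T : Scheme.{u}} {i j : J} (a : T ⟶ Z i) (b : T ⟶ Z j) (h : a ≫ e i = b ≫ e j) :
      ∃ c : T ⟶ (R.dom i j).toScheme, c ≫ (R.dom i j).ι = a ∧
        c ≫ R.swap i j ≫ (R.dom j i).ι = b :=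
    ⟨PullbackCone.IsLimit.lift (R.glueData.vPullbackConeIsLimit i j) a b h,
      PullbackCone.IsLimit.lift_fst (R.glueData.vPullbackConeIsLimit i j) a b h,
      PullbackCone.IsLimit.lift_snd (R.glueData.vPullbackConeIsLimit i j) a b h⟩
  refine ⟨G, e, R.glueData.ι_isOpenImmersion, R.glueData.ι_jointly_surjective,
    fun {T i j} a b => ⟨fun h => ?_, fun h => ?_⟩⟩
  · obtain ⟨c, rfl, rfl⟩ := hl a b h
    rw [R.swap_ι]
    exact R.comp c (R.rel_map i j)
  · rw [← R.lift_ι h, Category.assoc, he, R.lift_map_assoc]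

end GluingRel

end Gluing

/-! ### Local frames of subbundles and the reconstruction of subbundles from them. -/

section Frames

variable {m n l : Type} [Fintype m] [DecidableEq m] [Fintype n] [DecidableEq n] [Fintype l]
  [DecidableEq l] {T T' T'' X Y : Scheme.{u}}

/-- For a subbundle `j : S → V` on `T` and `h : T' ⟶ T`, the columns of `A` form a frame of `h^* S`
over an open subset of `T'`, in the `i`-th trivialization of `V`. -/
def BundleMap.IsFrame {f : T ⟶ X} {S : VectorBundle T n} {V : VectorBundle X m}
    (j : BundleMap f S V) (h : T' ⟶ T) (i : V.ι) {O : T'.Opens} (A : Matrix m n Γ(T', O)) : Prop :=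
  ∀ x ∈ O, ∃ (b : S.ι) (O' : T'.Opens) (h₁ : O' ≤ O) (h₂ : O' ≤ h ⁻¹ᵁ (f ⁻¹ᵁ V.U i ⊓ S.U b)),
    x ∈ O' ∧ ∃ C : Matrix n n Γ(T', O'), IsUnit C ∧
      A.map (res h₁) = (j.mat i b).map (pull h h₂) * C

lemma isUnit_map_res {O O' : X.Opens} {C : Matrix n n Γ(X, O)} (hC : IsUnit C) (h : O' ≤ O) :
    IsUnit (C.map (res h)) :=
  hC.map (res h).mapMatrix

section

variable {f : T ⟶ X} {S : VectorBundle T n} {V : VectorBundle X m} {j : BundleMap f S V}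
  {h : T' ⟶ T} {i k : V.ι} {O O' : T'.Opens}

lemma BundleMap.IsFrame.le {A : Matrix m n Γ(T', O)} (hA : j.IsFrame h i A) :
    O ≤ h ⁻¹ᵁ f ⁻¹ᵁ V.U i := fun x hx => by
  obtain ⟨b, O', h₁, h₂, hx', -⟩ := hA x hx
  exact (h₂ hx').1

lemma BundleMap.isFrame_mat (j : BundleMap f S V) (h : T' ⟶ T) (i : V.ι) (b : S.ι)
    (hO : O ≤ h ⁻¹ᵁ (f ⁻¹ᵁ V.U i ⊓ S.U b)) : j.IsFrame h i ((j.mat i b).map (pull h hO)) :=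
  fun x hx => ⟨b, O, le_rfl, hO, hx, 1, isUnit_one, by rw [map_res_self, Matrix.mul_one]⟩

lemma BundleMap.IsFrame.res {A : Matrix m n Γ(T', O)} (hA : j.IsFrame h i A) (hO : O' ≤ O) :
    j.IsFrame h i (A.map (res hO)) := fun x hx => by
  obtain ⟨b, U, h₁, h₂, hx', C, hC, e⟩ := hA x (hO hx)
  refine ⟨b, U ⊓ O', inf_le_right, inf_le_left.trans h₂, ⟨hx', hx⟩,
    C.map (GrassBundle.res inf_le_left), isUnit_map_res hC _, ?_⟩
  have := congrArg (fun M => M.map (GrassBundle.res (inf_le_left : U ⊓ O' ≤ U))) e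
  simpa only [map_res_mul, map_res_res, map_res_pull] using this

lemma BundleMap.IsFrame.of_local {A : Matrix m n Γ(T', O)}
    (H : ∀ x ∈ O, ∃ (O' : T'.Opens) (hO : O' ≤ O), x ∈ O' ∧
      j.IsFrame h i (A.map (GrassBundle.res hO))) : j.IsFrame h i A := fun x hx => by
  obtain ⟨O', hO, hx', hA⟩ := H x hx
  obtain ⟨b, U, h₁, h₂, hxU, C, hC, e⟩ := hA x hx'
  exact ⟨b, U, h₁.trans hO, h₂, hxU, C, hC, by rw [map_res_res] at e; exact e⟩

lemma BundleMap.IsFrame.pull {A : Matrix m n Γ(T', O)} (hA : j.IsFrame h i A) (t : T'' ⟶ T')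
    {U : T''.Opens} (hU : U ≤ t ⁻¹ᵁ O) : j.IsFrame (t ≫ h) i (A.map (pull t hU)) := fun x hx => by
  obtain ⟨b, O', h₁, h₂, hx', C, hC, e⟩ := hA (t x) (hU hx)
  have h₃ : U ⊓ t ⁻¹ᵁ O' ≤ t ⁻¹ᵁ O' := inf_le_right
  refine ⟨b, U ⊓ t ⁻¹ᵁ O', inf_le_left, sub, ⟨hx, hx'⟩,
    C.map (GrassBundle.pull t h₃), pull_isUnit_det _ _ hC, ?_⟩
  have := congrArg (fun M => M.map (GrassBundle.pull t h₃)) e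
  simpa only [map_pull_mul, map_res_pull, map_pull_res, map_pull_pull] using this

lemma BundleMap.IsFrame.locSplit {A : Matrix m n Γ(T', O)} (hA : j.IsFrame h i A)
    (hj : j.IsSubbundle) : LocSplit A := LocSplit.of_local fun x hx => by
  obtain ⟨b, O', h₁, h₂, hx', C, hC, e⟩ := hA x hx
  refine ⟨O', h₁, hx', ?_⟩
  rw [e]
  exact (((isSubbundle_iff j).mp hj i b).pull h h₂).mul (LocSplit.of_isUnit hC)

/-- A frame transforms into a frame by the transition functions and by a change of basis. -/
lemma BundleMap.IsFrame.change {B : Matrix m n Γ(T', O)} (hB : j.IsFrame h k B) {f' : T' ⟶ X}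
    (e : h ≫ f = f') (hO : O ≤ f' ⁻¹ᵁ (V.U i ⊓ V.U k)) {C : Matrix n n Γ(T', O)} (hC : IsUnit C) :
    j.IsFrame h i ((V.g i k).map (GrassBundle.pull f' hO) * B * C) := fun x hx => by
  subst e
  obtain ⟨b, O', h₁, h₂, hx', D, hD, e⟩ := hB x hx
  refine ⟨b, O', h₁, sub, hx', D * C.map (GrassBundle.res h₁), hD.mul (isUnit_map_res hC _), ?_⟩
  rw [map_res_mul, map_res_mul, e, map_res_pull, j.pull_mat_target h i k b _ sub h₂]
  simp only [Matrix.mul_assoc]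

/-- Two frames of the same subbundle differ by a change of basis. -/
lemma BundleMap.IsFrame.exists_eq {A B : Matrix m n Γ(T', O)} (hj : j.IsSubbundle)
    (hA : j.IsFrame h i A) (hB : j.IsFrame h k B) {f' : T' ⟶ X}
    (e : h ≫ f = f') (hO : O ≤ f' ⁻¹ᵁ (V.U i ⊓ V.U k)) :
    ∃ C : Matrix n n Γ(T', O), IsUnit C ∧ A = (V.g i k).map (GrassBundle.pull f' hO) * B * C := by
  subst e
  -- Left invertibility of the right-hand factor makes the change of basis unique, so that it may be
  -- constructed locally.
  have hgB : LocSplit ((V.g i k).map (GrassBundle.pull (h ≫ f) hO) * B) :=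
    (LocSplit.of_isUnit (V.isUnit_pull_g _ i k hO)).mul (hB.locSplit hj)
  obtain ⟨C, hC⟩ := exists_mat_of_local (O := O)
    (fun O' (C : Matrix n n Γ(T', O')) => ∃ h₁ : O' ≤ O, IsUnit C ∧ A.map (GrassBundle.res h₁) =
      ((V.g i k).map (GrassBundle.pull (h ≫ f) hO) * B).map (GrassBundle.res h₁) * C)
    (by
      rintro O' O'' h₀ C ⟨h₁, hC, e⟩
      refine ⟨h₀.trans h₁, isUnit_map_res hC _, ?_⟩
      have := congrArg (fun M => M.map (GrassBundle.res h₀)) e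
      rw [map_res_mul _ (Matrix.map _ _), map_res_res, map_res_res] at this
      exact this)
    (by
      rintro O' C C' ⟨h₁, hC, e⟩ ⟨h₁', hC', e'⟩
      exact (hgB.res h₁).cancel (e.symm.trans e'))
    (by
      intro x hx
      obtain ⟨b, U, h₁, h₂, hxU, C, hC, e⟩ := hA x hx
      obtain ⟨c, W, h₃, h₄, hxW, D, hD, e'⟩ := hB x hx
      have hU : U ⊓ W ≤ U := inf_le_left
      have hW : U ⊓ W ≤ W := inf_le_right
      have hbc : U ⊓ W ≤ h ⁻¹ᵁ (S.U c ⊓ S.U b) := sub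
      have hD' := isUnit_map_res hD hW
      -- Writing `A` as a matrix of `j` times `C` and `B` as another such matrix times `D`, the
      -- change of basis is `D⁻¹`, then the transition function of `S`, then `C`.
      refine ⟨U ⊓ W, hU.trans h₁, ⟨hxU, hxW⟩,
        (D.map (GrassBundle.res hW))⁻¹ * (S.g c b).map (GrassBundle.pull h hbc) *
          C.map (GrassBundle.res hU), hU.trans h₁, ?_, ?_⟩
      · exact ((Matrix.isUnit_nonsing_inv_iff.mpr hD').mul (S.isUnit_pull_g h c b hbc)).mul
          (isUnit_map_res hC hU)
      have e₁ := congrArg (fun M => M.map (GrassBundle.res hU)) e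
      have e₂ := congrArg (fun M => M.map (GrassBundle.res hW)) e'
      simp only [map_res_mul, map_res_res, map_res_pull] at e₁ e₂ ⊢
      rw [e₁, e₂, j.pull_mat_source h i c b _ sub hbc, j.pull_mat_target h i k c _ sub sub]
      simp only [Matrix.mul_assoc]
      rw [Matrix.mul_nonsing_inv_cancel_left _ _ ((Matrix.isUnit_iff_isUnit_det _).mp hD')])
  refine ⟨C, isUnit_of_local fun x hx => ?_, mat_ext fun x hx => ?_⟩
  · obtain ⟨O', h₁, hx', _, H, -⟩ := hC x hx
    exact ⟨O', h₁, hx', H⟩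
  · obtain ⟨O', h₁, hx', _, -, H⟩ := hC x hx
    refine ⟨O', h₁, hx', ?_⟩
    rw [H, map_res_mul _ (_ * _)]

lemma BundleMap.IsFrame.exists_eq_mul {A B : Matrix m n Γ(T', O)} (hj : j.IsSubbundle)
    (hA : j.IsFrame h i A) (hB : j.IsFrame h i B) :
    ∃ C : Matrix n n Γ(T', O), IsUnit C ∧ A = B * C := by
  have hle := hA.le
  obtain ⟨C, hC, e⟩ := hA.exists_eq hj hB rfl sub
  exact ⟨C, hC, by rwa [V.pull_g_self, Matrix.one_mul] at e⟩

lemma BundleMap.IsFrame.mul {B : Matrix m n Γ(T', O)} (hB : j.IsFrame h i B)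
    {C : Matrix n n Γ(T', O)} (hC : IsUnit C) : j.IsFrame h i (B * C) := by
  have hle := hB.le
  have := hB.change (i := i) rfl sub hC
  rwa [V.pull_g_self, Matrix.one_mul] at this

lemma BundleMap.isFrame_id_mat (j : BundleMap f S V) (i : V.ι) (b : S.ι) {O : T.Opens}
    (hO : O ≤ f ⁻¹ᵁ V.U i ⊓ S.U b) : j.IsFrame (𝟙 T) i ((j.mat i b).map (GrassBundle.res hO)) := by
  have := j.isFrame_mat (𝟙 T) i b hO
  rwa [map_pull_id (hO : O ≤ 𝟙 T ⁻¹ᵁ (f ⁻¹ᵁ V.U i ⊓ S.U b))] at this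

/-- A subbundle `S'` of `f'^* V` is the pull-back of a subbundle `S` of `f^* V` along `h` if and
only if the two have common local frames. -/
lemma exists_isComp_iff {f' : T' ⟶ X} {S' : VectorBundle T' n} {j' : BundleMap f' S' V}
    (e : h ≫ f = f') (hj : j.IsSubbundle) (hj' : j'.IsSubbundle) :
    (∃ k : BundleMap h S' S, IsComp k j j') ↔
      ∀ x : T', ∃ (O : T'.Opens) (_ : x ∈ O) (i : V.ι) (A : Matrix m n Γ(T', O)),
        j.IsFrame h i A ∧ j'.IsFrame (𝟙 T') i A := by
  subst e
  constructor
  · rintro ⟨k, hk⟩ x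
    have hku := (isSubbundle_iff k).mp (hk.locSplit hj')
    obtain ⟨i, hi⟩ := V.exists_mem (f (h x))
    obtain ⟨b, hb⟩ := S.exists_mem (h x)
    obtain ⟨a, ha⟩ := S'.exists_mem x
    have h₁ : h ⁻¹ᵁ (f ⁻¹ᵁ V.U i ⊓ S.U b) ⊓ S'.U a ≤ (h ≫ f) ⁻¹ᵁ V.U i ⊓ S'.U a := sub
    have h₂ : h ⁻¹ᵁ (f ⁻¹ᵁ V.U i ⊓ S.U b) ⊓ S'.U a ≤ h ⁻¹ᵁ S.U b ⊓ S'.U a := sub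
    refine ⟨_, (⟨⟨hi, hb⟩, ha⟩ : x ∈ h ⁻¹ᵁ (f ⁻¹ᵁ V.U i ⊓ S.U b) ⊓ S'.U a), i,
      (j'.mat i a).map (GrassBundle.res h₁), ?_, j'.isFrame_id_mat i a h₁⟩
    rw [hk.2 i b a _ inf_le_left h₂ h₁]
    exact (j.isFrame_mat h i b inf_le_left).mul ((hku b a).res h₂).isUnit
  · intro H
    -- The matrices of `k` must satisfy `j' = j * K`. They are unique since `j` can be cancelled,
    -- and they exist near each point by comparing both subbundles with the common frame.
    have hjs := (isSubbundle_iff j).mp hj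
    have glue (b : S.ι) (a : S'.ι) : ∃ K : Matrix n n Γ(T', h ⁻¹ᵁ S.U b ⊓ S'.U a),
        ∀ (i : V.ι) (O : T'.Opens) (h₁ : O ≤ h ⁻¹ᵁ (f ⁻¹ᵁ V.U i ⊓ S.U b))
          (h₂ : O ≤ h ⁻¹ᵁ S.U b ⊓ S'.U a) (h₃ : O ≤ (h ≫ f) ⁻¹ᵁ V.U i ⊓ S'.U a),
          (j'.mat i a).map (GrassBundle.res h₃) =
            (j.mat i b).map (GrassBundle.pull h h₁) * K.map (GrassBundle.res h₂) := by
      obtain ⟨K, hK⟩ := exists_mat_of_local (O := h ⁻¹ᵁ S.U b ⊓ S'.U a)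
        (fun O' (K : Matrix n n Γ(T', O')) => O' ≤ h ⁻¹ᵁ S.U b ⊓ S'.U a ∧
          ∀ (i : V.ι) (O : T'.Opens) (h₁ : O ≤ h ⁻¹ᵁ (f ⁻¹ᵁ V.U i ⊓ S.U b)) (h₂ : O ≤ O')
          (h₃ : O ≤ (h ≫ f) ⁻¹ᵁ V.U i ⊓ S'.U a), (j'.mat i a).map (GrassBundle.res h₃) =
            (j.mat i b).map (GrassBundle.pull h h₁) * K.map (GrassBundle.res h₂))
        (by
          intro O' O'' h₀ K hK
          refine ⟨h₀.trans hK.1, fun i O h₁ h₂ h₃ => ?_⟩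
          rw [map_res_res]
          exact hK.2 i O h₁ (h₂.trans h₀) h₃)
        (by
          intro O' K K' hK hK'
          refine mat_ext fun x hx => ?_
          obtain ⟨i, hi⟩ := V.exists_mem (f (h x))
          have hO := hK.1
          have h₁ : O' ⊓ h ⁻¹ᵁ f ⁻¹ᵁ V.U i ≤ h ⁻¹ᵁ (f ⁻¹ᵁ V.U i ⊓ S.U b) := sub
          have h₃ : O' ⊓ h ⁻¹ᵁ f ⁻¹ᵁ V.U i ≤ (h ≫ f) ⁻¹ᵁ V.U i ⊓ S'.U a := sub
          refine ⟨_, inf_le_left, ⟨hx, hi⟩, ((hjs i b).pull h h₁).cancel ?_⟩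
          rw [← hK.2 i _ h₁ inf_le_left h₃, ← hK'.2 i _ h₁ inf_le_left h₃])
        (by
          intro x hx
          obtain ⟨U, hxU, i₀, A, hA, hA'⟩ := H x
          have hle := hA.le
          let O' := U ⊓ (h ⁻¹ᵁ S.U b ⊓ S'.U a)
          have hU : O' ≤ U := inf_le_left
          have hO : O' ≤ h ⁻¹ᵁ S.U b ⊓ S'.U a := inf_le_right
          have le₁ : O' ≤ h ⁻¹ᵁ (f ⁻¹ᵁ V.U i₀ ⊓ S.U b) := sub
          have le₂ : O' ≤ (h ≫ f) ⁻¹ᵁ V.U i₀ ⊓ S'.U a := sub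
          obtain ⟨C, -, e⟩ := (hA.res hU).exists_eq_mul hj (j.isFrame_mat h i₀ b le₁)
          obtain ⟨D, -, e'⟩ := (j'.isFrame_id_mat i₀ a le₂).exists_eq_mul hj' (hA'.res hU)
          -- Here the common frame is the matrix of `j` times `C`, and the matrix of `j'` is the
          -- common frame times `D`. Other trivializations of `V` follow by multiplying with a
          -- transition function.
          refine ⟨O', hO, ⟨hxU, hx⟩, C * D, hO, fun i O h₁ h₂ h₃ => ?_⟩
          have hi : O ≤ (h ≫ f) ⁻¹ᵁ (V.U i ⊓ V.U i₀) := sub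
          rw [e, Matrix.mul_assoc] at e'
          have e'' := congrArg (fun N => N.map (GrassBundle.res h₂)) e'
          rw [j'.res_mat_target i i₀ a _ hi (h₂.trans le₂), j.pull_mat_target h i i₀ b _ hi (h₂.trans le₁),
            Matrix.mul_assoc]
          simp only [map_res_mul, map_res_res, map_res_pull] at e'' ⊢
          rw [e''])
      refine ⟨K, fun i O h₁ h₂ h₃ => mat_ext fun x hx => ?_⟩
      obtain ⟨O', h₄, hx', -, H'⟩ := hK x (h₂ hx)
      refine ⟨O ⊓ O', inf_le_left, ⟨hx, hx'⟩, ?_⟩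
      simp only [map_res_mul, map_res_pull, map_res_res] at H' ⊢
      exact H' i (O ⊓ O') (inf_le_left.trans h₁) inf_le_right (inf_le_left.trans h₃)
    choose K hK using glue
    refine ⟨⟨K, ?_⟩, rfl, fun i b a O h₁ h₂ h₃ => hK b a i O h₁ h₂ h₃⟩
    intro b b' a a' O h₁ h₂ h₃ h₄
    refine mat_ext fun x hx => ?_
    obtain ⟨i, hi⟩ := V.exists_mem (f (h x))
    let O' := O ⊓ h ⁻¹ᵁ f ⁻¹ᵁ V.U i
    have hO : O' ≤ O := inf_le_left
    refine ⟨O', hO, ⟨hx, hi⟩, ?_⟩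
    have le₁ : O' ≤ h ⁻¹ᵁ (f ⁻¹ᵁ V.U i ⊓ S.U b) := sub
    have le₂ : O' ≤ h ⁻¹ᵁ (f ⁻¹ᵁ V.U i ⊓ S.U b') := sub
    have le₃ : O' ≤ (h ≫ f) ⁻¹ᵁ V.U i ⊓ S'.U a := sub
    have le₄ : O' ≤ (h ≫ f) ⁻¹ᵁ V.U i ⊓ S'.U a' := sub
    simp only [map_res_mul, map_res_pull, map_res_res]
    refine ((hjs i b).pull h le₁).cancel ?_
    rw [← Matrix.mul_assoc, ← j.pull_mat_source h i b b' le₂, ← hK b' a' i O' le₂ _ le₄,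
      ← Matrix.mul_assoc, ← hK b a i O' le₁ _ le₃, ← j'.res_mat_source i a a' le₄]

end

/-- A family of compatible local frames defines a subbundle. -/
lemma exists_subbundle {f : T ⟶ X} {V : VectorBundle X m} {J : Type u} (R : J → T.Opens)
    (hR : ⨆ a, R a = ⊤) (idx : J → V.ι) (hle : ∀ a, R a ≤ f ⁻¹ᵁ V.U (idx a))
    (A : ∀ a, Matrix m n Γ(T, R a)) (hA : ∀ a, LocSplit (A a))
    (hc : ∀ a b (h : R a ⊓ R b ≤ f ⁻¹ᵁ (V.U (idx a) ⊓ V.U (idx b))),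
      ∃ C : Matrix n n Γ(T, R a ⊓ R b), (V.g (idx a) (idx b)).map (pull f h) *
        (A b).map (res (inf_le_right : R a ⊓ R b ≤ R b)) =
          (A a).map (res (inf_le_left : R a ⊓ R b ≤ R a)) * C) :
    ∃ (S : VectorBundle T n) (j : BundleMap f S V), j.IsSubbundle ∧
      ∀ a, j.IsFrame (𝟙 T) (idx a) (A a) := by
  have hle₂ (a b : J) : R a ⊓ R b ≤ f ⁻¹ᵁ (V.U (idx a) ⊓ V.U (idx b)) :=
    le_inf (inf_le_left.trans (hle a)) (inf_le_right.trans (hle b))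
  choose g hg using fun a b => hc a b (hle₂ a b)
  have hg' (a b : J) (O : T.Opens) (h₁ : O ≤ f ⁻¹ᵁ (V.U (idx a) ⊓ V.U (idx b))) (h₂ : O ≤ R b)
      (h₃ : O ≤ R a) (h₄ : O ≤ R a ⊓ R b) : (V.g (idx a) (idx b)).map (pull f h₁) *
        (A b).map (res h₂) = (A a).map (res h₃) * (g a b).map (res h₄) := by
    have := congrArg (fun M => M.map (res h₄)) (hg a b)
    simpa only [map_res_mul, map_res_res, map_res_pull] using this
  -- The matrices that compare the frames serve as transition functions; the cocycle conditions come
  -- from those of `V` by cancelling the frame, which also yields their invertibility.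
  let S : VectorBundle T n :=
    { ι := J
      U := R
      iSup_U := hR
      g := g
      g_self := fun a => by
        refine ((hA a).res (inf_le_left : R a ⊓ R a ≤ R a)).cancel ?_
        rw [← hg a a, V.pull_g_self, Matrix.one_mul, Matrix.mul_one]
      g_mul := fun a b c O h₁ h₂ h₃ => by
        refine ((hA a).res (h₁.trans inf_le_left)).cancel (l := n) ?_
        have hb : O ≤ R b := h₁.trans inf_le_right
        have hcc : O ≤ R c := h₂.trans inf_le_right
        rw [← Matrix.mul_assoc, ← hg' a b O (h₁.trans (hle₂ a b)) hb, Matrix.mul_assoc,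
          ← hg' b c O (h₂.trans (hle₂ b c)) hcc, ← Matrix.mul_assoc,
          V.pull_g_mul f _ _ _ _ _ (h₃.trans (hle₂ a c)), hg' a c O _ hcc _ h₃] }
  have le₁ (i : V.ι) (a : J) : f ⁻¹ᵁ V.U i ⊓ R a ≤ f ⁻¹ᵁ (V.U i ⊓ V.U (idx a)) :=
    le_inf inf_le_left (inf_le_right.trans (hle a))
  -- The frame `A a` is given in the trivialization `idx a` and has to be moved to the
  -- trivialization `i`.
  let M (i : V.ι) (a : J) : Matrix m n Γ(T, f ⁻¹ᵁ V.U i ⊓ R a) :=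
    (V.g i (idx a)).map (pull f (le₁ i a)) *
      (A a).map (res (inf_le_right : f ⁻¹ᵁ V.U i ⊓ R a ≤ R a))
  have hM (i : V.ι) (a : J) (O : T.Opens) (h₁ : O ≤ f ⁻¹ᵁ V.U i ⊓ R a)
      (h₂ : O ≤ f ⁻¹ᵁ (V.U i ⊓ V.U (idx a))) (h₃ : O ≤ R a) :
      (M i a).map (res h₁) = (V.g i (idx a)).map (pull f h₂) * (A a).map (res h₃) := by
    simp only [M, map_res_mul, map_res_pull, map_res_res]
  let j : BundleMap f S V :=
    { mat := M
      compat := fun i k a b O h₁ h₂ h₃ h₄ => by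
        have ha : O ≤ R a := h₂.trans inf_le_left
        have hb : O ≤ R b := h₂.trans inf_le_right
        have hab := h₂.trans (hle₂ a b)
        have hib : O ≤ f ⁻¹ᵁ (V.U i ⊓ V.U (idx b)) := sub
        have e₁ := hM k b O h₄ (h₄.trans (le₁ k b)) hb
        have e₂ := hM i a O h₃ (h₃.trans (le₁ i a)) ha
        refine (congrArg _ e₁).trans (Eq.trans ?_ (congrArg (fun N => N * _) e₂).symm)
        refine (Matrix.mul_assoc _ _ _).symm.trans (Eq.trans ?_ (Matrix.mul_assoc _ _ _).symm)
        rw [V.pull_g_mul f _ _ _ _ _ hib]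
        refine Eq.trans ?_ (congrArg _ (hg' a b O hab hb ha h₂))
        rw [← Matrix.mul_assoc, V.pull_g_mul f _ _ _ _ _ hib] }
  refine ⟨S, j, (isSubbundle_iff j).mpr fun i a =>
    (LocSplit.of_isUnit (V.isUnit_pull_g f _ _ _)).mul ((hA a).res _), fun a => ?_⟩
  have h₁ : R a ≤ f ⁻¹ᵁ V.U (idx a) ⊓ R a := le_inf (hle a) le_rfl
  have := j.isFrame_id_mat (idx a) a h₁
  have e := hM (idx a) a (R a) h₁ (h₁.trans (le₁ _ _)) le_rfl
  rw [V.pull_g_self, map_res_self, Matrix.one_mul] at e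
  exact e ▸ this

end Frames

/-! ### Affine cells of normalized matrices and their overlaps. -/

section Cells

variable {m n : Type} [Fintype m] [DecidableEq m] [Fintype n] [DecidableEq n]
  {T T' X Y : Scheme.{u}}

lemma top_le_preimage (f : T ⟶ Y) : (⊤ : T.Opens) ≤ f ⁻¹ᵁ ⊤ := le_rfl

lemma exists_lift_opens (U : Y.Opens) (f : T ⟶ Y) (h : ⊤ ≤ f ⁻¹ᵁ U) :
    ∃ g : T ⟶ U.toScheme, g ≫ U.ι = f := by
  refine ⟨IsOpenImmersion.lift U.ι f ?_, IsOpenImmersion.lift_fac _ _ _⟩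
  rintro _ ⟨x, rfl⟩
  rw [Scheme.Opens.range_ι]
  exact h (trivial : x ∈ (⊤ : T.Opens))

lemma top_le_ι_preimage (U : Y.Opens) : ⊤ ≤ U.ι ⁻¹ᵁ U := by
  rw [Scheme.Opens.ι_preimage_self]

lemma hom_ext_of_local {f g : T ⟶ Y} (H : ∀ x : T, ∃ O : T.Opens, x ∈ O ∧ O.ι ≫ f = O.ι ≫ g) :
    f = g := by
  choose O hO h using H
  exact (T.openCoverOfIsOpenCover O (TopologicalSpace.IsOpenCover.mk
    (top_le_iff.mp fun x _ => Opens.mem_iSup.mpr ⟨x, hO x⟩))).hom_ext _ _ h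

lemma exists_hom_glue {ι : Type u} (U : ι → T.Opens) (hU : ∀ x, ∃ i, x ∈ U i)
    (f : ∀ i, (U i).toScheme ⟶ Y)
    (H : ∀ (i j : ι) (T' : Scheme.{u}) (a : T' ⟶ (U i).toScheme) (b : T' ⟶ (U j).toScheme),
      a ≫ (U i).ι = b ≫ (U j).ι → a ≫ f i = b ≫ f j) :
    ∃ g : T ⟶ Y, ∀ i, (U i).ι ≫ g = f i := by
  let c := T.openCoverOfIsOpenCover U (TopologicalSpace.IsOpenCover.mk
    (top_le_iff.mp fun x _ => Opens.mem_iSup.mpr (hU x)))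
  exact ⟨Scheme.Cover.glueMorphisms c f fun i j => H i j _ _ _ Limits.pullback.condition,
    fun i => Scheme.Cover.ι_glueMorphisms c f _ i⟩

lemma appTop_eq_pull (f : T ⟶ Y) (a : Γ(Y, ⊤)) : f.appTop a = pull f (top_le_preimage f) a := by
  unfold pull
  exact congrArg (fun φ => φ.hom a) f.app_eq_appLE

/-- The projection of the affine space over an open subscheme. -/
def affineProj (U : Y.Opens) (n : Type) : AffineSpace (ULift.{u} n) U.toScheme ⟶ Y :=
  (AffineSpace (ULift.{u} n) U.toScheme ↘ U.toScheme) ≫ U.ι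

/-- The coordinate functions of the affine space over an open subscheme. -/
def affineCoord (U : Y.Opens) (k : n) : Γ(AffineSpace (ULift.{u} n) U.toScheme, ⊤) :=
  AffineSpace.coord U.toScheme ⟨k⟩

lemma top_le_affineProj_preimage (U : Y.Opens) : ⊤ ≤ affineProj U n ⁻¹ᵁ U := by
  change ⊤ ≤ (AffineSpace (ULift.{u} n) U.toScheme ↘ U.toScheme) ⁻¹ᵁ U.ι ⁻¹ᵁ U
  rw [Scheme.Opens.ι_preimage_self]
  exact le_rfl

lemma affine_hom_ext {U : Y.Opens} {f g : T ⟶ AffineSpace (ULift.{u} n) U.toScheme}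
    (h : f ≫ affineProj U n = g ≫ affineProj U n)
    (h' : ∀ k, pull f (top_le_preimage f) (affineCoord U k) =
      pull g (top_le_preimage g) (affineCoord U k)) : f = g := by
  refine AffineSpace.hom_ext ?_ fun k => ?_
  · rw [← cancel_mono U.ι]
    exact (Category.assoc _ _ _).trans (h.trans (Category.assoc _ _ _).symm)
  · rw [appTop_eq_pull, appTop_eq_pull]
    exact h' k.down

lemma exists_affine_hom {U : Y.Opens} (f : T ⟶ Y) (h : ⊤ ≤ f ⁻¹ᵁ U) (x : n → Γ(T, ⊤)) :
    ∃ g : T ⟶ AffineSpace (ULift.{u} n) U.toScheme, g ≫ affineProj U n = f ∧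
      ∀ k, pull g (top_le_preimage g) (affineCoord U k) = x k := by
  obtain ⟨f, rfl⟩ := exists_lift_opens U f h
  refine ⟨AffineSpace.homOfVector f fun k => x k.down, ?_, fun k => ?_⟩
  · rw [affineProj, ← Category.assoc, AffineSpace.homOfVector_over]
  · rw [← appTop_eq_pull]
    exact AffineSpace.homOfVector_appTop_coord _ _ _

/-- The affine scheme over `U` of the `m × n` matrices whose rows selected by `I` form the identity
matrix. -/
structure Cell (U : Y.Opens) (I : n ↪ m) where
  Z : Scheme.{u}
  ν : Z ⟶ Y
  A : Matrix m n Γ(Z, ⊤)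
  le : ⊤ ≤ ν ⁻¹ᵁ U
  minor : A.submatrix I id = 1
  exists_hom : ∀ {T : Scheme.{u}} (f : T ⟶ Y) (B : Matrix m n Γ(T, ⊤)), ⊤ ≤ f ⁻¹ᵁ U →
    B.submatrix I id = 1 → ∃ h : T ⟶ Z, h ≫ ν = f ∧ A.map (pull h (top_le_preimage h)) = B
  hom_ext : ∀ {T : Scheme.{u}} (a b : T ⟶ Z), a ≫ ν = b ≫ ν →
    A.map (pull a (top_le_preimage a)) = A.map (pull b (top_le_preimage b)) → a = b

-- The cell is an affine space with one coordinate for each entry in a row outside the range of `I`;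
-- the remaining entries are those of the identity matrix.
open Classical in
lemma nonempty_cell (U : Y.Opens) (I : n ↪ m) : Nonempty (Cell U I) := by
  let l := {p : m // p ∉ Set.range I} × n
  let Z := AffineSpace (ULift.{u} l) U.toScheme
  let A : Matrix m n Γ(Z, ⊤) := Matrix.of fun p q =>
    if hp : p ∈ Set.range I then (1 : Matrix n n Γ(Z, ⊤)) hp.choose q
    else affineCoord U (⟨⟨p, hp⟩, q⟩ : l)
  have hI (i : n) (h : I i ∈ Set.range I) : h.choose = i := I.injective h.choose_spec
  have hA (i q : n) : A (I i) q = (1 : Matrix n n Γ(Z, ⊤)) i q := by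
    have h : I i ∈ Set.range I := ⟨i, rfl⟩
    exact (dif_pos h).trans (congrArg (fun k => (1 : Matrix n n Γ(Z, ⊤)) k q) (hI i h))
  have hA' (p : m) (q : n) (hp : p ∉ Set.range I) : A p q = affineCoord U (⟨⟨p, hp⟩, q⟩ : l) := dif_neg hp
  refine ⟨⟨Z, affineProj U l, A, top_le_affineProj_preimage U, ?_, ?_, ?_⟩⟩
  · ext i q
    exact hA i q
  · intro T f B hf hB
    obtain ⟨h, e, hx⟩ := exists_affine_hom f hf fun k : l => B k.1 k.2
    refine ⟨h, e, ?_⟩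
    ext p q
    rw [Matrix.map_apply]
    by_cases hp : p ∈ Set.range I
    · obtain ⟨i, rfl⟩ := hp
      have e₁ := congrFun (congrFun hB i) q
      rw [Matrix.submatrix_apply, id] at e₁
      rw [hA, e₁, Matrix.one_apply, Matrix.one_apply]
      split_ifs
      · exact map_one _
      · exact map_zero _
    · rw [hA' p q hp]
      exact hx _
  · intro T a b e h
    refine affine_hom_ext e fun k => ?_
    have := congrFun (congrFun h k.1.1) k.2
    rwa [Matrix.map_apply, Matrix.map_apply, hA' _ _ k.1.2] at this

section Relation

variable {V : VectorBundle X m} {i j k : V.ι} {I I' I'' : n ↪ m}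

/-- Two points of cells over trivializing open sets of `V` define the same subbundle of `V`. -/
def CellRel (c : Cell (V.U i) I) (d : Cell (V.U j) I') (a : T ⟶ c.Z) (b : T ⟶ d.Z) : Prop :=
  ∃ f : T ⟶ X, a ≫ c.ν = f ∧ b ≫ d.ν = f ∧ ∃ C : Matrix n n Γ(T, ⊤), IsUnit C ∧
    ∀ h : ⊤ ≤ f ⁻¹ᵁ (V.U i ⊓ V.U j), c.A.map (pull a (top_le_preimage a)) =
      (V.g i j).map (pull f h) * d.A.map (pull b (top_le_preimage b)) * C

lemma Cell.top_le {U : Y.Opens} {I : n ↪ m} (c : Cell U I) {a : T ⟶ c.Z} {f : T ⟶ Y}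
    (e : a ≫ c.ν = f) : ⊤ ≤ f ⁻¹ᵁ U := by
  subst e
  exact fun x _ => c.le (trivial : a x ∈ (⊤ : c.Z.Opens))

lemma Cell.pull_minor {U : Y.Opens} {I : n ↪ m} (c : Cell U I) (a : T ⟶ c.Z) {O : T.Opens}
    (h : O ≤ a ⁻¹ᵁ ⊤) : (c.A.map (pull a h)).submatrix I id = 1 := by
  rw [Matrix.submatrix_map, c.minor, map_pull_one]

lemma submatrix_mul_id {R : Type*} [CommRing R] {l : Type} (A : Matrix m n R) (C : Matrix n n R)
    (I : l → m) : (A * C).submatrix I id = A.submatrix I id * C := rfl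

variable {c : Cell (V.U i) I} {d : Cell (V.U j) I'} {e : Cell (V.U k) I''}

lemma CellRel.refl (a : T ⟶ c.Z) : CellRel c c a a :=
  ⟨_, rfl, rfl, 1, isUnit_one, fun h => by rw [V.pull_g_self, Matrix.mul_one, Matrix.one_mul]⟩

lemma CellRel.symm {a : T ⟶ c.Z} {b : T ⟶ d.Z} (H : CellRel c d a b) : CellRel d c b a := by
  obtain ⟨f, ha, hb, C, hC, H⟩ := H
  have h₁ := c.top_le ha
  have h₂ := d.top_le hb
  have hij : ⊤ ≤ f ⁻¹ᵁ (V.U i ⊓ V.U j) := le_inf h₁ h₂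
  have hjj : ⊤ ≤ f ⁻¹ᵁ (V.U j ⊓ V.U j) := le_inf h₂ h₂
  refine ⟨f, hb, ha, C⁻¹, Matrix.isUnit_nonsing_inv_iff.mpr hC, fun h => ?_⟩
  rw [H hij, ← Matrix.mul_assoc, ← Matrix.mul_assoc, V.pull_g_mul f j i j _ _ hjj, V.pull_g_self,
    Matrix.one_mul, Matrix.mul_nonsing_inv_cancel_right _ _ ((Matrix.isUnit_iff_isUnit_det _).mp hC)]

lemma CellRel.trans {a : T ⟶ c.Z} {b : T ⟶ d.Z} {t : T ⟶ e.Z} (H : CellRel c d a b)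
    (H' : CellRel d e b t) : CellRel c e a t := by
  obtain ⟨f, ha, hb, C, hC, H⟩ := H
  obtain ⟨f', hb', ht, D, hD, H'⟩ := H'
  obtain rfl := hb.symm.trans hb'
  have h₁ := c.top_le ha
  have h₂ := d.top_le hb
  have h₃ := e.top_le ht
  have hij : ⊤ ≤ f ⁻¹ᵁ (V.U i ⊓ V.U j) := le_inf h₁ h₂
  have hjk : ⊤ ≤ f ⁻¹ᵁ (V.U j ⊓ V.U k) := le_inf h₂ h₃
  refine ⟨f, ha, ht, D * C, hD.mul hC, fun h => ?_⟩
  rw [H hij, H' hjk, ← V.pull_g_mul f i j k hij hjk]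
  simp only [Matrix.mul_assoc]

lemma CellRel.comp {a : T ⟶ c.Z} {b : T ⟶ d.Z} (t : T' ⟶ T) (H : CellRel c d a b) :
    CellRel c d (t ≫ a) (t ≫ b) := by
  obtain ⟨f, ha, hb, C, hC, H⟩ := H
  have hij : ⊤ ≤ f ⁻¹ᵁ (V.U i ⊓ V.U j) := le_inf (c.top_le ha) (d.top_le hb)
  refine ⟨t ≫ f, by rw [Category.assoc, ha], by rw [Category.assoc, hb],
    C.map (pull t (top_le_preimage t)), pull_isUnit_det _ _ hC, fun h => ?_⟩
  have := congrArg (fun M => M.map (pull t (top_le_preimage t))) (H hij)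
  simpa only [map_pull_mul, map_pull_pull] using this

/-- Comparing the rows selected by `I`, which form the identity on both sides, forces the change of
basis to be `1`. -/
lemma CellRel.eq {a b : T ⟶ c.Z} (H : CellRel c c a b) : a = b := by
  obtain ⟨f, ha, hb, C, hC, H⟩ := H
  have h := c.top_le ha
  have hii : ⊤ ≤ f ⁻¹ᵁ (V.U i ⊓ V.U i) := le_inf h h
  have e := H hii
  rw [V.pull_g_self, Matrix.one_mul] at e
  refine c.hom_ext a b (ha.trans hb.symm) ?_
  have e' := congrArg (fun M => M.submatrix I id) e
  simp only [submatrix_mul_id, c.pull_minor, Matrix.one_mul] at e'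
  rw [e, ← e', Matrix.mul_one]

/-- The overlap of two cells. -/
lemma exists_overlap (c : Cell (V.U i) I) (d : Cell (V.U j) I') :
    ∃ (O : c.Z.Opens) (p : O.toScheme ⟶ d.Z), CellRel c d O.ι p ∧
      ∀ {T : Scheme.{u}} (a : T ⟶ c.Z) (b : T ⟶ d.Z), CellRel c d a b → ⊤ ≤ a ⁻¹ᵁ O := by
  let W : c.Z.Opens := c.ν ⁻¹ᵁ (V.U j ⊓ V.U i)
  let B : Matrix m n Γ(c.Z, W) :=
    (V.g j i).map (pull c.ν (le_refl (c.ν ⁻¹ᵁ (V.U j ⊓ V.U i)))) * c.A.map (res (le_top : W ≤ ⊤))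
  -- A point of the first cell lies in the second when the minor `I'` is invertible in the
  -- trivialization `j`; the normalized matrix is then `B * M⁻¹`.
  let M : Matrix n n Γ(c.Z, W) := B.submatrix I' id
  let O := c.Z.basicOpen M.det
  have hOW : O ≤ W := c.Z.basicOpen_le _
  have hO : ⊤ ≤ O.ι ⁻¹ᵁ O := top_le_ι_preimage O
  have hOW' : ⊤ ≤ O.ι ⁻¹ᵁ W := fun x hx => hOW (hO hx)
  have hM : IsUnit (M.map (pull O.ι hOW')) := by
    have := pull_isUnit_det O.ι hO (isUnit_map_res_basicOpen M)
    rwa [map_pull_res] at this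
  have hM' := (Matrix.isUnit_iff_isUnit_det _).mp hM
  have hj : ⊤ ≤ (O.ι ≫ c.ν) ⁻¹ᵁ V.U j := fun x hx => (hOW' hx).1
  obtain ⟨p, hp, hp'⟩ := d.exists_hom (O.ι ≫ c.ν)
    (B.map (pull O.ι hOW') * (M.map (pull O.ι hOW'))⁻¹) hj (by
      rw [submatrix_mul_id, Matrix.submatrix_map]
      exact Matrix.mul_nonsing_inv _ hM')
  have hB {T : Scheme.{u}} (a : T ⟶ c.Z) (h : ⊤ ≤ a ⁻¹ᵁ W) (h' : ⊤ ≤ (a ≫ c.ν) ⁻¹ᵁ (V.U j ⊓ V.U i)) :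
      B.map (pull a h) = (V.g j i).map (pull (a ≫ c.ν) h') *
        c.A.map (pull a (top_le_preimage a)) := by
    simp only [B, map_pull_mul, map_pull_pull, map_pull_res]
  refine ⟨O, p, CellRel.symm ⟨O.ι ≫ c.ν, hp, rfl, (M.map (pull O.ι hOW'))⁻¹,
    Matrix.isUnit_nonsing_inv_iff.mpr hM, fun h => ?_⟩, ?_⟩
  · rw [hp', hB O.ι hOW' h]
  · intro T a b H
    obtain ⟨f, hb, ha, C, hC, H⟩ := H.symm
    obtain rfl := ha
    have h₁ := c.top_le (rfl : a ≫ c.ν = _)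
    have h₂ := d.top_le hb
    have hji : ⊤ ≤ (a ≫ c.ν) ⁻¹ᵁ (V.U j ⊓ V.U i) := le_inf h₂ h₁
    have e := H hji
    rw [← hB a hji hji] at e
    have e' := congrArg (fun N => N.submatrix I' id) e
    simp only [submatrix_mul_id, d.pull_minor] at e'
    -- The rows `I'` of the second cell's matrix form the identity, so the relation itself exhibits
    -- an inverse of the minor.
    have hu : IsUnit (M.map (pull a hji)) := IsUnit.of_mul_eq_one _ e'.symm
    rw [Matrix.isUnit_iff_isUnit_det] at hu
    have hd : (M.map (pull a hji)).det = pull a hji M.det := ((pull a hji).map_det M).symm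
    rw [hd] at hu
    have := Scheme.basicOpen_of_isUnit T hu
    have e₂ := Scheme.basicOpen_appLE a ⊤ W hji M.det
    have e₃ : (⊤ : T.Opens) ≤ ⊤ ⊓ a ⁻¹ᵁ O := (this.symm.trans e₂).le
    exact e₃.trans inf_le_right

end Relation

end Cells

/-! ### Existence of Grassmann bundles. -/

section Existence

variable {m n : Type} [Fintype m] [DecidableEq m] [Fintype n] [DecidableEq n]
  {T T' X Y Z : Scheme.{u}}

lemma pull_bijective (e : Z ⟶ Y) [IsOpenImmersion e] {U : Y.Opens} {O : Z.Opens}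
    (h : O ≤ e ⁻¹ᵁ U) (hO : e ⁻¹ᵁ U ≤ O) (h' : U ≤ e.opensRange) :
    Function.Bijective (pull e h) := by
  obtain rfl := le_antisymm h hO
  have := e.isIso_app U h'
  have e₁ : pull e h = (e.app U).hom := 
    congrArg CommRingCat.Hom.hom (e.app_eq_appLE (U := U)).symm
  rw [e₁]
  exact ConcreteCategory.bijective_of_isIso (e.app U)

lemma exists_mat_pull_eq (e : Z ⟶ Y) [IsOpenImmersion e] {U : Y.Opens} {O : Z.Opens}
    (h : O ≤ e ⁻¹ᵁ U) (hO : e ⁻¹ᵁ U ≤ O) (h' : U ≤ e.opensRange) (A : Matrix m n Γ(Z, O)) :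
    ∃ B : Matrix m n Γ(Y, U), B.map (pull e h) = A := by
  choose B hB using fun i j => (pull_bijective e h hO h').2 (A i j)
  exact ⟨Matrix.of B, by ext i j; exact hB i j⟩

lemma mat_pull_injective (e : Z ⟶ Y) [IsOpenImmersion e] {U : Y.Opens} {O : Z.Opens}
    (h : O ≤ e ⁻¹ᵁ U) (hO : e ⁻¹ᵁ U ≤ O) (h' : U ≤ e.opensRange) {A B : Matrix m n Γ(Y, U)}
    (H : A.map (pull e h) = B.map (pull e h)) : A = B :=
  Matrix.map_injective (pull_bijective e h hO h').1 H

lemma mat_pull_ι_injective (U : Y.Opens) {A B : Matrix m n Γ(Y, U)}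
    (H : A.map (pull U.ι (top_le_ι_preimage U)) = B.map (pull U.ι (top_le_ι_preimage U))) :
    A = B :=
  mat_pull_injective U.ι _ le_top (by rw [Scheme.Opens.opensRange_ι]) H

lemma exists_mat_pull_ι_eq (U : Y.Opens) (A : Matrix m n Γ(U.toScheme, ⊤)) :
    ∃ B : Matrix m n Γ(Y, U), B.map (pull U.ι (top_le_ι_preimage U)) = A :=
  exists_mat_pull_eq U.ι _ le_top (by rw [Scheme.Opens.opensRange_ι]) A

lemma exists_hom_of_charts {J : Type u} {Z : J → Scheme.{u}} (e : ∀ j, Z j ⟶ T)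
    [∀ j, IsOpenImmersion (e j)] (he : ∀ x : T, ∃ (j : J) (y : Z j), e j y = x)
    (f : ∀ j, Z j ⟶ Y)
    (H : ∀ (i j : J) (T' : Scheme.{u}) (a : T' ⟶ Z i) (b : T' ⟶ Z j),
      a ≫ e i = b ≫ e j → a ≫ f i = b ≫ f j) : ∃ g : T ⟶ Y, ∀ j, e j ≫ g = f j := by
  obtain ⟨g, hg⟩ := exists_hom_glue (fun j => (e j).opensRange)
    (fun x => by obtain ⟨j, y, h⟩ := he x; exact ⟨j, y, h⟩)
    (fun j => (e j).isoOpensRange.inv ≫ f j) (fun i j T' a b hab => by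
      rw [← Category.assoc, ← Category.assoc]
      refine H i j T' _ _ ?_
      rw [Category.assoc, Category.assoc, Scheme.Hom.isoOpensRange_inv_comp,
        Scheme.Hom.isoOpensRange_inv_comp, hab])
  refine ⟨g, fun j => ?_⟩
  rw [← cancel_epi (e j).isoOpensRange.inv, ← hg j, ← Category.assoc,
    Scheme.Hom.isoOpensRange_inv_comp]

/-- A frame of a subbundle is a frame of its pull-back. -/
lemma BundleMap.IsFrame.transfer {f : T ⟶ X} {S : VectorBundle T n} {V : VectorBundle X m}
    {j : BundleMap f S V} {h : T' ⟶ T} {f' : T' ⟶ X} {S' : VectorBundle T' n}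
    {j' : BundleMap f' S' V} (e : h ≫ f = f') (hj : j.IsSubbundle) (hj' : j'.IsSubbundle)
    (H : ∃ k : BundleMap h S' S, IsComp k j j') {i : V.ι} {O : T'.Opens}
    {A : Matrix m n Γ(T', O)} (hA : j.IsFrame h i A) : j'.IsFrame (𝟙 T') i A := by
  refine BundleMap.IsFrame.of_local fun x hx => ?_
  obtain ⟨O', hx', k, B, hB, hB'⟩ := (exists_isComp_iff e hj hj').mp H x
  have h₁ : O ⊓ O' ≤ O := inf_le_left
  have h₂ : O ⊓ O' ≤ O' := inf_le_right
  have hi := hA.le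
  have hk := hB.le
  have e' : f' = 𝟙 T' ≫ f' := (Category.id_comp _).symm
  have hik : O ⊓ O' ≤ f' ⁻¹ᵁ (V.U i ⊓ V.U k) := by
    subst e
    exact sub
  obtain ⟨C, hC, eC⟩ := (hA.res h₁).exists_eq hj (hB.res h₂) e hik
  refine ⟨O ⊓ O', h₁, ⟨hx, hx'⟩, ?_⟩
  rw [eC]
  exact (hB'.res h₂).change (Category.id_comp _) hik hC

/-- Locally, a subbundle has frames some rows of which form the identity matrix. -/
lemma BundleMap.IsSubbundle.exists_normalized {f : T ⟶ X} {S : VectorBundle T n}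
    {V : VectorBundle X m} {j : BundleMap f S V} (hj : j.IsSubbundle) (x : T) :
    ∃ (i : V.ι) (I : n ↪ m) (O : T.Opens) (B : Matrix m n Γ(T, O)), x ∈ O ∧
      j.IsFrame (𝟙 T) i B ∧ B.submatrix I id = 1 := by
  obtain ⟨i, hi⟩ := V.exists_mem (f x)
  obtain ⟨a, ha⟩ := S.exists_mem x
  obtain ⟨I, O, hO, hx, hI⟩ := ((isSubbundle_iff j).mp hj i a).exists_minor
    (⟨hi, ha⟩ : x ∈ f ⁻¹ᵁ V.U i ⊓ S.U a)
  refine ⟨i, I, O, (j.mat i a).map (GrassBundle.res hO) *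
    (((j.mat i a).submatrix I id).map (GrassBundle.res hO))⁻¹, hx,
    (j.isFrame_id_mat i a hO).mul (Matrix.isUnit_nonsing_inv_iff.mpr hI), ?_⟩
  rw [submatrix_mul_id, Matrix.submatrix_map]
  exact Matrix.mul_nonsing_inv _ ((Matrix.isUnit_iff_isUnit_det _).mp hI)

/-- The gluing relation between the cells. -/
def cellGluingRel (V : VectorBundle X m)
    (c : ∀ p : V.ι × (n ↪ m), Cell (V.U p.1) p.2) : GluingRel fun p => (c p).Z where
  Rel {_ p q} a b := CellRel (c p) (c q) a b
  refl a := CellRel.refl a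
  symm h := h.symm
  trans h h' := h.trans h'
  comp t h := h.comp t
  dom p q := (exists_overlap (c p) (c q)).choose
  map p q := (exists_overlap (c p) (c q)).choose_spec.choose
  rel_map p q := (exists_overlap (c p) (c q)).choose_spec.choose_spec.1
  exists_lift {T p q a b} h := by
    obtain ⟨t, ht⟩ := exists_lift_opens _ a
      ((exists_overlap (c p) (c q)).choose_spec.choose_spec.2 a b h)
    refine ⟨t, ht, CellRel.eq (((exists_overlap (c p) (c q)).choose_spec.choose_spec.1.comp
      t).symm.trans ?_)⟩
    rw [ht]
    exact h

/-- The cells for all trivializations and all choices of `s` rows are glued, and their matrices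
become frames of the tautological bundle. A subbundle has normalized frames locally, hence local
morphisms to cells; these agree in the glued scheme because two frames of one subbundle differ by a
change of basis. The same comparison gives uniqueness. -/
theorem nonempty_grassmannian (V : VectorBundle X m) (s : ℕ) : Nonempty (Grassmannian V s) := by
  obtain ⟨c⟩ := Classical.nonempty_pi.mpr
    fun p : V.ι × (Fin s ↪ m) => nonempty_cell (V.U p.1) p.2
  obtain ⟨G, e, he, hsurj, hrel⟩ := (cellGluingRel V c).exists_glued
  have hrel' {T : Scheme.{u}} {p q : V.ι × (Fin s ↪ m)} (a : T ⟶ (c p).Z) (b : T ⟶ (c q).Z) :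
    a ≫ e p = b ≫ e q ↔ CellRel (c p) (c q) a b := hrel a b
  obtain ⟨ν, hν⟩ := exists_hom_of_charts e hsurj (fun p => (c p).ν) fun p q T' a b h => by
    obtain ⟨f, ha, hb, -⟩ := (hrel' a b).mp h
    exact ha.trans hb.symm
  let R (p : V.ι × (Fin s ↪ m)) : G.Opens := (e p).opensRange
  have hR : ⨆ p, R p = ⊤ := top_le_iff.mp fun x _ => by
    obtain ⟨p, y, h⟩ := hsurj x
    exact Opens.mem_iSup.mpr ⟨p, y, h⟩
  have htop (p) : ⊤ ≤ e p ⁻¹ᵁ R p := (Scheme.Hom.preimage_opensRange (e p)).ge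
  -- The matrix of a cell is transported to the open image of the cell.
  choose A hA using fun p => exists_mat_pull_eq (e p) (htop p) le_top le_rfl (c p).A
  have hA' {T : Scheme.{u}} {p} (a : T ⟶ (c p).Z) (h : T ⟶ G) (ha : a ≫ e p = h)
      (hO : ⊤ ≤ h ⁻¹ᵁ R p) : (A p).map (pull h hO) = (c p).A.map (pull a (top_le_preimage a)) := by
    subst ha
    rw [← hA p, map_pull_pull]
  have hlift {T : Scheme.{u}} {p} (h : T ⟶ G) (hO : ⊤ ≤ h ⁻¹ᵁ R p) :
      ∃ a : T ⟶ (c p).Z, a ≫ e p = h := by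
    refine ⟨IsOpenImmersion.lift (e p) h ?_, IsOpenImmersion.lift_fac _ _ _⟩
    rintro _ ⟨x, rfl⟩
    exact hO (trivial : x ∈ (⊤ : T.Opens))
  have hRle (p) : R p ≤ ν ⁻¹ᵁ V.U p.1 := by
    rintro _ ⟨y, rfl⟩
    have h₁ : y ∈ (e p ≫ ν) ⁻¹ᵁ V.U p.1 := by
      rw [hν]
      exact (c p).le (trivial : y ∈ (⊤ : (c p).Z.Opens))
    exact h₁
  obtain ⟨S, incl, hincl, hframe⟩ := exists_subbundle R hR (fun p => p.1) hRle A
    (fun p => LocSplit.of_minor p.2 (by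
      have : (A p).submatrix p.2 id = 1 := by
        refine mat_pull_injective (e p) (htop p) le_top le_rfl ?_
        rw [← Matrix.submatrix_map, hA, (c p).minor, map_pull_one]
      rw [this]
      exact isUnit_one))
    (fun p q hpq => by
      let O := R p ⊓ R q
      have hO := top_le_ι_preimage O
      have hp : ⊤ ≤ O.ι ⁻¹ᵁ R p := hO.trans fun x hx => hx.1
      have hq : ⊤ ≤ O.ι ⁻¹ᵁ R q := hO.trans fun x hx => hx.2
      obtain ⟨a, ha⟩ := hlift O.ι hp
      obtain ⟨b, hb⟩ := hlift O.ι hq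
      -- The overlap has a lift to each of the two cells; both lifts are the same point of `G`, so
      -- they are related, and the relation supplies the transition matrix.
      obtain ⟨f, hbf, haf, C, hC, H⟩ := (hrel' b a).mp (hb.trans ha.symm)
      have hf : O.ι ≫ ν = f := by rw [← ha, Category.assoc, hν, haf]
      subst hf
      obtain ⟨D, hD⟩ := exists_mat_pull_ι_eq O C
      have hqp : ⊤ ≤ (O.ι ≫ ν) ⁻¹ᵁ (V.U q.1 ⊓ V.U p.1) := (c q).top_le hbf |>.trans
        fun x hx => ⟨hx, (c p).top_le haf trivial⟩
      have hpq' : ⊤ ≤ (O.ι ≫ ν) ⁻¹ᵁ (V.U p.1 ⊓ V.U q.1) := hqp.trans fun x hx => hx.symm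
      have hpp : ⊤ ≤ (O.ι ≫ ν) ⁻¹ᵁ (V.U p.1 ⊓ V.U p.1) := hqp.trans fun x hx => ⟨hx.2, hx.2⟩
      refine ⟨D, mat_pull_ι_injective O ?_⟩
      have e₁ := H hqp
      rw [← hA' a O.ι ha hp, ← hA' b O.ι hb hq] at e₁
      simp only [map_pull_mul, map_pull_res, map_pull_pull]
      rw [e₁, hD, ← Matrix.mul_assoc, ← Matrix.mul_assoc, V.pull_g_mul _ p.1 q.1 p.1 _ _ hpp,
        V.pull_g_self, Matrix.one_mul])
  have hpull {T : Scheme.{u}} {p} {O : T.Opens} (h : T ⟶ G) (hO : O ≤ h ⁻¹ᵁ R p) :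
      incl.IsFrame h p.1 ((A p).map (pull h hO)) := by
    have := (hframe p).pull h hO
    rwa [Category.comp_id] at this
  refine ⟨⟨G, ν, S, incl, hincl, fun {T} f S' j hj => ?_⟩⟩
  refine existsUnique_of_exists_of_unique ?_ ?_
  · choose i I O B hx hB hI using hj.exists_normalized
    have hOi (x) : ⊤ ≤ ((O x).ι ≫ f) ⁻¹ᵁ V.U (i x) :=
      (top_le_ι_preimage (O x)).trans fun y hy => (hB x).le hy
    choose h hh hhB using fun x => (c (i x, I x)).exists_hom ((O x).ι ≫ f)
      ((B x).map (pull (O x).ι (top_le_ι_preimage (O x)))) (hOi x) (by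
        rw [Matrix.submatrix_map, hI, map_pull_one])
    obtain ⟨g, hg⟩ := exists_hom_glue O (fun x => ⟨x, hx x⟩) (fun x => h x ≫ e (i x, I x))
      (fun x y T' a b hab => by
        rw [← Category.assoc, ← Category.assoc, hrel']
        let t := a ≫ (O x).ι
        have ht : ⊤ ≤ t ⁻¹ᵁ O x := fun z _ => top_le_ι_preimage (O x) trivial
        have ht' : ⊤ ≤ t ⁻¹ᵁ O y := by
          simp only [t, hab]
          exact fun z _ => top_le_ι_preimage (O y) trivial
        have hx₁ := (hB x).pull t ht
        have hy₁ := (hB y).pull t ht'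
        rw [Category.comp_id] at hx₁ hy₁
        have hxy : ⊤ ≤ (t ≫ f) ⁻¹ᵁ (V.U (i x) ⊓ V.U (i y)) := le_inf hx₁.le hy₁.le
        obtain ⟨C, hC, eC⟩ := hx₁.exists_eq hj hy₁ rfl hxy
        refine ⟨t ≫ f, by simp only [Category.assoc, hh, t],
          by simp only [Category.assoc, hh, t, hab], C, hC, fun hxy => ?_⟩
        have eA := map_pull_pull a (h x) (top_le_preimage (h x)) (top_le_preimage a)
          (c (i x, I x)).A
        have eA' := map_pull_pull b (h y) (top_le_preimage (h y)) (top_le_preimage b)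
          (c (i y, I y)).A
        rw [hhB, map_pull_pull] at eA eA'
        rw [← eA', map_pull_congr hab.symm _ ht']
        exact eA.symm.trans eC)
    have hgν : g ≫ ν = f := by
      refine hom_ext_of_local fun x => ⟨O x, hx x, ?_⟩
      rw [← Category.assoc, hg, Category.assoc, hν, hh]
    refine ⟨g, hgν, (exists_isComp_iff hgν hincl hj).mpr fun x =>
      ⟨O x, hx x, i x, B x, ?_, hB x⟩⟩
    have hOR : O x ≤ g ⁻¹ᵁ R (i x, I x) := by
      intro y hy
      have e₁ : ((O x).ι ≫ g) ⟨y, hy⟩ = (h x ≫ e (i x, I x)) ⟨y, hy⟩ := by rw [hg]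
      exact ⟨_, e₁.symm⟩
    have := hpull g hOR
    have e₁ : (A (i x, I x)).map (pull g hOR) = B x := by
      refine mat_pull_ι_injective _ ?_
      rw [map_pull_pull, hA' (h x) _ (hg x).symm, hhB]
    rwa [e₁] at this
  · rintro h h' ⟨hν₁, hk⟩ ⟨hν₂, hk'⟩
    refine hom_ext_of_local fun x => ?_
    have hmem (y : G) : ∃ p, y ∈ R p := by
      obtain ⟨p, z, hz⟩ := hsurj y
      exact ⟨p, z, hz⟩
    obtain ⟨p, hp⟩ := hmem (h x)
    obtain ⟨q, hq⟩ := hmem (h' x)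
    -- On this set each morphism lifts to one cell, and the two pulled-back tautological frames are
    -- frames of the same subbundle `j`.
    let O : T.Opens := h ⁻¹ᵁ R p ⊓ h' ⁻¹ᵁ R q
    have h₁ : O ≤ h ⁻¹ᵁ R p := inf_le_left
    have h₂ : O ≤ h' ⁻¹ᵁ R q := inf_le_right
    refine ⟨O, ⟨hp, hq⟩, ?_⟩
    have f₁ := (hpull h h₁).transfer hν₁ hincl hj hk
    have f₂ := (hpull h' h₂).transfer hν₂ hincl hj hk'
    have hpq : O ≤ f ⁻¹ᵁ (V.U p.1 ⊓ V.U q.1) := le_inf f₁.le f₂.le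
    obtain ⟨C, hC, eC⟩ := f₁.exists_eq hj f₂ (Category.id_comp f) hpq
    have hO := top_le_ι_preimage O
    have h₃ : ⊤ ≤ (O.ι ≫ h) ⁻¹ᵁ R p := hO.trans fun x hx => h₁ hx
    have h₄ : ⊤ ≤ (O.ι ≫ h') ⁻¹ᵁ R q := hO.trans fun x hx => h₂ hx
    obtain ⟨a, ha⟩ := hlift (O.ι ≫ h) h₃
    obtain ⟨b, hb⟩ := hlift (O.ι ≫ h') h₄
    rw [← ha, ← hb, hrel']
    refine ⟨O.ι ≫ f, ?_, ?_, C.map (pull O.ι hO), pull_isUnit_det _ _ hC, fun _ => ?_⟩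
    · rw [← hν p, ← Category.assoc, ha, Category.assoc, hν₁]
    · rw [← hν q, ← Category.assoc, hb, Category.assoc, hν₂]
    have := congrArg (fun M => M.map (pull O.ι hO)) eC
    simp only [map_pull_mul, map_pull_pull] at this
    rw [← hA' a _ ha h₃, ← hA' b _ hb h₄, this]

end Existence

/-! ### Local splittings of a short exact sequence. -/

section Splitting

variable {k n r : Type} [Fintype k] [DecidableEq k] [Fintype n] [DecidableEq n]
  [Fintype r] [DecidableEq r] {T X : Scheme.{u}}

/-- The columns of `σ` are preimages of the basis vectors. The columns of `1 - σ * P` are killed by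
`P`, hence come from `F`, which gives `θ`; finally `F * θ * F = F`, and `F` is injective. -/
lemma exists_matrix_splitting {R : Type*} [CommRing R] {F : Matrix n k R} {P : Matrix r n R}
    (hF : Function.Injective F.mulVecLin) (hex : Function.Exact F.mulVecLin P.mulVecLin)
    (hP : Function.Surjective P.mulVecLin) :
    ∃ (σ : Matrix n r R) (θ : Matrix k n R), F * θ + σ * P = 1 ∧ θ * F = 1 ∧ P * σ = 1 := by
  choose s hs using fun j : r => hP (Pi.single j 1)
  let σ : Matrix n r R := (Matrix.of s).transpose
  have hσ : P * σ = 1 := by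
    ext i j
    have := congrFun (hs j) i
    rw [Matrix.one_apply, ← Pi.single_apply]
    exact this.trans (by rw [Pi.single_comm])
  have hPF : P * F = 0 := by
    ext i j
    have := congrFun (hex.apply_apply_eq_zero (Pi.single j 1)) i
    rw [Matrix.mulVecLin_apply, Matrix.mulVecLin_apply, Matrix.mulVec_mulVec,
      Matrix.mulVec_single_one] at this
    exact this
  have hker (j : n) : P.mulVecLin ((1 - σ * P).col j) = 0 := by
    have e : P * (1 - σ * P) = 0 := by
      rw [Matrix.mul_sub, ← Matrix.mul_assoc, hσ, Matrix.one_mul, Matrix.mul_one, sub_self]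
    funext i
    exact congrFun (congrFun e i) j
  choose t ht using fun j : n => (hex _).mp (hker j)
  let θ : Matrix k n R := (Matrix.of t).transpose
  have hθ : F * θ = 1 - σ * P := by
    ext i j
    exact congrFun (ht j) i
  refine ⟨σ, θ, by rw [hθ, sub_add_cancel], ?_, hσ⟩
  have e : F * (θ * F) = F * (1 : Matrix k k R) := by
    rw [← Matrix.mul_assoc, hθ, Matrix.sub_mul, Matrix.mul_assoc, hPF, Matrix.mul_zero, sub_zero,
      Matrix.one_mul, Matrix.mul_one]
  ext i j
  exact congrFun (hF (a₁ := (θ * F).col j) (a₂ := (1 : Matrix k k R).col j) (by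
    funext l
    exact congrFun (congrFun e l) j)) i

lemma exists_opens_le {ι : Type} [Finite ι] {x : X} (O : ι → X.Opens) (h : ∀ i, x ∈ O i) :
    ∃ U : X.Opens, x ∈ U ∧ ∀ i, U ≤ O i :=
  ⟨⟨⋂ i, O i, isOpen_iInter_of_finite fun i => (O i).isOpen⟩, Set.mem_iInter.mpr h,
    fun i => Set.iInter_subset _ i⟩

lemma germ_res {U O : X.Opens} (h : O ≤ U) {x : X} (hx : x ∈ O) (a : Γ(X, U)) :
    germ x hx (res h a) = germ x (h hx) a :=
  X.presheaf.germ_res_apply (homOfLE h) x hx a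

lemma map_germ_res {m : Type} {U O : X.Opens} (h : O ≤ U) {x : X} (hx : x ∈ O)
    (A : Matrix m n Γ(X, U)) : (A.map (res h)).map (germ x hx) = A.map (germ x (h hx)) := by
  ext i j
  exact germ_res h hx _

/-- Only finitely many germs are involved, so they have representatives on a common neighbourhood.
-/
lemma exists_mat_germ {m : Type} [Finite m] {x : X} {O : X.Opens} (hx : x ∈ O)
    (A : Matrix m n (X.presheaf.stalk x)) :
    ∃ (U : X.Opens) (hxU : x ∈ U) (_ : U ≤ O) (B : Matrix m n Γ(X, U)),
      B.map (germ x hxU) = A := by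
  choose V hV hxV b hb using fun p : m × n => X.presheaf.exists_le_germ_eq (A p.1 p.2) hx
  obtain ⟨U, hU, hUV⟩ := exists_opens_le (fun o : Option (m × n) => o.elim O V)
    (fun o => by cases o; exacts [hx, hxV _])
  refine ⟨U, hU, hUV none, Matrix.of fun i j => res (hUV (some (i, j))) (b (i, j)), ?_⟩
  ext i j
  exact (germ_res (hUV (some (i, j))) hU (b (i, j))).trans (hb (i, j))

lemma exists_mat_res_eq {m : Type} [Finite m] {x : X} {O : X.Opens} (hx : x ∈ O)
    {A B : Matrix m n Γ(X, O)} (h : A.map (germ x hx) = B.map (germ x hx)) :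
    ∃ (U : X.Opens) (hU : U ≤ O), x ∈ U ∧ A.map (res hU) = B.map (res hU) := by
  choose V hxV i₁ i₂ hV using fun p : m × n =>
    X.presheaf.germ_eq x hx hx (A p.1 p.2) (B p.1 p.2) (congrFun (congrFun h p.1) p.2)
  obtain ⟨U, hU, hUV⟩ := exists_opens_le (fun o : Option (m × n) => o.elim O V)
    (fun o => by cases o; exacts [hx, hxV _])
  refine ⟨U, hUV none, hU, ?_⟩
  ext i j
  have h₁ : V (i, j) ≤ O := (i₁ (i, j)).le
  have h₂ : res h₁ (A i j) = res h₁ (B i j) := hV (i, j)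
  have h₃ : U ≤ V (i, j) := hUV (some (i, j))
  exact (res_res h₁ h₃ _).symm.trans ((congrArg (res h₃) h₂).trans (res_res h₁ h₃ _))

variable {K : VectorBundle X k} {V : VectorBundle X n} {W : VectorBundle X r}

/-- A splitting of the sequence `K → V → W` over an open subset of trivializing open sets. -/
structure LocalSplitting (φ : BundleHom K V) (ρ : BundleHom V W) where
  κ : K.ι
  i : V.ι
  w : W.ι
  O : X.Opens
  leK : O ≤ K.U κ
  leV : O ≤ V.U i
  leW : O ≤ W.U w
  F : Matrix n k Γ(X, O)
  P : Matrix r n Γ(X, O)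
  σ : Matrix n r Γ(X, O)
  θ : Matrix k n Γ(X, O)
  eqF : ∀ h, (φ.mat i κ).map (res h) = F
  eqP : ∀ h, (ρ.mat w i).map (res h) = P
  split : F * θ + σ * P = 1
  θ_mul_F : θ * F = 1
  P_mul_σ : P * σ = 1

lemma LocalSplitting.P_mul_F {φ : BundleHom K V} {ρ : BundleHom V W} (L : LocalSplitting φ ρ) :
    L.P * L.F = 0 := by
  -- Both summands on the left become `P * F`, so `P * F + P * F = P * F`.
  have h := congrArg (fun M => L.P * M * L.F) L.split
  simp only [Matrix.mul_add, Matrix.add_mul, Matrix.mul_one] at h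
  rw [Matrix.mul_assoc L.P (L.F * L.θ), Matrix.mul_assoc L.F, L.θ_mul_F, Matrix.mul_one,
    ← Matrix.mul_assoc L.P L.σ, L.P_mul_σ, Matrix.one_mul] at h
  simpa using h

lemma LocalSplitting.θ_mul_σ {φ : BundleHom K V} {ρ : BundleHom V W} (L : LocalSplitting φ ρ) :
    L.θ * L.σ = 0 := by
  -- As before, both summands become `θ * σ`.
  have h := congrArg (fun M => L.θ * M * L.σ) L.split
  simp only [Matrix.mul_add, Matrix.add_mul, Matrix.mul_one] at h
  rw [← Matrix.mul_assoc L.θ L.F, L.θ_mul_F, Matrix.one_mul, Matrix.mul_assoc L.θ,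
    Matrix.mul_assoc L.σ, L.P_mul_σ, Matrix.mul_one] at h
  simpa using h

/-- A short exact sequence of vector bundles is locally split. -/
lemma ShortExact.exists_localSplitting {φ : BundleHom K V} {ρ : BundleHom V W}
    (hex : ShortExact φ ρ) {κ : K.ι} {i : V.ι} {w : W.ι} {x : X} (hκ : x ∈ K.U κ)
    (hi : x ∈ V.U i) (hw : x ∈ W.U w) :
    ∃ L : LocalSplitting φ ρ, L.κ = κ ∧ L.i = i ∧ L.w = w ∧ x ∈ L.O := by
  obtain ⟨h₁, h₂, h₃⟩ := hex κ i w x hκ hi hw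
  -- The sequence of stalks is split over the local ring; the matrices, and then the three
  -- identities between them, are spread out to a neighbourhood.
  obtain ⟨σ₀, θ₀, e₁, e₂, e₃⟩ := exists_matrix_splitting h₁ h₂ h₃
  let O₀ : X.Opens := K.U κ ⊓ V.U i ⊓ W.U w
  obtain ⟨O₁, hx₁, hO₁, σ₁, hσ₁⟩ := exists_mat_germ (O := O₀) ⟨⟨hκ, hi⟩, hw⟩ σ₀
  obtain ⟨O₂, hx₂, hO₂, θ₂, hθ₂⟩ := exists_mat_germ hx₁ θ₀
  have le₁ : O₂ ≤ 𝟙 X ⁻¹ᵁ V.U i ⊓ K.U κ := fun y hy => ⟨(hO₁ (hO₂ hy)).1.2, (hO₁ (hO₂ hy)).1.1⟩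
  have le₂ : O₂ ≤ 𝟙 X ⁻¹ᵁ W.U w ⊓ V.U i := fun y hy => ⟨(hO₁ (hO₂ hy)).2, (hO₁ (hO₂ hy)).1.2⟩
  let F₂ : Matrix n k Γ(X, O₂) := (φ.mat i κ).map (res le₁)
  let P₂ : Matrix r n Γ(X, O₂) := (ρ.mat w i).map (res le₂)
  let σ₂ : Matrix n r Γ(X, O₂) := σ₁.map (res hO₂)
  have hF : F₂.map (germ x hx₂) = (φ.mat i κ).map (germ x (⟨hi, hκ⟩ : x ∈ 𝟙 X ⁻¹ᵁ V.U i ⊓ K.U κ)) := map_germ_res _ _ _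
  have hP : P₂.map (germ x hx₂) = (ρ.mat w i).map (germ x (⟨hw, hi⟩ : x ∈ 𝟙 X ⁻¹ᵁ W.U w ⊓ V.U i)) := map_germ_res _ _ _
  have hσ : σ₂.map (germ x hx₂) = σ₀ := (map_germ_res _ _ _).trans hσ₁
  have hone {l : Type} [DecidableEq l] : (1 : Matrix l l Γ(X, O₂)).map (germ x hx₂) = 1 :=
    Matrix.map_one _ (map_zero _) (map_one _)
  obtain ⟨O₃, hO₃, hx₃, E₁⟩ := exists_mat_res_eq hx₂ (A := F₂ * θ₂ + σ₂ * P₂) (B := 1) (by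
    rw [Matrix.map_add _ (map_add _), Matrix.map_mul, Matrix.map_mul, hF, hP, hσ, hθ₂, hone, e₁])
  obtain ⟨O₄, hO₄, hx₄, E₂⟩ := exists_mat_res_eq hx₂ (A := θ₂ * F₂) (B := 1) (by
    rw [Matrix.map_mul, hF, hθ₂, hone, e₂])
  obtain ⟨O₅, hO₅, hx₅, E₃⟩ := exists_mat_res_eq hx₂ (A := P₂ * σ₂) (B := 1) (by
    rw [Matrix.map_mul, hP, hσ, hone, e₃])
  let O : X.Opens := O₃ ⊓ O₄ ⊓ O₅
  have l₃ : O ≤ O₃ := inf_le_left.trans inf_le_left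
  have l₄ : O ≤ O₄ := inf_le_left.trans inf_le_right
  have l₅ : O ≤ O₅ := inf_le_right
  have l₂ : O ≤ O₂ := l₃.trans hO₃
  have D₁ := congrArg (fun M => M.map (res l₃)) E₁
  have D₂ := congrArg (fun M => M.map (res l₄)) E₂
  have D₃ := congrArg (fun M => M.map (res l₅)) E₃
  simp only [map_res_add, map_res_mul, map_res_res, map_res_one] at D₁ D₂ D₃
  exact ⟨⟨κ, i, w, O, fun y hy => (le₁ (l₂ hy)).2, fun y hy => (le₁ (l₂ hy)).1,
    fun y hy => (le₂ (l₂ hy)).1, F₂.map (res l₂), P₂.map (res l₂), σ₂.map (res l₂),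
    θ₂.map (res l₂), fun h => (map_res_res _ _ _).symm, fun h => (map_res_res _ _ _).symm,
    D₁, D₂, D₃⟩, rfl, rfl, rfl, ⟨⟨hx₃, hx₄⟩, hx₅⟩⟩

end Splitting

/-! ### Morphisms to a Grassmann bundle in terms of frames. -/

section FramesOfGrassmannians

variable {m n l : Type} [Fintype m] [DecidableEq m] [Fintype n] [DecidableEq n]
  [Fintype l] [DecidableEq l] {T T' T'' X Y : Scheme.{u}}

/-- A frame of the pull-back of a subbundle is a frame of the subbundle. -/
lemma BundleMap.IsFrame.transfer_symm {f : T ⟶ X} {S : VectorBundle T n} {V : VectorBundle X m}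
    {j : BundleMap f S V} {h : T' ⟶ T} {f' : T' ⟶ X} {S' : VectorBundle T' n}
    {j' : BundleMap f' S' V} (e : h ≫ f = f') (hj : j.IsSubbundle) (hj' : j'.IsSubbundle)
    (H : ∃ k : BundleMap h S' S, IsComp k j j') {i : V.ι} {O : T'.Opens}
    {A : Matrix m n Γ(T', O)} (hA : j'.IsFrame (𝟙 T') i A) : j.IsFrame h i A := by
  refine BundleMap.IsFrame.of_local fun x hx => ?_
  obtain ⟨O', hx', k, B, hB, hB'⟩ := (exists_isComp_iff e hj hj').mp H x
  have h₁ : O ⊓ O' ≤ O := inf_le_left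
  have h₂ : O ⊓ O' ≤ O' := inf_le_right
  have hi := hA.le
  have hk := hB.le
  have hik : O ⊓ O' ≤ f' ⁻¹ᵁ (V.U i ⊓ V.U k) := by
    subst e
    exact sub
  obtain ⟨C, hC, eC⟩ := (hA.res h₁).exists_eq hj' (hB'.res h₂) (Category.id_comp _) hik
  refine ⟨O ⊓ O', h₁, ⟨hx, hx'⟩, ?_⟩
  rw [eC]
  exact (hB.res h₂).change e hik hC

lemma BundleMap.isFrame_baseChange_iff {f : T ⟶ X} {S : VectorBundle T n} {V : VectorBundle X m}
    {j : BundleMap f S V} {h : T' ⟶ T} {t : T'' ⟶ T'} {i : V.ι} {O : T''.Opens}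
    {A : Matrix m n Γ(T'', O)} : (j.baseChange h).IsFrame t i A ↔ j.IsFrame (t ≫ h) i A := by
  constructor
  · intro hA x hx
    obtain ⟨b, O', h₁, h₂, hx', C, hC, e⟩ := hA x hx
    have h₂' : O' ≤ (t ≫ h) ⁻¹ᵁ (f ⁻¹ᵁ V.U i ⊓ S.U b) := h₂
    exact ⟨b, O', h₁, h₂', hx', C, hC,
      e.trans (congrArg (fun M => M * C) (j.pull_baseChange_mat h t i b h₂ h₂'))⟩
  · intro hA x hx
    obtain ⟨b, O', h₁, h₂, hx', C, hC, e⟩ := hA x hx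
    have h₂' : O' ≤ t ⁻¹ᵁ ((h ≫ f) ⁻¹ᵁ V.U i ⊓ (S.pullback h).U b) := h₂
    exact ⟨b, O', h₁, h₂', hx', C, hC,
      e.trans (congrArg (fun M => M * C) (j.pull_baseChange_mat h t i b h₂' h₂).symm)⟩

lemma BundleMap.IsFrame.baseChange {f : T ⟶ X} {S : VectorBundle T n} {V : VectorBundle X m}
    {j : BundleMap f S V} {h : T' ⟶ T} {i : V.ι} {O : T'.Opens} {A : Matrix m n Γ(T', O)}
    (hA : j.IsFrame h i A) : (j.baseChange h).IsFrame (𝟙 T') i A := by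
  rw [BundleMap.isFrame_baseChange_iff, Category.id_comp]
  exact hA

section

variable {V : VectorBundle X m} {s : ℕ} (GV : Grassmannian V s)

/-- A matrix with independent columns defines a point of the Grassmannian. -/
lemma Grassmannian.exists_hom {f : T ⟶ X} {i : V.ι} (hf : ⊤ ≤ f ⁻¹ᵁ V.U i)
    {B : Matrix m (Fin s) Γ(T, ⊤)} (hB : LocSplit B) :
    ∃ h : T ⟶ GV.G, h ≫ GV.ν = f ∧ GV.incl.IsFrame h i B := by
  -- The columns of `B` span a trivial subbundle with a single chart, which the universal property
  -- classifies.
  obtain ⟨S, j, hj, hjB⟩ := exists_subbundle (f := f) (V := V) (fun _ : PUnit => ⊤)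
    (ciSup_const) (fun _ => i) (fun _ => hf) (fun _ => B) (fun _ => hB)
    (fun _ _ h => ⟨1, by rw [V.pull_g_self, Matrix.one_mul, Matrix.mul_one]⟩)
  obtain ⟨h, hh, hk⟩ := (GV.existsUnique f S j hj).exists
  exact ⟨h, hh, (hjB PUnit.unit).transfer_symm hh GV.incl_isSubbundle hj hk⟩

/-- Both morphisms classify the pull-back of the tautological bundle along `a`: for `b` this follows
from the common frames. -/
lemma Grassmannian.hom_ext {a b : T ⟶ GV.G} (e : a ≫ GV.ν = b ≫ GV.ν)
    (H : ∀ x : T, ∃ (O : T.Opens) (_ : x ∈ O) (i : V.ι) (A : Matrix m (Fin s) Γ(T, O)),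
      GV.incl.IsFrame a i A ∧ GV.incl.IsFrame b i A) : a = b := by
  have hj := GV.incl_isSubbundle.baseChange a
  refine (GV.existsUnique (a ≫ GV.ν) _ (GV.incl.baseChange a) hj).unique ⟨rfl, ?_⟩ ⟨e.symm, ?_⟩
  · refine (exists_isComp_iff rfl GV.incl_isSubbundle hj).mpr fun x => ?_
    obtain ⟨O, hx, i, A, h₁, h₂⟩ := H x
    exact ⟨O, hx, i, A, h₁, h₁.baseChange⟩
  · refine (exists_isComp_iff e.symm GV.incl_isSubbundle hj).mpr fun x => ?_
    obtain ⟨O, hx, i, A, h₁, h₂⟩ := H x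
    exact ⟨O, hx, i, A, h₂, h₁.baseChange⟩

end

/-- Two frames of a subbundle with the same image under a linear map, injective on the subbundle,
are equal. -/
lemma BundleMap.IsFrame.eq_of_mul_eq {f : T ⟶ X} {S : VectorBundle T n} {V : VectorBundle X m}
    {j : BundleMap f S V} (hj : j.IsSubbundle) {h : T' ⟶ T} {i : V.ι} {O : T'.Opens}
    {A B : Matrix m n Γ(T', O)} (hA : j.IsFrame h i A) (hB : j.IsFrame h i B)
    {P : Matrix l m Γ(T', O)} (hP : LocSplit (P * B)) (e : P * A = P * B) : A = B := by
  obtain ⟨C, hC, rfl⟩ := hA.exists_eq_mul hj hB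
  have : C = 1 := hP.cancel (by rw [Matrix.mul_one, Matrix.mul_assoc, e])
  rw [this, Matrix.mul_one]

/-- The image of a frame under a bundle map which is injective on the subbundle. -/
lemma BundleMap.IsFrame.push {f : T ⟶ X} {S : VectorBundle T n} {V : VectorBundle X m}
    {W : VectorBundle X l} {j : BundleMap f S V} {ρ : BundleHom V W} {d : BundleMap f S W}
    (hd : IsComp j ρ d) {h : T' ⟶ T} {i : V.ι} {O : T'.Opens} {A : Matrix m n Γ(T', O)}
    (hA : j.IsFrame h i A) (w : W.ι) {f' : T' ⟶ X} (e : h ≫ f = f')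
    (hO : O ≤ f' ⁻¹ᵁ (𝟙 X ⁻¹ᵁ W.U w ⊓ V.U i)) :
    d.IsFrame h w ((ρ.mat w i).map (GrassBundle.pull f' hO) * A) := fun x hx => by
  subst e
  obtain ⟨b, O', h₁, h₂, hx', C, hC, e⟩ := hA x hx
  have h₃ : O' ≤ h ⁻¹ᵁ (f ⁻¹ᵁ W.U w ⊓ S.U b) := fun y hy => ⟨(hO (h₁ hy)).1, (h₂ hy).2⟩
  refine ⟨b, O', h₁, h₃, hx', C, hC, ?_⟩
  have h₄ : f ⁻¹ᵁ (𝟙 X ⁻¹ᵁ W.U w ⊓ V.U i) ⊓ S.U b ≤ f ⁻¹ᵁ W.U w ⊓ S.U b := sub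
  have h₅ : O' ≤ h ⁻¹ᵁ (f ⁻¹ᵁ (𝟙 X ⁻¹ᵁ W.U w ⊓ V.U i) ⊓ S.U b) :=
    fun y hy => ⟨hO (h₁ hy), (h₂ hy).2⟩
  have e₁ := hd.2 w i b (f ⁻¹ᵁ (𝟙 X ⁻¹ᵁ W.U w ⊓ V.U i) ⊓ S.U b) sub sub h₄
  have e₂ := congrArg (fun M => M.map (GrassBundle.pull h h₅)) e₁
  simp only [map_pull_mul, map_pull_res, map_pull_pull] at e₂
  rw [e₂, map_res_mul, e, map_res_pull, Matrix.mul_assoc]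

/-- If the pull-back of a matrix is locally split, so is the matrix near the image. -/
lemma LocSplit.exists_of_pull {h : T' ⟶ T} {U : T.Opens} {O : T'.Opens} {A : Matrix m n Γ(T, U)}
    {hO : O ≤ h ⁻¹ᵁ U} (H : LocSplit (A.map (GrassBundle.pull h hO))) {x : T'} (hx : x ∈ O) :
    ∃ (U' : T.Opens) (hU : U' ≤ U), h x ∈ U' ∧ LocSplit (A.map (GrassBundle.res hU)) := by
  -- An invertible minor of the pull-back is the pull-back of a minor, whose determinant is
  -- therefore nonzero at the image point.
  obtain ⟨I, O', hO', hx', hI⟩ := H.exists_minor hx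
  refine ⟨T.basicOpen (A.submatrix I id).det, T.basicOpen_le _, ?_,
    LocSplit.of_minor I (by
      rw [Matrix.submatrix_map]; exact isUnit_map_res_basicOpen (A.submatrix I id))⟩
  rw [Matrix.submatrix_map, map_res_pull] at hI
  have hle := hO'.trans hO
  have hd : ((A.submatrix I id).map (GrassBundle.pull h hle)).det =
      GrassBundle.pull h hle (A.submatrix I id).det :=
    ((GrassBundle.pull h hle).map_det _).symm
  have hu := (Matrix.isUnit_iff_isUnit_det _).mp hI
  rw [hd] at hu
  have e₁ := Scheme.basicOpen_of_isUnit T' hu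
  have e₂ := Scheme.basicOpen_appLE h O' U hle (A.submatrix I id).det
  exact ((e₁.symm.trans e₂).le hx').2

end FramesOfGrassmannians

/-! ### The open set of transverse planes and the morphism `π`. -/

section Projection

variable {k m n l : Type} [Fintype k] [DecidableEq k] [Fintype m] [DecidableEq m] [Fintype n]
  [DecidableEq n] [Fintype l] [DecidableEq l] {T T' X Y : Scheme.{u}}

section

variable {f : T ⟶ X} {S : VectorBundle T n} {V : VectorBundle X m} (d : BundleMap f S V)

/-- The open set on which a bundle map is injective on the fibres. -/
def BundleMap.injLocus : T.Opens :=
  sSup {O' | ∀ w a, LocSplit ((d.mat w a).map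
    (res (inf_le_left : (f ⁻¹ᵁ V.U w ⊓ S.U a) ⊓ O' ≤ f ⁻¹ᵁ V.U w ⊓ S.U a)))}

variable {d}

/-- One pair of trivializations suffices, since the others differ by invertible transition matrices.
-/
lemma BundleMap.mem_injLocus {w : V.ι} {a : S.ι} {O : T.Opens} {h : O ≤ f ⁻¹ᵁ V.U w ⊓ S.U a}
    (H : LocSplit ((d.mat w a).map (res h))) {x : T} (hx : x ∈ O) : x ∈ d.injLocus := by
  refine Opens.mem_sSup.mpr ⟨O, fun w' a' => ?_, hx⟩
  have h₁ : (f ⁻¹ᵁ V.U w' ⊓ S.U a') ⊓ O ≤ f ⁻¹ᵁ (V.U w' ⊓ V.U w) := sub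
  have h₂ : (f ⁻¹ᵁ V.U w' ⊓ S.U a') ⊓ O ≤ S.U a ⊓ S.U a' := sub
  have h₃ : (f ⁻¹ᵁ V.U w' ⊓ S.U a') ⊓ O ≤ f ⁻¹ᵁ V.U w ⊓ S.U a' := sub
  have h₄ : (f ⁻¹ᵁ V.U w' ⊓ S.U a') ⊓ O ≤ O := inf_le_right
  rw [d.res_mat_target w' w a' inf_le_left h₁ h₃, d.res_mat_source w a a' h₃ (h₄.trans h) h₂]
  have := H.res h₄
  rw [map_res_res] at this
  exact (LocSplit.of_isUnit (V.isUnit_pull_g f w' w h₁)).mul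
    (this.mul (LocSplit.of_isUnit (S.isUnit_res_g a a' h₂)))

lemma BundleMap.locSplit_of_le_injLocus {w : V.ι} {a : S.ι} {O : T.Opens}
    (h : O ≤ f ⁻¹ᵁ V.U w ⊓ S.U a) (h' : O ≤ d.injLocus) : LocSplit ((d.mat w a).map (res h)) := by
  refine LocSplit.of_local fun x hx => ?_
  obtain ⟨O', hO', hx'⟩ := Opens.mem_sSup.mp (h' hx)
  refine ⟨O ⊓ O', inf_le_left, ⟨hx, hx'⟩, ?_⟩
  have := (hO' w a).res (inf_le_inf_right O' h)
  rw [map_res_res] at this ⊢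
  exact this

lemma BundleMap.isSubbundle_baseChange (h : T' ⟶ T) (hh : ⊤ ≤ h ⁻¹ᵁ d.injLocus) :
    (d.baseChange h).IsSubbundle := by
  rw [isSubbundle_iff]
  intro w a
  have H := d.locSplit_of_le_injLocus (w := w) (a := a)
    (inf_le_left : (f ⁻¹ᵁ V.U w ⊓ S.U a) ⊓ d.injLocus ≤ f ⁻¹ᵁ V.U w ⊓ S.U a) inf_le_right
  have hO : h ⁻¹ᵁ (f ⁻¹ᵁ V.U w ⊓ S.U a) ≤ h ⁻¹ᵁ ((f ⁻¹ᵁ V.U w ⊓ S.U a) ⊓ d.injLocus) :=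
    le_inf le_rfl (le_top.trans hh)
  have := H.pull h hO
  rwa [map_pull_res] at this

/-- The frame is the pulled-back matrix of `d` up to an invertible factor, and left invertibility of
a pull-back descends to a neighbourhood of the image point. -/
lemma BundleMap.IsFrame.mem_injLocus {h : T' ⟶ T} {w : V.ι} {O : T'.Opens}
    {A : Matrix m n Γ(T', O)} (hA : d.IsFrame h w A) (H : LocSplit A) {x : T'} (hx : x ∈ O) :
    h x ∈ d.injLocus := by
  obtain ⟨b, O', h₁, h₂, hx', C, hC, e⟩ := hA x hx
  have e' : (d.mat w b).map (GrassBundle.pull h h₂) = A.map (GrassBundle.res h₁) * C⁻¹ := by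
    rw [e, Matrix.mul_nonsing_inv_cancel_right _ _ ((Matrix.isUnit_iff_isUnit_det _).mp hC)]
  have H' : LocSplit ((d.mat w b).map (GrassBundle.pull h h₂)) := by
    rw [e']
    exact (H.res h₁).mul (LocSplit.of_isUnit (Matrix.isUnit_nonsing_inv_iff.mpr hC))
  obtain ⟨U, hU, hxU, H''⟩ := H'.exists_of_pull hx'
  exact BundleMap.mem_injLocus H'' hxU

end

lemma exists_isComp_of_eq {h : T' ⟶ T} {f : T ⟶ X} {f' : T' ⟶ X} (e : h ≫ f = f')
    {S' : VectorBundle T' n} {S : VectorBundle T m} {V : VectorBundle X l}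
    (φ : BundleMap h S' S) (ψ : BundleMap f S V) :
    ∃ χ : BundleMap f' S' V, IsComp φ ψ χ := by
  subst e
  exact exists_isComp φ ψ

/-- The splitting identifies the kernel of `P` with the range of `F`: if `P` kills `v`, then `v = F
θ v`. So injectivity of `P` on the range of `B` means that this range meets that of `F` only in `0`.
-/
lemma injective_mul_iff {R : Type*} [CommRing R] {B : Matrix n m R} {F : Matrix n k R}
    {P : Matrix l n R} {θ : Matrix k n R} {σ : Matrix n l R} (h : F * θ + σ * P = 1)
    (hPF : P * F = 0) (hB : Function.Injective B.mulVec) :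
    Function.Injective (P * B).mulVec ↔
      LinearMap.range B.mulVecLin ⊓ LinearMap.range F.mulVecLin = ⊥ := by
  constructor
  · intro H
    rw [eq_bot_iff]
    rintro _ ⟨⟨u, rfl⟩, ⟨y, hy⟩⟩
    rw [Matrix.mulVecLin_apply, Matrix.mulVecLin_apply] at hy
    have : (P * B).mulVec u = (P * B).mulVec 0 := by
      rw [← Matrix.mulVec_mulVec, ← hy, Matrix.mulVec_mulVec, hPF, Matrix.zero_mulVec,
        Matrix.mulVec_zero]
    rw [H this, map_zero]
    exact Submodule.zero_mem _
  · intro H u v huv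
    have e : P.mulVec (B.mulVec (u - v)) = 0 := by
      rw [Matrix.mulVec_mulVec, Matrix.mulVec_sub, huv, sub_self]
    have e' : B.mulVec (u - v) = F.mulVec (θ.mulVec (B.mulVec (u - v))) := by
      have := congrArg (fun M => M.mulVec (B.mulVec (u - v))) h
      simp only [Matrix.add_mulVec, Matrix.one_mulVec, ← Matrix.mulVec_mulVec, e,
        Matrix.mulVec_zero, add_zero] at this
      exact this.symm
    have hmem : B.mulVec (u - v) ∈ LinearMap.range B.mulVecLin ⊓ LinearMap.range F.mulVecLin :=
      ⟨⟨u - v, rfl⟩, ⟨θ.mulVec (B.mulVec (u - v)), e'.symm⟩⟩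
    rw [H, Submodule.mem_bot] at hmem
    exact sub_eq_zero.mp (hB (hmem.trans (Matrix.mulVec_zero B).symm))

lemma map_eval_res {O O' : X.Opens} (h : O' ≤ O) {x : X} (hx : x ∈ O') (A : Matrix m n Γ(X, O)) :
    (A.map (res h)).map (eval x hx) = A.map (eval x (h hx)) := by
  ext i j
  exact eval_res h x hx _

variable {K : VectorBundle X k} {V : VectorBundle X m} {W : VectorBundle X l} {φ : BundleHom K V}
  {ρ : BundleHom V W} {s : ℕ}

/-- The `s`-planes which meet the image of `K` trivially are those on which `ρ` is injective. -/
lemma coe_injLocus_eq_transverse (hex : ShortExact φ ρ) (GV : Grassmannian V s)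
    {d : BundleMap GV.ν GV.S W} (hd : IsComp GV.incl ρ d) :
    (d.injLocus : Set GV.G) = GV.transverse φ := by
  have key (p : GV.G) (i : V.ι) (a : GV.S.ι) (c : K.ι) (w : W.ι) (hi : p ∈ GV.ν ⁻¹ᵁ V.U i)
      (ha : p ∈ GV.S.U a) (hc : p ∈ GV.ν ⁻¹ᵁ K.U c) (hw : p ∈ GV.ν ⁻¹ᵁ W.U w) :
      Function.Injective ((d.mat w a).map
        (eval p (⟨hw, ha⟩ : p ∈ GV.ν ⁻¹ᵁ W.U w ⊓ GV.S.U a))).mulVec ↔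
      LinearMap.range (GV.incl.fiber i a p ⟨hi, ha⟩) ⊓
        LinearMap.range ((φ.baseChange GV.ν).fiber i c p ⟨hi, hc⟩) = ⊥ := by
    obtain ⟨L, rfl, rfl, rfl, hL⟩ := hex.exists_localSplitting hc hi hw
    let O : GV.G.Opens := GV.ν ⁻¹ᵁ L.O ⊓ GV.S.U a
    have hp : p ∈ O := ⟨hL, ha⟩
    have hO : O ≤ GV.ν ⁻¹ᵁ L.O := inf_le_left
    have hOa : O ≤ GV.S.U a := inf_le_right
    have leV := L.leV
    have leK := L.leK
    have leW := L.leW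
    have l₁ : O ≤ GV.ν ⁻¹ᵁ (𝟙 X ⁻¹ᵁ W.U L.w ⊓ V.U L.i) := sub
    have l₂ : O ≤ GV.ν ⁻¹ᵁ V.U L.i ⊓ GV.S.U a := sub
    have l₃ : O ≤ GV.ν ⁻¹ᵁ W.U L.w ⊓ GV.S.U a := sub
    have l₄ : O ≤ GV.ν ⁻¹ᵁ (𝟙 X ⁻¹ᵁ V.U L.i ⊓ K.U L.κ) := sub
    have l₅ : L.O ≤ 𝟙 X ⁻¹ᵁ W.U L.w ⊓ V.U L.i := sub
    have l₆ : L.O ≤ 𝟙 X ⁻¹ᵁ V.U L.i ⊓ K.U L.κ := sub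
    have eP : (ρ.mat L.w L.i).map (pull GV.ν l₁) = L.P.map (pull GV.ν hO) := by
      rw [← L.eqP l₅, map_pull_res]
    have eF : (φ.mat L.i L.κ).map (pull GV.ν l₄) = L.F.map (pull GV.ν hO) := by
      rw [← L.eqF l₆, map_pull_res]
    have e₁ := hd.2 L.w L.i a O l₁ l₂ l₃
    rw [eP] at e₁
    have e₂ := congrArg (fun M => M.map (eval p hp)) e₁
    simp only [Matrix.map_mul, map_eval_res] at e₂
    rw [e₂]
    -- The identities of the local splitting survive pull-back and evaluation, so they hold on the
    -- fibre at `p`.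
    have h₁ := congrArg (fun M => (M.map (pull GV.ν hO)).map (eval p hp)) L.split
    have h₂ := congrArg (fun M => (M.map (pull GV.ν hO)).map (eval p hp)) L.P_mul_F
    simp only [map_pull_add, Matrix.map_mul,
      Matrix.map_one _ (map_zero _) (map_one _), Matrix.map_add _ (map_add (eval p hp))] at h₁ h₂
    rw [Matrix.map_zero _ (map_zero _), Matrix.map_zero _ (map_zero _)] at h₂
    have hB : Function.Injective ((GV.incl.mat L.i a).map (eval p (l₂ hp))).mulVec :=
      GV.incl_isSubbundle L.i a p ⟨hi, ha⟩
    have := injective_mul_iff (σ := (L.σ.map (pull GV.ν hO)).map (eval p hp)) h₁ h₂ hB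
    refine this.trans ?_
    have e₃ : ((φ.baseChange GV.ν).fiber L.i L.κ p ⟨hi, hc⟩) =
        ((L.F.map (pull GV.ν hO)).map (eval p hp)).mulVecLin := by
      have l₇ : O ≤ (GV.ν ≫ 𝟙 X) ⁻¹ᵁ V.U L.i ⊓ (K.pullback GV.ν).U L.κ := l₄
      rw [← eF, ← φ.res_baseChange_mat GV.ν L.i L.κ l₇ l₄]
      exact congrArg Matrix.mulVecLin
        (map_eval_res l₇ hp ((φ.baseChange GV.ν).mat L.i L.κ)).symm
    rw [e₃]
    rfl
  ext p
  constructor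
  · intro hp i a c hi ha hc
    obtain ⟨w, hw⟩ := W.exists_mem (GV.ν p)
    refine (key p i a c w hi ha hc hw).mp ?_
    have H := d.locSplit_of_le_injLocus (w := w) (a := a)
      (inf_le_left : (GV.ν ⁻¹ᵁ W.U w ⊓ GV.S.U a) ⊓ d.injLocus ≤ GV.ν ⁻¹ᵁ W.U w ⊓ GV.S.U a)
      inf_le_right
    have hp' : p ∈ (GV.ν ⁻¹ᵁ W.U w ⊓ GV.S.U a) ⊓ d.injLocus := ⟨⟨hw, ha⟩, hp⟩
    have := H.injective hp'
    rwa [map_eval_res] at this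
  · intro hp
    obtain ⟨i, hi⟩ := V.exists_mem (GV.ν p)
    obtain ⟨c, hc⟩ := K.exists_mem (GV.ν p)
    obtain ⟨w, hw⟩ := W.exists_mem (GV.ν p)
    obtain ⟨a, ha⟩ := GV.S.exists_mem p
    -- Openness enters here: injectivity at the single point `p` yields a minor invertible around
    -- it.
    obtain ⟨I, O, hO, hpO, hI⟩ := exists_isUnit_minor _
      ((key p i a c w hi ha hc hw).mpr (hp i a c hi ha hc))
    exact BundleMap.mem_injLocus (h := hO)
      (LocSplit.of_minor I (by rw [Matrix.submatrix_map]; exact hI)) hpO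

/-- Existence and uniqueness of the projection. -/
lemma exists_isProjection (GV : Grassmannian V s) (GW : Grassmannian W s)
    {d : BundleMap GV.ν GV.S W} (hd : IsComp GV.incl ρ d) :
    ∃ π : d.injLocus.toScheme ⟶ GW.G, IsProjection ρ GV GW d.injLocus π ∧
      (∀ π', IsProjection ρ GV GW d.injLocus π' → π' = π) ∧
      π ≫ GW.ν = d.injLocus.ι ≫ GV.ν ∧
      ∃ k : BundleMap π (GV.S.pullback d.injLocus.ι) GW.S,
        IsComp k GW.incl (d.baseChange d.injLocus.ι) := by
  have hsub := BundleMap.isSubbundle_baseChange (d := d) d.injLocus.ι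
    (top_le_ι_preimage d.injLocus)
  -- On this open set the image under `ρ` of the tautological bundle is a subbundle of `W`, and `π`
  -- classifies it.
  obtain ⟨π, ⟨hπ, k, hk⟩, huniq⟩ := GW.existsUnique _ _ (d.baseChange d.injLocus.ι) hsub
  refine ⟨π, ⟨hπ, d.baseChange d.injLocus.ι, k, hd.baseChange _, hk⟩, ?_, hπ, k, hk⟩
  rintro π' ⟨hπ', d', k', hd', hk'⟩
  -- The composite with `ρ` required of another projection is unique, so that projection classifies
  -- the same subbundle.
  obtain rfl := hd'.unique (hd.baseChange _)
  exact huniq π' ⟨hπ', k', hk'⟩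

end Projection

/-! ### Coordinates on the fibres of `π`: lifting frames from `W` to `V`. -/

section AffineStructure

variable {k m l : Type} [Fintype k] [DecidableEq k] [Fintype m] [DecidableEq m]
  [Fintype l] [DecidableEq l] {T X : Scheme.{u}} {K : VectorBundle X k} {V : VectorBundle X m}
  {W : VectorBundle X l} {φ : BundleHom K V} {ρ : BundleHom V W} {s : ℕ}

namespace LocalSplitting

lemma pull_P (L : LocalSplitting φ ρ) (f : T ⟶ X) {O : T.Opens} (h : O ≤ f ⁻¹ᵁ L.O)
    (h' : O ≤ f ⁻¹ᵁ (𝟙 X ⁻¹ᵁ W.U L.w ⊓ V.U L.i)) :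
    (ρ.mat L.w L.i).map (pull f h') = L.P.map (pull f h) := by
  have leV := L.leV
  have leW := L.leW
  have l₁ : L.O ≤ 𝟙 X ⁻¹ᵁ W.U L.w ⊓ V.U L.i := sub
  rw [← L.eqP l₁, map_pull_res]

lemma pull_F (L : LocalSplitting φ ρ) (f : T ⟶ X) {O : T.Opens} (h : O ≤ f ⁻¹ᵁ L.O)
    (h' : O ≤ f ⁻¹ᵁ (𝟙 X ⁻¹ᵁ V.U L.i ⊓ K.U L.κ)) :
    (φ.mat L.i L.κ).map (pull f h') = L.F.map (pull f h) := by
  have leV := L.leV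
  have leK := L.leK
  have l₁ : L.O ≤ 𝟙 X ⁻¹ᵁ V.U L.i ⊓ K.U L.κ := sub
  rw [← L.eqF l₁, map_pull_res]

/-- The matrices `P` are those of `ρ`, so they intertwine the transition functions of `V` and `W`.
No such relation holds for `σ` and `θ`, which is why the bundle is affine and not linear. -/
lemma P_mul_g (L L' : LocalSplitting φ ρ) (f : T ⟶ X) {O : T.Opens} (h : O ≤ f ⁻¹ᵁ L.O)
    (h' : O ≤ f ⁻¹ᵁ L'.O) (h₁ : O ≤ f ⁻¹ᵁ (V.U L.i ⊓ V.U L'.i)) (h₂ : O ≤ f ⁻¹ᵁ (W.U L.w ⊓ W.U L'.w)) :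
    L.P.map (pull f h) * (V.g L.i L'.i).map (pull f h₁) =
      (W.g L.w L'.w).map (pull f h₂) * L'.P.map (pull f h') := by
  have h₃ : O ≤ f ⁻¹ᵁ (𝟙 X ⁻¹ᵁ W.U L.w ⊓ V.U L.i) := sub
  have h₄ : O ≤ f ⁻¹ᵁ (𝟙 X ⁻¹ᵁ W.U L.w ⊓ V.U L'.i) := sub
  have h₅ : O ≤ f ⁻¹ᵁ (𝟙 X ⁻¹ᵁ W.U L'.w ⊓ V.U L'.i) := sub
  have h₆ : O ≤ (f ≫ 𝟙 X) ⁻¹ᵁ (W.U L.w ⊓ W.U L'.w) := sub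
  rw [← L.pull_P f h h₃, ← L'.pull_P f h' h₅, ← ρ.pull_mat_source f L.w L.i L'.i h₄ h₃ h₁,
    ρ.pull_mat_target f L.w L'.w L'.i h₄ h₆ h₅, map_pull_congr (Category.comp_id f) h₆ h₂]

lemma g_mul_F (L L' : LocalSplitting φ ρ) (f : T ⟶ X) {O : T.Opens} (h : O ≤ f ⁻¹ᵁ L.O)
    (h' : O ≤ f ⁻¹ᵁ L'.O) (h₁ : O ≤ f ⁻¹ᵁ (V.U L.i ⊓ V.U L'.i)) (h₂ : O ≤ f ⁻¹ᵁ (K.U L.κ ⊓ K.U L'.κ)) :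
    (V.g L.i L'.i).map (pull f h₁) * L'.F.map (pull f h') =
      L.F.map (pull f h) * (K.g L.κ L'.κ).map (pull f h₂) := by
  have h₃ : O ≤ f ⁻¹ᵁ (𝟙 X ⁻¹ᵁ V.U L.i ⊓ K.U L.κ) := sub
  have h₄ : O ≤ f ⁻¹ᵁ (𝟙 X ⁻¹ᵁ V.U L.i ⊓ K.U L'.κ) := sub
  have h₅ : O ≤ f ⁻¹ᵁ (𝟙 X ⁻¹ᵁ V.U L'.i ⊓ K.U L'.κ) := sub
  have h₆ : O ≤ (f ≫ 𝟙 X) ⁻¹ᵁ (V.U L.i ⊓ V.U L'.i) := sub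
  rw [← L.pull_F f h h₃, ← L'.pull_F f h' h₅, ← φ.pull_mat_source f L.i L.κ L'.κ h₄ h₃ h₂,
    φ.pull_mat_target f L.i L'.i L'.κ h₄ h₆ h₅, map_pull_congr (Category.comp_id f) h₆ h₁]

end LocalSplitting

/-- Grassmannians of `V` and `W` with the morphism `π`, on the open set on which `ρ` is injective
on the tautological bundle, defined by the images under `ρ`. -/
structure Projection (ρ : BundleHom V W) (s : ℕ) where
  GV : Grassmannian V s
  GW : Grassmannian W s
  d : BundleMap GV.ν GV.S W
  isComp_d : IsComp GV.incl ρ d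
  π : d.injLocus.toScheme ⟶ GW.G
  π_ν : π ≫ GW.ν = d.injLocus.ι ≫ GV.ν
  exists_isComp_π : ∃ k : BundleMap π (GV.S.pullback d.injLocus.ι) GW.S,
    IsComp k GW.incl (d.baseChange d.injLocus.ι)

namespace Projection

variable (D : Projection ρ s)

/-- The source of the projection. -/
abbrev E : Scheme.{u} := D.d.injLocus.toScheme

/-- The inclusion of the source of the projection into the Grassmannian of `V`. -/
abbrev q : D.E ⟶ D.GV.G := D.d.injLocus.ι

/-- The image under `ρ` of a frame of the tautological bundle. -/
lemma push (h : T ⟶ D.E) (L : LocalSplitting φ ρ) {O : T.Opens} {A : Matrix m (Fin s) Γ(T, O)}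
    (hA : D.GV.incl.IsFrame (h ≫ D.q) L.i A) {f : T ⟶ X} (e : (h ≫ D.q) ≫ D.GV.ν = f)
    (hO : O ≤ f ⁻¹ᵁ L.O) : D.GW.incl.IsFrame (h ≫ D.π) L.w (L.P.map (pull f hO) * A) := by
  have leV := L.leV
  have leW := L.leW
  have hO' : O ≤ f ⁻¹ᵁ (𝟙 X ⁻¹ᵁ W.U L.w ⊓ V.U L.i) := sub
  have h₁ := hA.push D.isComp_d L.w e hO'
  rw [L.pull_P f hO hO', ← BundleMap.isFrame_baseChange_iff] at h₁
  have hsub := BundleMap.isSubbundle_baseChange (d := D.d) D.q (top_le_ι_preimage D.d.injLocus)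
  obtain ⟨k, hk⟩ := D.exists_isComp_π
  refine h₁.baseChange.transfer_symm ?_ D.GW.incl_isSubbundle (hsub.baseChange h)
    ⟨k.baseChange h, hk.baseChange h⟩
  rw [Category.assoc, D.π_ν]

/-- The open subset of the Grassmannian of `W` over which the projection is trivialized. -/
def base (L : LocalSplitting φ ρ) (a : D.GW.S.ι) : D.GW.G.Opens := D.GW.ν ⁻¹ᵁ L.O ⊓ D.GW.S.U a

variable (L L' : LocalSplitting φ ρ) (a a' : D.GW.S.ι)

lemma base_le : D.base L a ≤ D.GW.ν ⁻¹ᵁ L.O := inf_le_left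

lemma base_le' : D.base L a ≤ D.GW.ν ⁻¹ᵁ W.U L.w ⊓ D.GW.S.U a :=
  le_inf (inf_le_left.trans fun _ hx => L.leW hx) inf_le_right

/-- The frame of the tautological bundle on the Grassmannian of `W`. -/
def frame : Matrix l (Fin s) Γ(D.GW.G, D.base L a) :=
  (D.GW.incl.mat L.w a).map (res (D.base_le' L a))

lemma isFrame_frame (f : T ⟶ D.GW.G) {O : T.Opens} (h : O ≤ f ⁻¹ᵁ D.base L a) :
    D.GW.incl.IsFrame f L.w ((D.frame L a).map (pull f h)) := by
  have h' : O ≤ f ⁻¹ᵁ (D.GW.ν ⁻¹ᵁ W.U L.w ⊓ D.GW.S.U a) := fun x hx => D.base_le' L a (h hx)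
  rw [frame, map_pull_res]
  exact D.GW.incl.isFrame_mat f L.w a h'

lemma locSplit_frame (f : T ⟶ D.GW.G) {O : T.Opens} (h : O ≤ f ⁻¹ᵁ D.base L a) :
    LocSplit ((D.frame L a).map (pull f h)) :=
  (D.isFrame_frame L a f h).locSplit D.GW.incl_isSubbundle

lemma preimage_le : D.π ⁻¹ᵁ D.base L a ≤ (D.q ≫ D.GV.ν) ⁻¹ᵁ L.O := by
  rw [preimage_eq_of_comp_eq D.π_ν]
  exact fun x hx => D.base_le L a hx

/-- Locally take any frame of the tautological bundle of `V`; its image under `P` is a frame of the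
image plane, and a change of basis makes that image the prescribed frame. The lift is unique because
`P` is injective on the plane, so the local lifts glue. -/
lemma exists_lift : ∃ τ : Matrix m (Fin s) Γ(D.E, D.π ⁻¹ᵁ D.base L a),
    D.GV.incl.IsFrame D.q L.i τ ∧
      L.P.map (pull (D.q ≫ D.GV.ν) (D.preimage_le L a)) * τ =
        (D.frame L a).map (pull D.π (le_refl (D.π ⁻¹ᵁ D.base L a))) := by
  have hsub := D.GV.incl_isSubbundle
  obtain ⟨τ, hτ⟩ := exists_mat_of_local (O := D.π ⁻¹ᵁ D.base L a)
    (fun O' (τ : Matrix m (Fin s) Γ(D.E, O')) => D.GV.incl.IsFrame D.q L.i τ ∧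
      ∃ h : O' ≤ D.π ⁻¹ᵁ D.base L a, L.P.map (pull (D.q ≫ D.GV.ν) (h.trans (D.preimage_le L a))) *
        τ = (D.frame L a).map (pull D.π h))
    (by
      rintro O' O'' h₀ τ ⟨hτ, h, e⟩
      refine ⟨hτ.res h₀, h₀.trans h, ?_⟩
      have := congrArg (fun M => M.map (res h₀)) e
      simpa only [map_res_mul, map_res_pull] using this)
    (by
      rintro O' τ τ' ⟨hτ, h, e⟩ ⟨hτ', h', e'⟩
      refine hτ.eq_of_mul_eq hsub hτ' (P := L.P.map (pull (D.q ≫ D.GV.ν)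
        (h.trans (D.preimage_le L a)))) ?_ (e.trans e'.symm)
      rw [e']
      exact D.locSplit_frame L a D.π h')
    (by
      intro x hx
      have hxL : (D.q ≫ D.GV.ν) x ∈ L.O := D.preimage_le L a hx
      obtain ⟨b, hb⟩ := D.GV.S.exists_mem (D.q x)
      let O : D.E.Opens := D.π ⁻¹ᵁ D.base L a ⊓ D.q ⁻¹ᵁ D.GV.S.U b
      have hO : O ≤ D.π ⁻¹ᵁ D.base L a := inf_le_left
      have hOL := hO.trans (D.preimage_le L a)
      have hOb : O ≤ D.q ⁻¹ᵁ (D.GV.ν ⁻¹ᵁ V.U L.i ⊓ D.GV.S.U b) :=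
        fun y hy => ⟨L.leV (hOL hy), hy.2⟩
      have hB := D.GV.incl.isFrame_mat D.q L.i b hOb
      have hPB := D.push (𝟙 D.E) L (f := D.q ≫ D.GV.ν) (by rwa [Category.id_comp])
        (by rw [Category.id_comp]) hOL
      rw [Category.id_comp] at hPB
      obtain ⟨C, hC, e⟩ := (D.isFrame_frame L a D.π hO).exists_eq_mul D.GW.incl_isSubbundle hPB
      exact ⟨O, hO, ⟨hx, hb⟩, _, hB.mul hC, hO, by rw [e, Matrix.mul_assoc]⟩)
  refine ⟨τ, BundleMap.IsFrame.of_local fun x hx => ?_, mat_ext fun x hx => ?_⟩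
  · obtain ⟨O', h, hx', H, -⟩ := hτ x hx
    exact ⟨O', h, hx', H⟩
  · obtain ⟨O', h, hx', -, h', e⟩ := hτ x hx
    refine ⟨O', h, hx', ?_⟩
    rw [map_res_mul, map_res_pull, map_res_pull, e]

/-- The frame of the tautological bundle on the Grassmannian of `V` which is mapped to the given
frame on the Grassmannian of `W`. -/
def lift : Matrix m (Fin s) Γ(D.E, D.π ⁻¹ᵁ D.base L a) := (D.exists_lift L a).choose

lemma isFrame_lift : D.GV.incl.IsFrame D.q L.i (D.lift L a) := (D.exists_lift L a).choose_spec.1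

lemma P_mul_lift : L.P.map (pull (D.q ≫ D.GV.ν) (D.preimage_le L a)) * D.lift L a =
    (D.frame L a).map (pull D.π (le_refl (D.π ⁻¹ᵁ D.base L a))) :=
  (D.exists_lift L a).choose_spec.2

/-- The matrix of coordinate functions. -/
def coord : Matrix k (Fin s) Γ(D.E, D.π ⁻¹ᵁ D.base L a) :=
  L.θ.map (pull (D.q ≫ D.GV.ν) (D.preimage_le L a)) * D.lift L a

variable {L a}

section

variable {h : T ⟶ D.E} {O : T.Opens} (hO : O ≤ h ⁻¹ᵁ (D.π ⁻¹ᵁ D.base L a))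
  (hL : O ≤ (h ≫ D.q ≫ D.GV.ν) ⁻¹ᵁ L.O) (hb : O ≤ (h ≫ D.π) ⁻¹ᵁ D.base L a)

lemma pull_coord : (D.coord L a).map (pull h hO) =
    L.θ.map (pull (h ≫ D.q ≫ D.GV.ν) hL) * (D.lift L a).map (pull h hO) := by
  rw [coord, map_pull_mul, map_pull_pull]

lemma P_mul_pull_lift : L.P.map (pull (h ≫ D.q ≫ D.GV.ν) hL) * (D.lift L a).map (pull h hO) =
    (D.frame L a).map (pull (h ≫ D.π) hb) := by
  have := congrArg (fun M => M.map (pull h hO)) (D.P_mul_lift L a)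
  simpa only [map_pull_mul, map_pull_pull] using this

/-- The frame in terms of the coordinate functions. -/
lemma pull_lift : (D.lift L a).map (pull h hO) =
    L.F.map (pull (h ≫ D.q ≫ D.GV.ν) hL) * (D.coord L a).map (pull h hO) +
      L.σ.map (pull (h ≫ D.q ≫ D.GV.ν) hL) * (D.frame L a).map (pull (h ≫ D.π) hb) := by
  rw [← D.P_mul_pull_lift hO hL hb, D.pull_coord hO hL, ← Matrix.mul_assoc, ← Matrix.mul_assoc,
    ← Matrix.add_mul, ← map_pull_mul, ← map_pull_mul, ← map_pull_add, L.split, map_pull_one,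
    Matrix.one_mul]

/-- Characterization of the frame. -/
lemma pull_lift_eq {B : Matrix m (Fin s) Γ(T, O)} (hB : D.GV.incl.IsFrame (h ≫ D.q) L.i B)
    (e : L.P.map (pull (h ≫ D.q ≫ D.GV.ν) hL) * B = (D.frame L a).map (pull (h ≫ D.π) hb)) :
    (D.lift L a).map (pull h hO) = B := by
  refine ((D.isFrame_lift L a).pull h hO).eq_of_mul_eq D.GV.incl_isSubbundle hB
    (P := L.P.map (pull (h ≫ D.q ≫ D.GV.ν) hL)) ?_ ?_
  · rw [e]
    exact D.locSplit_frame L a _ hb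
  · rw [e]
    exact D.P_mul_pull_lift hO hL hb

end

end Projection

end AffineStructure

/-! ### Charts of affine bundles and refinement of covers. -/

section Charts

variable {n m : Type} [Fintype n] [DecidableEq n] [Fintype m] [DecidableEq m]
  {E X Y T : Scheme.{u}}

lemma topIso_inv_eq_pull (U : Y.Opens) (a : Γ(Y, U)) :
    U.topIso.inv.hom a = pull U.ι (top_le_ι_preimage U) a := by
  have : U.topIso.inv = U.ι.appLE U ⊤ (top_le_ι_preimage U) := by
    rw [Scheme.Opens.topIso_inv, Scheme.Opens.ι_appLE]
    rfl
  rw [this]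
  rfl

lemma chart_affineProj (p : E ⟶ Y) (U : Y.Opens) (x : n → Γ(E, p ⁻¹ᵁ U)) :
    chart p U x ≫ affineProj U n = (p ⁻¹ᵁ U).ι ≫ p := by
  rw [chart, affineProj, ← Category.assoc, AffineSpace.homOfVector_over, morphismRestrict_ι]

lemma pull_chart_affineCoord (p : E ⟶ Y) (U : Y.Opens) (x : n → Γ(E, p ⁻¹ᵁ U)) (k : n) :
    pull (chart p U x) (top_le_preimage (chart p U x)) (affineCoord U k) =
      pull (p ⁻¹ᵁ U).ι (top_le_ι_preimage (p ⁻¹ᵁ U)) (x k) := by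
  rw [← appTop_eq_pull, ← topIso_inv_eq_pull]
  exact AffineSpace.homOfVector_appTop_coord _ _ _

/-- A chart is an isomorphism if its points are uniquely described by their coordinates. -/
lemma isIso_chart_of_existsUnique (p : E ⟶ Y) (U : Y.Opens) (x : n → Γ(E, p ⁻¹ᵁ U))
    (hex : ∀ {T : Scheme.{u}} (f : T ⟶ Y) (_ : ⊤ ≤ f ⁻¹ᵁ U) (y : n → Γ(T, ⊤)),
      ∃ g : T ⟶ E, g ≫ p = f ∧ ∀ (h : ⊤ ≤ g ⁻¹ᵁ (p ⁻¹ᵁ U)) k, pull g h (x k) = y k)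
    (huniq : ∀ {T : Scheme.{u}} (a b : T ⟶ E) (ha : ⊤ ≤ a ⁻¹ᵁ (p ⁻¹ᵁ U))
      (hb : ⊤ ≤ b ⁻¹ᵁ (p ⁻¹ᵁ U)), a ≫ p = b ≫ p → (∀ k, pull a ha (x k) = pull b hb (x k)) →
        a = b) : IsIso (chart p U x) := by
  -- The inverse is obtained from the universal point, the affine space with its own coordinates.
  obtain ⟨g, hg, hgx⟩ := hex (affineProj U n) (top_le_affineProj_preimage U) (affineCoord U)
  have hgU : ⊤ ≤ g ⁻¹ᵁ (p ⁻¹ᵁ U) := by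
    have := top_le_affineProj_preimage (n := n) U
    rwa [preimage_eq_of_comp_eq hg] at this
  obtain ⟨g', rfl⟩ := exists_lift_opens (p ⁻¹ᵁ U) g hgU
  have hc := top_le_ι_preimage (p ⁻¹ᵁ U)
  refine ⟨g', ?_, ?_⟩
  · rw [← cancel_mono (p ⁻¹ᵁ U).ι, Category.id_comp, Category.assoc]
    have h₁ : ⊤ ≤ (chart p U x ≫ g' ≫ (p ⁻¹ᵁ U).ι) ⁻¹ᵁ (p ⁻¹ᵁ U) := fun y _ => hgU trivial
    refine huniq _ _ h₁ hc ?_ fun k => ?_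
    · rw [Category.assoc, hg, chart_affineProj]
    · rw [← pull_pull (chart p U x) (g' ≫ (p ⁻¹ᵁ U).ι) hgU (top_le_preimage _), hgx hgU k,
        pull_chart_affineCoord]
  · refine affine_hom_ext ?_ fun k => ?_
    · rw [Category.assoc, chart_affineProj, ← Category.assoc, hg, Category.id_comp]
    · have e₁ := pull_pull g' (chart p U x) (top_le_preimage (chart p U x)) (top_le_preimage g')
        (affineCoord U k)
      rw [pull_chart_affineCoord, pull_pull] at e₁
      refine e₁.symm.trans ((hgx hgU k).trans ?_)
      exact ((pull_id (le_refl _) _).trans (res_self _ _)).symm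

/-- A vector bundle is isomorphic to the bundle obtained by a refinement of the cover. -/
lemma nonempty_bundleIso_refine (V : VectorBundle X n) (e : m ≃ n) (ι : Type u) (U : ι → X.Opens)
    (hU : ⨆ c, U c = ⊤) (r : ι → V.ι) (hr : ∀ c, U c ≤ V.U (r c)) :
    Nonempty (BundleIso (V.refine e ι U hU r hr) V) := by
  have l₁ (i : V.ι) (c : ι) : 𝟙 X ⁻¹ᵁ V.U i ⊓ U c ≤ V.U i ⊓ V.U (r c) := inf_le_inf_left _ (hr c)
  have l₂ (c : ι) (i : V.ι) : 𝟙 X ⁻¹ᵁ U c ⊓ V.U i ≤ V.U (r c) ⊓ V.U i := inf_le_inf_right _ (hr c)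
  -- The transition functions of `V` itself, with renumbered coordinates, give both directions of
  -- the isomorphism.
  let F (i : V.ι) (c : ι) : Matrix n m Γ(X, 𝟙 X ⁻¹ᵁ V.U i ⊓ U c) :=
    ((V.g i (r c)).map (res (l₁ i c))).submatrix id e
  let G (c : ι) (i : V.ι) : Matrix m n Γ(X, 𝟙 X ⁻¹ᵁ U c ⊓ V.U i) :=
    ((V.g (r c) i).map (res (l₂ c i))).submatrix e id
  have hF (i : V.ι) (c : ι) (O : X.Opens) (h : O ≤ 𝟙 X ⁻¹ᵁ V.U i ⊓ U c) (h' : O ≤ V.U i ⊓ V.U (r c)) :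
      (F i c).map (res h) = ((V.g i (r c)).map (res h')).submatrix id e := by
    rw [← Matrix.submatrix_map, map_res_res]
  have hG (c : ι) (i : V.ι) (O : X.Opens) (h : O ≤ 𝟙 X ⁻¹ᵁ U c ⊓ V.U i) (h' : O ≤ V.U (r c) ⊓ V.U i) :
      (G c i).map (res h) = ((V.g (r c) i).map (res h')).submatrix e id := by
    rw [← Matrix.submatrix_map, map_res_res]
  have hg (c d : ι) (O : X.Opens) (h : O ≤ U c ⊓ U d) (h' : O ≤ V.U (r c) ⊓ V.U (r d)) :
      ((V.refine e ι U hU r hr).g c d).map (res h) =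
        ((V.g (r c) (r d)).map (res h')).submatrix e e := by
    exact (Matrix.submatrix_map _ _ _ _).symm.trans
      (congrArg (fun M : Matrix n n Γ(X, O) => M.submatrix e e)
        (map_res_res (inf_le_inf (hr c) (hr d)) h (V.g (r c) (r d))))
  let hom : BundleHom (V.refine e ι U hU r hr) V :=
    { mat := F
      compat := fun i j c d O h₁ h₂ h₃ h₄ => by
        have k₁ : O ≤ V.U i ⊓ V.U j := h₁
        have k₂ : O ≤ U c ⊓ U d := h₂
        have k₃ : O ≤ V.U i ⊓ V.U (r c) := le_inf (k₁.trans inf_le_left)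
          ((k₂.trans inf_le_left).trans (hr c))
        have k₄ : O ≤ V.U j ⊓ V.U (r d) := le_inf (k₁.trans inf_le_right)
          ((k₂.trans inf_le_right).trans (hr d))
        have k₅ : O ≤ V.U (r c) ⊓ V.U (r d) := le_inf (k₃.trans inf_le_right)
          (k₄.trans inf_le_right)
        have k₆ : O ≤ V.U i ⊓ V.U (r d) := le_inf (k₃.trans inf_le_left) (k₄.trans inf_le_right)
        refine (congrArg₂ (· * ·) (map_pull_id h₁ _) (hF j d O h₄ k₄)).trans ?_
        refine Eq.trans ?_ (congrArg₂ (· * ·) (hF i c O h₃ k₃) (hg c d O h₂ k₅)).symm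
        rw [Matrix.submatrix_mul_equiv, V.g_mul _ _ _ _ k₃ k₅ k₆, ← V.g_mul i j (r d) O k₁ k₄ k₆]
        rfl }
  let inv : BundleHom V (V.refine e ι U hU r hr) :=
    { mat := G
      compat := fun c d i j O h₁ h₂ h₃ h₄ => by
        have k₁ : O ≤ U c ⊓ U d := h₁
        have k₂ : O ≤ V.U i ⊓ V.U j := h₂
        have k₃ : O ≤ V.U (r c) ⊓ V.U i := le_inf ((k₁.trans inf_le_left).trans (hr c))
          (k₂.trans inf_le_left)
        have k₄ : O ≤ V.U (r d) ⊓ V.U j := le_inf ((k₁.trans inf_le_right).trans (hr d))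
          (k₂.trans inf_le_right)
        have k₅ : O ≤ V.U (r c) ⊓ V.U (r d) := le_inf (k₃.trans inf_le_left)
          (k₄.trans inf_le_left)
        have k₆ : O ≤ V.U (r c) ⊓ V.U j := le_inf (k₃.trans inf_le_left) (k₄.trans inf_le_right)
        refine (congrArg₂ (· * ·) ((map_pull_id h₁ _).trans (hg c d O h₁ k₅)) (hG d j O h₄ k₄)).trans ?_
        refine Eq.trans ?_ (congrArg (fun M => M * _) (hG c i O h₃ k₃)).symm
        rw [Matrix.submatrix_mul_equiv, V.g_mul _ _ _ _ k₅ k₄ k₆, ← V.g_mul (r c) i j O k₃ k₂ k₆]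
        rfl }
  refine ⟨⟨hom, inv, ⟨Category.id_comp _, fun c i d O h₁ h₂ h₃ => ?_⟩,
    ⟨Category.id_comp _, fun i c j O h₁ h₂ h₃ => ?_⟩⟩⟩
  · have k₁ : O ≤ U c ⊓ V.U i := h₁
    have k₂ : O ≤ V.U i ⊓ U d := h₂
    have k₃ : O ≤ V.U (r c) ⊓ V.U i := le_inf ((k₁.trans inf_le_left).trans (hr c))
      (k₁.trans inf_le_right)
    have k₄ : O ≤ V.U i ⊓ V.U (r d) := le_inf (k₁.trans inf_le_right)
      ((k₂.trans inf_le_right).trans (hr d))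
    have k₅ : O ≤ V.U (r c) ⊓ V.U (r d) := le_inf (k₃.trans inf_le_left) (k₄.trans inf_le_right)
    refine (hg c d O h₃ k₅).trans (Eq.trans ?_ (congrArg₂ (· * ·)
      ((map_pull_id h₁ _).trans (hG c i O h₁ k₃)) (hF i d O h₂ k₄)).symm)
    rw [← V.g_mul _ _ _ O k₃ k₄ k₅]
    rfl
  · have k₁ : O ≤ V.U i ⊓ U c := h₁
    have k₂ : O ≤ U c ⊓ V.U j := h₂
    have k₃ : O ≤ V.U i ⊓ V.U (r c) := le_inf (k₁.trans inf_le_left)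
      ((k₁.trans inf_le_right).trans (hr c))
    have k₄ : O ≤ V.U (r c) ⊓ V.U j := le_inf (k₃.trans inf_le_right) (k₂.trans inf_le_right)
    have k₅ : O ≤ V.U i ⊓ V.U j := le_inf (k₃.trans inf_le_left) (k₄.trans inf_le_right)
    refine Eq.trans ?_ (congrArg₂ (· * ·)
      ((map_pull_id h₁ _).trans (hF i c O h₁ k₃)) (hG c j O h₂ k₄)).symm
    change (V.g i j).map (res (O := O) h₃) = _ * _
    rw [Matrix.submatrix_mul_equiv, V.g_mul _ _ _ O k₃ k₄ k₅]
    rfl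

end Charts

/-! ### Points of the fibres of `π` and transition between coordinates. -/

section AffineBundle

variable {k m l : Type} [Fintype k] [DecidableEq k] [Fintype m] [DecidableEq m]
  [Fintype l] [DecidableEq l] {T X : Scheme.{u}} {K : VectorBundle X k} {V : VectorBundle X m}
  {W : VectorBundle X l} {φ : BundleHom K V} {ρ : BundleHom V W} {s : ℕ}

namespace Projection

variable (D : Projection ρ s) (L L' : LocalSplitting φ ρ) (a a' : D.GW.S.ι)

/-- The plane with coordinates `x` is spanned by `B = F * x + σ * A`, where `A` is the frame on the
Grassmannian of `W`. Then `P * B = A`, so `B` spans an `s`-plane on which `ρ` is injective, with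
image the given plane; and `θ * B = x`. -/
lemma exists_hom (f : T ⟶ D.GW.G) (hf : ⊤ ≤ f ⁻¹ᵁ D.base L a) (x : Matrix k (Fin s) Γ(T, ⊤)) :
    ∃ h : T ⟶ D.E, h ≫ D.π = f ∧ ∀ hh : ⊤ ≤ h ⁻¹ᵁ (D.π ⁻¹ᵁ D.base L a),
      (D.coord L a).map (pull h hh) = x := by
  have leV := L.leV
  have leW := L.leW
  have hL : ⊤ ≤ (f ≫ D.GW.ν) ⁻¹ᵁ L.O := fun y hy => D.base_le L a (hf hy)
  have hV : ⊤ ≤ (f ≫ D.GW.ν) ⁻¹ᵁ V.U L.i := fun y hy => L.leV (hL hy)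
  have hW : ⊤ ≤ (f ≫ D.GW.ν) ⁻¹ᵁ (𝟙 X ⁻¹ᵁ W.U L.w ⊓ V.U L.i) :=
    fun y hy => ⟨L.leW (hL hy), hV hy⟩
  let B : Matrix m (Fin s) Γ(T, ⊤) := L.F.map (pull (f ≫ D.GW.ν) hL) * x +
    L.σ.map (pull (f ≫ D.GW.ν) hL) * (D.frame L a).map (pull f hf)
  have hPB : L.P.map (pull (f ≫ D.GW.ν) hL) * B = (D.frame L a).map (pull f hf) := by
    rw [Matrix.mul_add, ← Matrix.mul_assoc, ← Matrix.mul_assoc, ← map_pull_mul, ← map_pull_mul,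
      L.P_mul_F, L.P_mul_σ, map_pull_one, Matrix.one_mul, Matrix.map_zero _ (map_zero _),
      Matrix.zero_mul, zero_add]
  have hθB : L.θ.map (pull (f ≫ D.GW.ν) hL) * B = x := by
    rw [Matrix.mul_add, ← Matrix.mul_assoc, ← Matrix.mul_assoc, ← map_pull_mul, ← map_pull_mul,
      L.θ_mul_F, L.θ_mul_σ, map_pull_one, Matrix.one_mul, Matrix.map_zero _ (map_zero _),
      Matrix.zero_mul, add_zero]
  have hsplit := D.locSplit_frame L a f hf
  have hB : LocSplit B := LocSplit.of_mul (A := L.P.map (pull (f ≫ D.GW.ν) hL)) (hPB ▸ hsplit)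
  obtain ⟨h₀, e₀, hfr⟩ := D.GV.exists_hom hV hB
  have hin : ⊤ ≤ h₀ ⁻¹ᵁ D.d.injLocus := fun y hy => by
    have := hfr.push D.isComp_d L.w e₀ hW
    rw [L.pull_P _ hL hW, hPB] at this
    exact this.mem_injLocus hsplit hy
  obtain ⟨h, rfl⟩ := exists_lift_opens D.d.injLocus h₀ hin
  have hπ : h ≫ D.π = f := by
    refine D.GW.hom_ext ?_ fun y => ⟨⊤, trivial, L.w, _, ?_, D.isFrame_frame L a f hf⟩
    · rw [Category.assoc, D.π_ν, ← Category.assoc, e₀]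
    · have := D.push h L hfr e₀ hL
      rwa [hPB] at this
  refine ⟨h, hπ, fun hh => ?_⟩
  have hν : h ≫ D.q ≫ D.GV.ν = f ≫ D.GW.ν := by rw [← Category.assoc]; exact e₀
  have hL' : ⊤ ≤ (h ≫ D.q ≫ D.GV.ν) ⁻¹ᵁ L.O := by rw [hν]; exact hL
  have hb : ⊤ ≤ (h ≫ D.π) ⁻¹ᵁ D.base L a := hh
  rw [D.pull_coord hh hL', D.pull_lift_eq hh hL' hb hfr (by
    rw [map_pull_congr hν hL' hL, hPB, map_pull_congr hπ hb hf]), map_pull_congr hν hL' hL, hθB]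

/-- The lifted frame is recovered from its coordinates and from the frame of the image plane, so
both morphisms have the same frame. -/
lemma hom_ext (f g : T ⟶ D.E) (hf : ⊤ ≤ f ⁻¹ᵁ (D.π ⁻¹ᵁ D.base L a))
    (hg : ⊤ ≤ g ⁻¹ᵁ (D.π ⁻¹ᵁ D.base L a)) (e : f ≫ D.π = g ≫ D.π)
    (h : (D.coord L a).map (pull f hf) = (D.coord L a).map (pull g hg)) : f = g := by
  have hν : f ≫ D.q ≫ D.GV.ν = g ≫ D.q ≫ D.GV.ν := by
    rw [← D.π_ν, ← Category.assoc, e, Category.assoc]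
  have hfL : ⊤ ≤ (f ≫ D.q ≫ D.GV.ν) ⁻¹ᵁ L.O := fun y hy => D.preimage_le L a (hf hy)
  have hgL : ⊤ ≤ (g ≫ D.q ≫ D.GV.ν) ⁻¹ᵁ L.O := fun y hy => D.preimage_le L a (hg hy)
  have hfb : ⊤ ≤ (f ≫ D.π) ⁻¹ᵁ D.base L a := hf
  have hgb : ⊤ ≤ (g ≫ D.π) ⁻¹ᵁ D.base L a := hg
  have hl : (D.lift L a).map (pull f hf) = (D.lift L a).map (pull g hg) := by
    rw [D.pull_lift hf hfL hfb, D.pull_lift hg hgL hgb, h, map_pull_congr hν hfL hgL,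
      map_pull_congr hν hfL hgL, map_pull_congr e hfb hgb]
  rw [← cancel_mono D.q]
  refine D.GV.hom_ext ?_ fun y => ⟨⊤, trivial, L.i, _, (D.isFrame_lift L a).pull f hf, ?_⟩
  · rw [Category.assoc, hν, Category.assoc]
  · rw [hl]
    exact (D.isFrame_lift L a).pull g hg

/-- The translation parts of the transition functions. -/
lemma exists_translation : ∃ t : Matrix k (Fin s) Γ(D.GW.G, D.base L a ⊓ D.base L' a'),
    ∀ {T : Scheme.{u}} (h : T ⟶ D.E) (O : T.Opens) (hO : O ≤ h ⁻¹ᵁ (D.π ⁻¹ᵁ D.base L a))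
      (hO' : O ≤ h ⁻¹ᵁ (D.π ⁻¹ᵁ D.base L' a'))
      (h₁ : O ≤ (h ≫ D.π) ⁻¹ᵁ (D.GW.ν ⁻¹ᵁ (K.U L.κ ⊓ K.U L'.κ)))
      (h₂ : O ≤ (h ≫ D.π) ⁻¹ᵁ (D.GW.S.U a' ⊓ D.GW.S.U a))
      (h₃ : O ≤ (h ≫ D.π) ⁻¹ᵁ (D.base L a ⊓ D.base L' a')),
      (D.coord L a).map (pull h hO) = ((K.pullback D.GW.ν).g L.κ L'.κ).map (pull (h ≫ D.π) h₁) *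
        (D.coord L' a').map (pull h hO') * (D.GW.S.g a' a).map (pull (h ≫ D.π) h₂) +
          t.map (pull (h ≫ D.π) h₃) := by
  let B : D.GW.G.Opens := D.base L a ⊓ D.base L' a'
  have leV := L.leV
  have leW := L.leW
  have leK := L.leK
  have leV' := L'.leV
  have leW' := L'.leW
  have leK' := L'.leK
  have b₁ : B ≤ D.GW.ν ⁻¹ᵁ L.O := fun y hy => D.base_le L a hy.1
  have b₂ : B ≤ D.GW.ν ⁻¹ᵁ L'.O := fun y hy => D.base_le L' a' hy.2
  have b₃ : B ≤ D.GW.ν ⁻¹ᵁ (V.U L.i ⊓ V.U L'.i) := sub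
  have b₄ : B ≤ D.base L' a' := inf_le_right
  have b₅ : B ≤ D.GW.S.U a' ⊓ D.GW.S.U a := fun y hy => ⟨hy.2.2, hy.1.2⟩
  -- This is the contribution of the summand `σ' * A'` of the second lifted frame, which involves
  -- only functions on the Grassmannian of `W`.
  refine ⟨L.θ.map (pull D.GW.ν b₁) * ((V.g L.i L'.i).map (pull D.GW.ν b₃) *
    (L'.σ.map (pull D.GW.ν b₂) * (D.frame L' a').map (res b₄)) * (D.GW.S.g a' a).map (res b₅)),
    fun {T} h O hO hO' h₁ h₂ h₃ => ?_⟩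
  have hν : (h ≫ D.π) ≫ D.GW.ν = h ≫ D.q ≫ D.GV.ν := by rw [Category.assoc, D.π_ν]
  have hνq : (h ≫ D.q) ≫ D.GV.ν = h ≫ D.q ≫ D.GV.ν := Category.assoc _ _ _
  have hL : O ≤ (h ≫ D.q ≫ D.GV.ν) ⁻¹ᵁ L.O := fun y hy => D.preimage_le L a (hO hy)
  have hL' : O ≤ (h ≫ D.q ≫ D.GV.ν) ⁻¹ᵁ L'.O := fun y hy => D.preimage_le L' a' (hO' hy)
  have hb : O ≤ (h ≫ D.π) ⁻¹ᵁ D.base L a := hO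
  have hb' : O ≤ (h ≫ D.π) ⁻¹ᵁ D.base L' a' := hO'
  have hV : O ≤ (h ≫ D.q ≫ D.GV.ν) ⁻¹ᵁ (V.U L.i ⊓ V.U L'.i) :=
    fun y hy => ⟨leV (hL hy), leV' (hL' hy)⟩
  have hW : O ≤ (h ≫ D.q ≫ D.GV.ν) ⁻¹ᵁ (W.U L.w ⊓ W.U L'.w) :=
    fun y hy => ⟨leW (hL hy), leW' (hL' hy)⟩
  have hK : O ≤ (h ≫ D.q ≫ D.GV.ν) ⁻¹ᵁ (K.U L.κ ⊓ K.U L'.κ) :=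
    fun y hy => ⟨leK (hL hy), leK' (hL' hy)⟩
  have hW' : O ≤ ((h ≫ D.π) ≫ D.GW.ν) ⁻¹ᵁ (W.U L.w ⊓ W.U L'.w) := by
    rw [hν]
    exact hW
  have hu : IsUnit ((D.GW.S.g a' a).map (pull (h ≫ D.π) h₂)) := D.GW.S.isUnit_pull_g _ _ _ _
  have hfr := ((D.isFrame_lift L' a').pull h hO').change (i := L.i) hνq hV hu
  have hframe : (D.frame L a).map (pull (h ≫ D.π) hb) =
      (W.g L.w L'.w).map (pull (h ≫ D.q ≫ D.GV.ν) hW) *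
        (D.frame L' a').map (pull (h ≫ D.π) hb') *
          (D.GW.S.g a' a).map (pull (h ≫ D.π) h₂) := by
    have c₁ : O ≤ (h ≫ D.π) ⁻¹ᵁ (D.GW.ν ⁻¹ᵁ W.U L.w ⊓ D.GW.S.U a) :=
      fun y hy => D.base_le' L a (hb hy)
    have c₂ : O ≤ (h ≫ D.π) ⁻¹ᵁ (D.GW.ν ⁻¹ᵁ W.U L'.w ⊓ D.GW.S.U a') :=
      fun y hy => D.base_le' L' a' (hb' hy)
    have c₃ : O ≤ (h ≫ D.π) ⁻¹ᵁ (D.GW.ν ⁻¹ᵁ W.U L'.w ⊓ D.GW.S.U a) :=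
      fun y hy => ⟨(c₂ hy).1, (c₁ hy).2⟩
    simp only [frame, map_pull_res]
    rw [D.GW.incl.pull_mat_target (h ≫ D.π) L.w L'.w a c₁ hW' c₃,
      D.GW.incl.pull_mat_source (h ≫ D.π) L'.w a' a c₃ c₂ h₂, map_pull_congr hν hW' hW,
      Matrix.mul_assoc]
  -- The first lifted frame is the second one, moved by the transition functions of `V` and `S`:
  -- both are frames of the plane with the same image under `P`.
  have key := D.pull_lift_eq hO hL hb hfr (by
    rw [← Matrix.mul_assoc, ← Matrix.mul_assoc, L.P_mul_g L' _ hL hL' hV hW,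
      Matrix.mul_assoc (Matrix.map _ _) (L'.P.map _), D.P_mul_pull_lift hO' hL' hb', hframe])
  have eK : ((K.pullback D.GW.ν).g L.κ L'.κ).map (pull (h ≫ D.π) h₁) =
      (K.g L.κ L'.κ).map (pull (h ≫ D.q ≫ D.GV.ν) hK) := by
    have hK' : O ≤ ((h ≫ D.π) ≫ D.GW.ν) ⁻¹ᵁ (K.U L.κ ⊓ K.U L'.κ) := h₁
    rw [← map_pull_congr hν hK' hK]
    exact map_pull_pull _ _ _ _ _
  -- The linear part: the transition function of `V` takes `F'` to `F` times that of `K`, and `θ * F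
  -- = 1` leaves the latter.
  have eθF : L.θ.map (pull (h ≫ D.q ≫ D.GV.ν) hL) *
      ((V.g L.i L'.i).map (pull (h ≫ D.q ≫ D.GV.ν) hV) *
        L'.F.map (pull (h ≫ D.q ≫ D.GV.ν) hL')) =
      (K.g L.κ L'.κ).map (pull (h ≫ D.q ≫ D.GV.ν) hK) := by
    rw [L.g_mul_F L' _ hL hL' hV hK, ← Matrix.mul_assoc, ← map_pull_mul, L.θ_mul_F, map_pull_one,
      Matrix.one_mul]
  have d₁ : O ≤ ((h ≫ D.π) ≫ D.GW.ν) ⁻¹ᵁ L.O := by rw [hν]; exact hL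
  have d₂ : O ≤ ((h ≫ D.π) ≫ D.GW.ν) ⁻¹ᵁ L'.O := by rw [hν]; exact hL'
  have d₃ : O ≤ ((h ≫ D.π) ≫ D.GW.ν) ⁻¹ᵁ (V.U L.i ⊓ V.U L'.i) := by rw [hν]; exact hV
  rw [D.pull_coord hO hL, key, D.pull_lift hO' hL' hb', eK, ← eθF]
  simp only [map_pull_mul, map_pull_pull, map_pull_res]
  rw [map_pull_congr hν d₁ hL, map_pull_congr hν d₂ hL', map_pull_congr hν d₃ hV]
  simp only [Matrix.mul_add, Matrix.add_mul, Matrix.mul_assoc]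

end Projection

end AffineBundle

/-! ### Assembly of the affine linear bundle. -/

section Conclusion

variable {k m l n : Type} [Fintype k] [DecidableEq k] [Fintype m] [DecidableEq m]
  [Fintype l] [DecidableEq l] [Fintype n] [DecidableEq n] {X : Scheme.{u}}
  {K : VectorBundle X k} {V : VectorBundle X m} {W : VectorBundle X l} {φ : BundleHom K V}
  {ρ : BundleHom V W} {s : ℕ}

/-- Rewrites the two-sided multiplication as one matrix acting on the vector of entries of `Y`, in
the form of the transition functions of `VectorBundle.hom`. -/
lemma mul_mul_apply {R ι : Type*} [CommRing R] [Fintype ι] (A : Matrix k k R) (Y : Matrix k ι R)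
    (B : Matrix ι ι R) (p : k × ι) :
    (A * Y * B) p.1 p.2 = ∑ q : k × ι, A p.1 q.1 * B q.2 p.2 * Y q.1 q.2 := by
  simp only [Matrix.mul_apply, Finset.sum_mul]
  rw [Finset.sum_comm, Fintype.sum_prod_type]
  exact Finset.sum_congr rfl fun _ _ => Finset.sum_congr rfl fun _ _ => by ring

namespace Projection

variable (D : Projection ρ s)

lemma iSup_base (hex : ShortExact φ ρ) :
    ⨆ c : LocalSplitting φ ρ × D.GW.S.ι, D.base c.1 c.2 = ⊤ := top_le_iff.mp fun x _ => by
  obtain ⟨κ, hκ⟩ := K.exists_mem (D.GW.ν x)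
  obtain ⟨i, hi⟩ := V.exists_mem (D.GW.ν x)
  obtain ⟨w, hw⟩ := W.exists_mem (D.GW.ν x)
  obtain ⟨L, -, -, -, hL⟩ := hex.exists_localSplitting hκ hi hw
  obtain ⟨a, ha⟩ := D.GW.S.exists_mem x
  exact Opens.mem_iSup.mpr ⟨(L, a), hL, ha⟩

lemma base_le_hom (c : LocalSplitting φ ρ × D.GW.S.ι) : D.base c.1 c.2 ≤
    (D.GW.S.hom (K.pullback D.GW.ν)).U (c.1.κ, c.2) := fun _ hx => ⟨c.1.leK hx.1, hx.2⟩

/-- The bundle `Hom(S, ν^* K)`, with respect to the cover by the open sets `base`. -/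
abbrev assoc (hex : ShortExact φ ρ) (e : n ≃ k × Fin s) : VectorBundle D.GW.G n :=
  (D.GW.S.hom (K.pullback D.GW.ν)).refine e (LocalSplitting φ ρ × D.GW.S.ι)
    (fun c => D.base c.1 c.2) (D.iSup_base hex) (fun c => (c.1.κ, c.2)) D.base_le_hom

lemma isIso_chart_coord (c : LocalSplitting φ ρ × D.GW.S.ι) (e : n ≃ k × Fin s) :
    IsIso (chart D.π (D.base c.1 c.2) fun p => D.coord c.1 c.2 (e p).1 (e p).2) := by
  refine isIso_chart_of_existsUnique _ _ _ ?_ ?_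
  · intro T f hf y
    obtain ⟨h, hh, H⟩ := D.exists_hom c.1 c.2 f hf (Matrix.of fun p q => y (e.symm (p, q)))
    refine ⟨h, hh, fun hU p => (congrFun (congrFun (H hU) (e p).1) (e p).2).trans ?_⟩
    exact congrArg y (e.symm_apply_apply p)
  · intro T a b ha hb hab H
    refine D.hom_ext c.1 c.2 a b ha hb hab ?_
    ext p q
    have := H (e.symm (p, q))
    rwa [e.apply_symm_apply] at this

/-- The projection is an affine linear bundle with associated bundle `Hom(S, ν^* K)`. -/
theorem exists_affineLinearBundle (hex : ShortExact φ ρ) (e : n ≃ k × Fin s) :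
    ∃ A : AffineLinearBundle D.π n,
      Nonempty (BundleIso A.assoc (D.GW.S.hom (K.pullback D.GW.ν))) := by
  choose t ht using fun c d : LocalSplitting φ ρ × D.GW.S.ι =>
    D.exists_translation c.1 d.1 c.2 d.2
  refine ⟨{ assoc := D.assoc hex e
            x := fun c p => D.coord c.1 c.2 (e p).1 (e p).2
            isIso_chart := fun c => D.isIso_chart_coord c e
            t := fun c d p => t c d (e p).1 (e p).2
            transition := fun c d O h => ?_ },
    nonempty_bundleIso_refine _ _ _ _ _ _ D.base_le_hom⟩
  have hO : O ≤ D.π ⁻¹ᵁ (D.base c.1 c.2 ⊓ D.base d.1 d.2) := h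
  have hc : O ≤ 𝟙 D.E ⁻¹ᵁ (D.π ⁻¹ᵁ D.base c.1 c.2) := fun x hx => (hO hx).1
  have hd : O ≤ 𝟙 D.E ⁻¹ᵁ (D.π ⁻¹ᵁ D.base d.1 d.2) := fun x hx => (hO hx).2
  have h₁ : O ≤ D.π ⁻¹ᵁ (D.GW.ν ⁻¹ᵁ (K.U c.1.κ ⊓ K.U d.1.κ)) :=
    fun x hx => ⟨c.1.leK (hO hx).1.1, d.1.leK (hO hx).2.1⟩
  have h₂ : O ≤ D.π ⁻¹ᵁ (D.GW.S.U d.2 ⊓ D.GW.S.U c.2) := fun x hx => ⟨(hO hx).2.2, (hO hx).1.2⟩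
  -- The transition formula for arbitrary points is applied to the universal one, the identity of
  -- `E`.
  have key : (D.coord c.1 c.2).map (res hc) =
      ((K.pullback D.GW.ν).g c.1.κ d.1.κ).map (pull D.π h₁) * (D.coord d.1 d.2).map (res hd) *
        (D.GW.S.g d.2 c.2).map (pull D.π h₂) + (t c d).map (pull D.π hO) := by
    have := ht c d (𝟙 D.E) O hc hd h₁ h₂ hO
    rwa [map_pull_id, map_pull_id] at this
  funext p
  refine (congrFun (congrFun key (e p).1) (e p).2).trans ?_
  refine congrArg (fun z : Γ(D.E, O) => z + pull D.π hO (t c d (e p).1 (e p).2))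
    ((mul_mul_apply _ _ _ (e p)).trans ?_)
  rw [← Equiv.sum_comp e]
  refine Finset.sum_congr rfl fun q _ => ?_
  refine congrArg (fun z : Γ(D.E, O) => z * res hd (D.coord d.1 d.2 (e q).1 (e q).2))
    (Eq.symm ?_)
  refine (pull_res _ _ _ _).trans ((map_mul _ _ _).trans (congrArg₂ (· * ·) ?_ ?_))
  · exact pull_res _ _ _ _
  · exact pull_res _ _ _ _

end Projection

end Conclusion

end GrassBundle

end

open GrassBundle in
theorem proposition2p4 {X : Scheme.{u}} (N r s : ℕ) (hr : r ≤ N) (hs : s ≤ r)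
    (K : VectorBundle X (Fin (N - r))) (V : VectorBundle X (Fin N)) (W : VectorBundle X (Fin r))
    (φ : BundleHom K V) (ρ : BundleHom V W) (hex : ShortExact φ ρ) :
    Nonempty (Grassmannian V s) ∧ Nonempty (Grassmannian W s) ∧
    ∀ (GV : Grassmannian V s) (GW : Grassmannian W s),
      ∃ U : GV.G.Opens, (U : Set GV.G) = GV.transverse φ ∧
      ∃ π : U.toScheme ⟶ GW.G, IsProjection ρ GV GW U π ∧
        (∀ π' : U.toScheme ⟶ GW.G, IsProjection ρ GV GW U π' → π' = π) ∧
        ∃ E : AffineLinearBundle π (Fin (s * (N - r))),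
          Nonempty (BundleIso E.assoc (GW.S.hom (K.pullback GW.ν))) := by
  refine ⟨nonempty_grassmannian V s, nonempty_grassmannian W s, fun GV GW => ?_⟩
  -- The restriction of `ρ` to the tautological bundle; its locus of injectivity is the required
  -- open set.
  obtain ⟨d, hd⟩ := exists_isComp_of_eq (Category.comp_id GV.ν) GV.incl ρ
  obtain ⟨π, hπ, huniq, hν, hk⟩ := exists_isProjection GV GW hd
  exact ⟨d.injLocus, coe_injLocus_eq_transverse hex GV hd, π, hπ, huniq,
    Projection.exists_affineLinearBundle ⟨GV, GW, d, hd, π, hν, hk⟩ hex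
      -- The factors are exchanged because entries of a homomorphism from `S` to `K` are indexed by
      -- the coordinate of `K` first.
      (finProdFinEquiv.symm.trans (Equiv.prodComm _ _))⟩
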